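/- Let $n\ge 2$, let $\Omega\subset\mathbb{R}^n$ be a bounded domain (nonempty, open, connected) with $C^\infty$ boundary, outward unit normal $\nu$ and surface measure $\sigma$ on $\partial\Omega$, and let $m>0$. Write $\|v\|_2$ for the norm of $L^2(\Omega)$ and, for $v\in H^1(\Omega)$, $v\not\equiv0$, put $$R_m(v)=\frac{\int_\Omega|\nabla v|^2\,dx+\frac1m\left(\int_{\partial\Omega}|v|\,d\sigma\right)^2}{\int_\Omega v^2\,dx},$$ with boundary values understood in the sense of traces. Let $u_0\in C^1(\Omega)\cap L^\infty(\Omega)\cap H^1(\Omega)$, with boundary values on $\partial\Omega$ given by its trace, be strictly positive on $\overline\Omega$, and let $u_1,u_2,\dots\in C^2(\Omega)\cap C^1(\overline\Omega)$ be classical solutions of $$-\Delta u_{k+1}=R_m(u_k)\,u_k\ \text{ in }\Omega,\qquad u_{k+1}+h_k\,\partial_\nu u_{k+1}=0\ \text{ on }\partial\Omega,\qquad h_k:=\frac{m|u_k|}{\int_{\partial\Omega}|u_k|\,d\sigma}\qquad(k\ge0).$$ Then for all $k\ge0$: 1. $R_m(u_{k+1})\,\|u_{k+1}\|_2\le R_m(u_k)\,\|u_k\|_2$;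 2. $\|u_k\|_2\le\|u_{k+1}\|_2$; 3. $R_m(u_{k+1})\le R_m(u_k)$. Moreover, the sequence $(u_k)_{k\ge0}$ is bounded in $H^1(\Omega)$: there is a constant $C$ with $\|u_k\|_{H^1(\Omega)}\le C$ for all $k\ge 0$. -/

import Mathlib

open MeasureTheory Filter Topology Set
open scoped Gradient ContDiff Laplacian

noncomputable section

namespace OptimalInsulation

variable {n : ℕ}

/-- `ρ` is a smooth local defining function of `Ω` at `x`: near `x`, `Ω` is the set where
`ρ < 0`, and `∇ρ x ≠ 0`. -/
structure IsLocalDefiningFunction (Ω : Set (EuclideanSpace ℝ (Fin n)))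
    (x : EuclideanSpace ℝ (Fin n)) (ρ : EuclideanSpace ℝ (Fin n) → ℝ) : Prop where
  smooth : ContDiff ℝ ∞ ρ
  gradient_ne_zero : ∇ ρ x ≠ 0
  mem_iff : ∀ᶠ y in 𝓝 x, (y ∈ Ω ↔ ρ y < 0)

/-- A bounded domain (nonempty connected open set) with smooth boundary. -/
structure IsSmoothBoundedDomain (Ω : Set (EuclideanSpace ℝ (Fin n))) : Prop where
  isOpen : IsOpen Ω
  isConnected : IsConnected Ω
  isBounded : Bornology.IsBounded Ω
  smooth_boundary : ∀ x ∈ frontier Ω, ∃ ρ, IsLocalDefiningFunction Ω x ρ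

/-- `ν` is the outward unit normal of `Ω` at the boundary point `x`. -/
def IsOuterUnitNormal (Ω : Set (EuclideanSpace ℝ (Fin n)))
    (x ν : EuclideanSpace ℝ (Fin n)) : Prop :=
  ∃ ρ, IsLocalDefiningFunction Ω x ρ ∧ ν = ‖∇ ρ x‖⁻¹ • ∇ ρ x

/-- Surface measure on `∂Ω`: the `(n-1)`-dimensional Hausdorff measure, normalized to agree with
Lebesgue measure on `(n-1)`-dimensional Euclidean space. -/
def surfaceMeasure (Ω : Set (EuclideanSpace ℝ (Fin n))) :
    Measure (EuclideanSpace ℝ (Fin n)) :=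
  (μHE[n - 1]).restrict (frontier Ω)

/-- `v` belongs to `H¹(Ω)` and has the weak gradient `G`. -/
structure IsH1With (Ω : Set (EuclideanSpace ℝ (Fin n))) (v : EuclideanSpace ℝ (Fin n) → ℝ)
    (G : EuclideanSpace ℝ (Fin n) → EuclideanSpace ℝ (Fin n)) : Prop where
  memLp : MemLp v 2 (volume.restrict Ω)
  memLp_gradient : MemLp G 2 (volume.restrict Ω)
  weak_gradient : ∀ φ : EuclideanSpace ℝ (Fin n) → ℝ, ContDiff ℝ ∞ φ → HasCompactSupport φ →
    tsupport φ ⊆ Ω → ∫ x in Ω, v x • ∇ φ x = - ∫ x in Ω, φ x • G x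

/-- `v` belongs to `H¹(Ω)` and its trace on `∂Ω` is `g`: `v` is the `H¹(Ω)`-limit of functions
smooth up to the boundary whose boundary values converge to `g` in `L²(∂Ω)`. -/
def HasTrace (Ω : Set (EuclideanSpace ℝ (Fin n))) (v g : EuclideanSpace ℝ (Fin n) → ℝ) : Prop :=
  MemLp g 2 (surfaceMeasure Ω) ∧
  ∃ G, IsH1With Ω v G ∧
    ∃ φ : ℕ → EuclideanSpace ℝ (Fin n) → ℝ, (∀ j, ContDiff ℝ ∞ (φ j)) ∧
      Tendsto (fun j => eLpNorm (fun x => φ j x - v x) 2 (volume.restrict Ω)) atTop (𝓝 0) ∧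
      Tendsto (fun j => eLpNorm (fun x => ∇ (φ j) x - G x) 2 (volume.restrict Ω)) atTop (𝓝 0) ∧
      Tendsto (fun j => eLpNorm (fun x => φ j x - g x) 2 (surfaceMeasure Ω)) atTop (𝓝 0)

/-- The norm of `L²(Ω)`. -/
def l2Norm (Ω : Set (EuclideanSpace ℝ (Fin n))) (v : EuclideanSpace ℝ (Fin n) → ℝ) : ℝ :=
  Real.sqrt (∫ x in Ω, v x ^ 2)

/-- `v ∈ H¹(Ω)` with `‖v‖_{H¹(Ω)} ≤ C`. -/
def H1NormLE (Ω : Set (EuclideanSpace ℝ (Fin n))) (v : EuclideanSpace ℝ (Fin n) → ℝ)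
    (C : ℝ) : Prop :=
  ∃ G, IsH1With Ω v G ∧ Real.sqrt ((∫ x in Ω, v x ^ 2) + ∫ x in Ω, ‖G x‖ ^ 2) ≤ C

/-- The functional `R_m`, for `v` that is `C¹` in `Ω` (its classical gradient is then its weak
gradient) and whose values on `∂Ω` are its boundary values (its trace). -/
def rayleigh (Ω : Set (EuclideanSpace ℝ (Fin n))) (m : ℝ)
    (v : EuclideanSpace ℝ (Fin n) → ℝ) : ℝ :=
  ((∫ x in Ω, ‖∇ v x‖ ^ 2) + 1 / m * (∫ x, |v x| ∂(surfaceMeasure Ω)) ^ 2) / ∫ x in Ω, v x ^ 2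

/-- The insulation profile `m |v| / ∫_{∂Ω} |v| dσ` on `∂Ω`. -/
def profile (Ω : Set (EuclideanSpace ℝ (Fin n))) (m : ℝ) (v : EuclideanSpace ℝ (Fin n) → ℝ)
    (x : EuclideanSpace ℝ (Fin n)) : ℝ :=
  m * |v x| / ∫ y, |v y| ∂(surfaceMeasure Ω)

/-- `u ∈ C²(Ω) ∩ C¹(closure Ω)` solves `-Δu = f` in `Ω`, `u + h ∂_ν u = 0` on `∂Ω` classically.
On `∂Ω`, the gradient of `u` is the value of the continuous extension `G` of `∇u`. -/
def IsClassicalRobinSolution (Ω : Set (EuclideanSpace ℝ (Fin n)))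
    (h f u : EuclideanSpace ℝ (Fin n) → ℝ) : Prop :=
  ContDiffOn ℝ 2 u Ω ∧ ContinuousOn u (closure Ω) ∧
  (∀ x ∈ Ω, - (Δ u) x = f x) ∧
  ∃ G : EuclideanSpace ℝ (Fin n) → EuclideanSpace ℝ (Fin n),
    ContinuousOn G (closure Ω) ∧ (∀ x ∈ Ω, G x = ∇ u x) ∧
    ∀ x ∈ frontier Ω, ∀ ν, IsOuterUnitNormal Ω x ν → u x + h x * inner ℝ (G x) ν = 0

/-- `u 0, u 1, …` is a sequence of iterates: `u 0 ∈ C¹(Ω) ∩ L^∞(Ω) ∩ H¹(Ω)`, with boundary values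
in the sense of traces, is strictly positive on the closure of `Ω`, and `u (k+1)` is a classical
solution of the Robin problem with source `R_m(u_k) u_k` and insulation `h_k`. -/
structure IsIteration (Ω : Set (EuclideanSpace ℝ (Fin n))) (m : ℝ)
    (u : ℕ → EuclideanSpace ℝ (Fin n) → ℝ) : Prop where
  zero_contDiffOn : ContDiffOn ℝ 1 (u 0) Ω
  zero_bounded : ∃ M, ∀ x ∈ Ω, |u 0 x| ≤ M
  zero_trace : HasTrace Ω (u 0) (u 0)
  zero_pos : ∀ x ∈ closure Ω, 0 < u 0 x
  step : ∀ k, IsClassicalRobinSolution Ω (profile Ω m (u k))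
    (fun x => rayleigh Ω m (u k) * u k x) (u (k + 1))

end OptimalInsulation

end

/-! Write `u = u_k`, `w = u_{k+1}`, let `E` be the numerator of `R_m`, and let `I`, `J` be the
boundary integrals of `|u|`, `|w|`. The iteration rests on testing the equation for `w` with `u` and
with `w`.

Testing with `u`: the Robin condition gives `|u ∂_ν w| = I |w| / m`, so the boundary term costs at
most `I J / m`. Since `R_m(u) ∫ u² = E(u)`, this yields `E(u) ≤ ∫ ∇u·∇w + I J / m ≤ (E(u) + E(w)) /
2`, hence `E(u) ≤ E(w)`.

Testing with `w`: the profile `h` has integral at most `m`, so Cauchy-Schwarz with weight `h` gives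
`J² ≤ -m ∫ w ∂_ν w`, hence `E(w) ≤ R_m(u) ∫ u w ≤ R_m(u) ‖u‖ ‖w‖`.

Dividing by the norms gives the three monotonicity claims (`IsAdmissible.energy_le_and_le`,
`IsAdmissible.iteration_step`). For the `H¹` bound, a Friedrichs inequality with the `L¹` norm of
the boundary values bounds `R_m` below by some `1/C`. Thus `‖u_k‖ ≤ C R_m(u_k) ‖u_k‖ ≤ C R_m(u_0)
‖u_0‖` for `k ≥ 1`, and the gradient is controlled by `R_m(u_k) ‖u_k‖²`.

Most of the work is Green's identity with Hausdorff measure on the boundary. In a cylinder where `Ω`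
lies under a `b`-Lipschitz graph, Fubini turns the integral of the axial derivative into an integral
over the base, which differs from the surface integral by a relative error `O(b²)`. Taking the axis
normal and `b → 0` gives the normal component of Gauss' formula. Tilting the axis by `±a`,
subtracting and dividing by `a` gives the tangential ones, because the error is quadratic in `a`. A
partition of unity globalizes this, and small shifts into `Ω` extend it to fields that are merely
continuous up to the boundary and have bounded divergence.

The initial function only has a trace, whereas later iterates are `C¹` up to the boundary.
`IsAdmissible` collects what both share. -/

noncomputable section

namespace OptimalInsulation

variable {n : ℕ}

/-! ### Local defining functions and uniqueness of the outer normal. -/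

namespace IsLocalDefiningFunction

variable {Ω : Set (EuclideanSpace ℝ (Fin n))} {x : EuclideanSpace ℝ (Fin n)}
  {ρ : EuclideanSpace ℝ (Fin n) → ℝ}

theorem hasFDerivAt (h : IsLocalDefiningFunction Ω x ρ) (y : EuclideanSpace ℝ (Fin n)) :
    HasFDerivAt ρ (fderiv ℝ ρ y) y :=
  (h.smooth.differentiable (by simp) y).hasFDerivAt

theorem continuous_gradient (h : IsLocalDefiningFunction Ω x ρ) : Continuous (∇ ρ) := by
  have : Continuous (fderiv ℝ ρ) := h.smooth.continuous_fderiv (by simp)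
  exact (InnerProductSpace.toDual ℝ (EuclideanSpace ℝ (Fin n))).symm.continuous.comp this

theorem inner_gradient (_ : IsLocalDefiningFunction Ω x ρ) (y v : EuclideanSpace ℝ (Fin n)) :
    inner ℝ (∇ ρ y) v = fderiv ℝ ρ y v := by
  simp [gradient]

theorem lt_of_inner_gradient_pos (h : IsLocalDefiningFunction Ω x ρ)
    {s : Set (EuclideanSpace ℝ (Fin n))} (hs : Convex ℝ s) {y z : EuclideanSpace ℝ (Fin n)}
    (hy : y ∈ s) (hz : z ∈ s) (hpos : ∀ w ∈ s, 0 < inner ℝ (∇ ρ w) (z - y)) : ρ y < ρ z := by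
  obtain ⟨w, hw, hwe⟩ := domain_mvt (f := ρ) (f' := fun y => fderiv ℝ ρ y)
    (fun y _ => (h.hasFDerivAt y).hasFDerivWithinAt) hs hy hz
  have := hpos w (hs.segment_subset hy hz hw)
  rw [h.inner_gradient, ← hwe] at this
  linarith

/-- A ball on which the local description of `Ω` is valid. -/
theorem exists_ball (h : IsLocalDefiningFunction Ω x ρ) :
    ∃ R > 0, ∀ y ∈ Metric.ball x R, (y ∈ Ω ↔ ρ y < 0) := by
  obtain ⟨R, hR, h'⟩ := Metric.eventually_nhds_iff_ball.1 h.mem_iff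
  exact ⟨R, hR, h'⟩

theorem le_zero_of_mem_closure (h : IsLocalDefiningFunction Ω x ρ)
    {U : Set (EuclideanSpace ℝ (Fin n))} (hU : IsOpen U) (hUΩ : ∀ y ∈ U, (y ∈ Ω ↔ ρ y < 0))
    {y : EuclideanSpace ℝ (Fin n)} (hyU : y ∈ U) (hy : y ∈ closure Ω) : ρ y ≤ 0 := by
  have h1 : y ∈ closure (U ∩ Ω) := hU.inter_closure ⟨hyU, hy⟩
  have h2 : closure (U ∩ Ω) ⊆ {y | ρ y ≤ 0} :=
    closure_minimal (fun z hz => ((hUΩ z hz.1).1 hz.2).le)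
      (isClosed_le h.smooth.continuous continuous_const)
  exact h2 h1

theorem eq_zero_of_mem_frontier (h : IsLocalDefiningFunction Ω x ρ) (hΩ : IsOpen Ω)
    {U : Set (EuclideanSpace ℝ (Fin n))} (hU : IsOpen U) (hUΩ : ∀ y ∈ U, (y ∈ Ω ↔ ρ y < 0))
    {y : EuclideanSpace ℝ (Fin n)} (hyU : y ∈ U) (hy : y ∈ frontier Ω) : ρ y = 0 := by
  refine le_antisymm (h.le_zero_of_mem_closure hU hUΩ hyU (frontier_subset_closure hy)) ?_
  rw [hΩ.frontier_eq] at hy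
  exact not_lt.1 fun h0 => hy.2 ((hUΩ y hyU).2 h0)

theorem eventually_frontier (h : IsLocalDefiningFunction Ω x ρ) :
    ∀ᶠ y in 𝓝 x, IsLocalDefiningFunction Ω y ρ := by
  filter_upwards [h.mem_iff.eventually_nhds,
    h.continuous_gradient.continuousAt.eventually_ne h.gradient_ne_zero] with y h1 h2
  exact ⟨h.smooth, h2, h1⟩

theorem hasDerivAt_line (h : IsLocalDefiningFunction Ω x ρ) (v : EuclideanSpace ℝ (Fin n)) :
    HasDerivAt (fun t : ℝ => ρ (x + t • v)) (inner ℝ (∇ ρ x) v) 0 := by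
  rw [h.inner_gradient]
  have h1 : HasDerivAt (fun t : ℝ => x + t • v) v 0 := by
    simpa using ((hasDerivAt_id (0 : ℝ)).smul_const v).const_add x
  exact HasFDerivAt.comp_hasDerivAt (0 : ℝ) (f := fun t : ℝ => x + t • v) (l := ρ)
    (l' := fderiv ℝ ρ x) (by simpa using h.hasFDerivAt x) h1

theorem eventually_pos_of_inner_pos (h : IsLocalDefiningFunction Ω x ρ) (h0 : ρ x = 0)
    {v : EuclideanSpace ℝ (Fin n)} (hv : 0 < inner ℝ (∇ ρ x) v) :
    ∀ᶠ t in 𝓝[>] (0 : ℝ), 0 < ρ (x + t • v) := by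
  have h2 := (h.hasDerivAt_line v).hasDerivWithinAt (s := Ioi 0)
  rw [hasDerivWithinAt_iff_tendsto_slope] at h2
  have h3 : ∀ᶠ t in 𝓝[>] (0 : ℝ), 0 < slope (fun t : ℝ => ρ (x + t • v)) 0 t := by
    simpa using h2.eventually (lt_mem_nhds hv)
  filter_upwards [h3, self_mem_nhdsWithin] with t ht ht0
  simp only [slope_def_field, zero_smul, add_zero, h0, sub_zero] at ht
  exact (div_pos_iff_of_pos_right ht0).1 ht

theorem eventually_neg_of_inner_neg (h : IsLocalDefiningFunction Ω x ρ) (h0 : ρ x = 0)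
    {v : EuclideanSpace ℝ (Fin n)} (hv : inner ℝ (∇ ρ x) v < 0) :
    ∀ᶠ t in 𝓝[>] (0 : ℝ), ρ (x + t • v) < 0 := by
  have h2 := (h.hasDerivAt_line v).hasDerivWithinAt (s := Ioi 0)
  rw [hasDerivWithinAt_iff_tendsto_slope] at h2
  have h3 : ∀ᶠ t in 𝓝[>] (0 : ℝ), slope (fun t : ℝ => ρ (x + t • v)) 0 t < 0 := by
    simpa using h2.eventually (gt_mem_nhds hv)
  filter_upwards [h3, self_mem_nhdsWithin] with t ht ht0
  simp only [slope_def_field, zero_smul, add_zero, h0, sub_zero] at ht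
  by_contra hc
  exact absurd ht (not_lt.2 (div_nonneg (not_lt.1 hc) (le_of_lt ht0)))

/-- The outer unit normal does not depend on the local defining function. -/
theorem normal_unique (hΩ : IsOpen Ω) (hx : x ∈ frontier Ω) {ρ' : EuclideanSpace ℝ (Fin n) → ℝ}
    (h : IsLocalDefiningFunction Ω x ρ) (h' : IsLocalDefiningFunction Ω x ρ') :
    ‖∇ ρ x‖⁻¹ • ∇ ρ x = ‖∇ ρ' x‖⁻¹ • ∇ ρ' x := by
  have key : ∀ ρ₁ : EuclideanSpace ℝ (Fin n) → ℝ, IsLocalDefiningFunction Ω x ρ₁ → ρ₁ x = 0 := by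
    intro ρ₁ h₁
    obtain ⟨R, hR, hb⟩ := h₁.exists_ball
    exact h₁.eq_zero_of_mem_frontier hΩ Metric.isOpen_ball hb (Metric.mem_ball_self hR) hx
  set a := ∇ ρ x
  set b := ∇ ρ' x
  have ha : 0 < ‖a‖ := norm_pos_iff.2 h.gradient_ne_zero
  have hb : 0 < ‖b‖ := norm_pos_iff.2 h'.gradient_ne_zero
  by_contra hne
  have hlt : inner ℝ (‖a‖⁻¹ • a) (‖b‖⁻¹ • b) < 1 := by
    rw [inner_lt_one_iff_real_of_norm_eq_one]
    · exact hne
    · rw [norm_smul, norm_inv, norm_norm, inv_mul_cancel₀ ha.ne']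
    · rw [norm_smul, norm_inv, norm_norm, inv_mul_cancel₀ hb.ne']
  set c := inner ℝ (‖a‖⁻¹ • a) (‖b‖⁻¹ • b) with hc
  have hab : inner ℝ a b = ‖a‖ * ‖b‖ * c := by
    rw [hc, real_inner_smul_left, real_inner_smul_right]
    field_simp
  -- If the unit normals differ, their difference points into `Ω` according to `ρ` and out of `Ω`
  -- according to `ρ'`; a short step in this direction is contradictory.
  have h1 : inner ℝ a (‖b‖⁻¹ • b - ‖a‖⁻¹ • a) < 0 := by
    rw [inner_sub_right, real_inner_smul_right, real_inner_smul_right, hab,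
      real_inner_self_eq_norm_sq]
    have : ‖b‖⁻¹ * (‖a‖ * ‖b‖ * c) - ‖a‖⁻¹ * ‖a‖ ^ 2 = ‖a‖ * (c - 1) := by field_simp
    rw [this]
    exact mul_neg_of_pos_of_neg ha (by linarith)
  have h2 : 0 < inner ℝ b (‖b‖⁻¹ • b - ‖a‖⁻¹ • a) := by
    rw [inner_sub_right, real_inner_smul_right, real_inner_smul_right,
      real_inner_comm a b, hab, real_inner_self_eq_norm_sq]
    have : ‖b‖⁻¹ * ‖b‖ ^ 2 - ‖a‖⁻¹ * (‖a‖ * ‖b‖ * c) = ‖b‖ * (1 - c) := by field_simp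
    rw [this]
    exact mul_pos hb (by linarith)
  set v := ‖b‖⁻¹ • b - ‖a‖⁻¹ • a
  have e1 := h.eventually_neg_of_inner_neg (key ρ h) h1
  have hcont : Tendsto (fun t : ℝ => x + t • v) (𝓝[>] 0) (𝓝 x) := by
    have : Continuous (fun t : ℝ => x + t • v) := by fun_prop
    simpa using (this.tendsto 0).mono_left nhdsWithin_le_nhds
  have hpos := h'.eventually_pos_of_inner_pos (key ρ' h') h2
  obtain ⟨t, ht1, ht2, ht3, ht4⟩ := (e1.and (hpos.and ((hcont.eventually h.mem_iff).and
    (hcont.eventually h'.mem_iff)))).exists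
  exact absurd (ht4.1 (ht3.2 ht1)) (not_lt.2 ht2.le)

end IsLocalDefiningFunction

/-! ### The boundary as a Lipschitz graph over a hyperplane. -/

section Chart

variable {Ω : Set (EuclideanSpace ℝ (Fin n))} {x₀ e : EuclideanSpace ℝ (Fin n)}

/-- The cylinder with centre `x₀`, axis `e`, radius `r` and half-height `s`. -/
def cylinder (x₀ e : EuclideanSpace ℝ (Fin n)) (r s : ℝ) : Set (EuclideanSpace ℝ (Fin n)) :=
  {x | ‖(ℝ ∙ e)ᗮ.orthogonalProjectionOnto (x - x₀)‖ < r ∧ |inner ℝ e (x - x₀)| < s}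

/-- The point over `h` at height `t` in cylinder coordinates. -/
def chartPoint (x₀ e : EuclideanSpace ℝ (Fin n)) (h : (ℝ ∙ e)ᗮ) (t : ℝ) :
    EuclideanSpace ℝ (Fin n) :=
  x₀ + ((h : EuclideanSpace ℝ (Fin n)) + t • e)

/-- In a cylinder with axis `e`, the set `Ω` is the subgraph of the `b`-Lipschitz function `g`. -/
structure IsGraphChart (Ω : Set (EuclideanSpace ℝ (Fin n))) (x₀ e : EuclideanSpace ℝ (Fin n))
    (b r s : ℝ) (g : (ℝ ∙ e)ᗮ → ℝ) : Prop where
  norm_eq_one : ‖e‖ = 1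
  slope_pos : 0 < b
  radius_pos : 0 < r
  height_pos : 0 < s
  lipschitz : ∀ h ∈ Metric.ball (0 : (ℝ ∙ e)ᗮ) r, ∀ h' ∈ Metric.ball (0 : (ℝ ∙ e)ᗮ) r,
    |g h - g h'| ≤ b * ‖h - h'‖
  abs_lt : ∀ h ∈ Metric.ball (0 : (ℝ ∙ e)ᗮ) r, |g h| < s
  mem_iff : ∀ h ∈ Metric.ball (0 : (ℝ ∙ e)ᗮ) r, ∀ t, |t| < s →
    (chartPoint x₀ e h t ∈ Ω ↔ t < g h)
  mem_frontier_iff : ∀ h ∈ Metric.ball (0 : (ℝ ∙ e)ᗮ) r, ∀ t, |t| < s →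
    (chartPoint x₀ e h t ∈ frontier Ω ↔ t = g h)

theorem inner_coe_orthogonal (h : (ℝ ∙ e)ᗮ) :
    inner ℝ e (h : EuclideanSpace ℝ (Fin n)) = 0 :=
  Submodule.mem_orthogonal_singleton_iff_inner_right.1 h.2

theorem projection_chartPoint (h : (ℝ ∙ e)ᗮ) (t : ℝ) :
    (ℝ ∙ e)ᗮ.orthogonalProjectionOnto (chartPoint x₀ e h t - x₀) = h := by
  simp [chartPoint, Submodule.orthogonalProjectionOnto_orthogonalComplement_singleton_eq_zero]

theorem inner_chartPoint (he : ‖e‖ = 1) (h : (ℝ ∙ e)ᗮ) (t : ℝ) :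
    inner ℝ e (chartPoint x₀ e h t - x₀) = t := by
  simp [chartPoint, inner_add_right, inner_coe_orthogonal, real_inner_smul_right, he]

theorem chartPoint_projection (he : ‖e‖ = 1) (x : EuclideanSpace ℝ (Fin n)) :
    chartPoint x₀ e ((ℝ ∙ e)ᗮ.orthogonalProjectionOnto (x - x₀)) (inner ℝ e (x - x₀)) = x := by
  have h := (ℝ ∙ e).starProjection_add_starProjection_orthogonal (x - x₀)
  rw [Submodule.starProjection_unit_singleton ℝ he] at h
  rw [chartPoint, add_comm (Subtype.val _)]
  change x₀ + (_ + (ℝ ∙ e)ᗮ.starProjection (x - x₀)) = x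
  rw [h]; simp

theorem chartPoint_mem_cylinder (he : ‖e‖ = 1) {r s : ℝ} (h : (ℝ ∙ e)ᗮ) (t : ℝ) :
    chartPoint x₀ e h t ∈ cylinder x₀ e r s ↔ ‖h‖ < r ∧ |t| < s := by
  rw [cylinder, mem_ofPred_eq, projection_chartPoint, inner_chartPoint he]

theorem isOpen_cylinder (r s : ℝ) : IsOpen (cylinder x₀ e r s) := by
  refine (isOpen_lt (f := fun x => ‖(ℝ ∙ e)ᗮ.orthogonalProjectionOnto (x - x₀)‖) ?_
    continuous_const).inter (isOpen_lt (f := fun x => |inner ℝ e (x - x₀)|) ?_ continuous_const)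
  · fun_prop
  · fun_prop

theorem self_mem_cylinder {r s : ℝ} (hr : 0 < r) (hs : 0 < s) : x₀ ∈ cylinder x₀ e r s := by
  simp [cylinder, hr, hs]

theorem continuous_chartPoint :
    Continuous fun p : (ℝ ∙ e)ᗮ × ℝ => chartPoint x₀ e p.1 p.2 := by
  unfold chartPoint; fun_prop

theorem cylinder_subset_ball (he : ‖e‖ = 1) {r s : ℝ} :
    cylinder x₀ e r s ⊆ Metric.ball x₀ (r + s) := by
  intro x hx
  rw [← chartPoint_projection (x₀ := x₀) he x, chartPoint_mem_cylinder he] at hx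
  rw [← chartPoint_projection (x₀ := x₀) he x, Metric.mem_ball, dist_eq_norm, chartPoint,
    add_sub_cancel_left]
  refine (norm_add_le _ _).trans_lt (add_lt_add hx.1 ?_)
  rw [norm_smul, he, mul_one]
  exact hx.2

/-- The condition `hbe` is open, so it persists near `x₀`. There `ρ` increases strictly along every
displacement whose axial part exceeds `b` times its horizontal part. This makes the zero of `ρ` on
each vertical line unique and forces the Lipschitz constant `b`. The axis need not be the normal,
which is what permits tilted charts. -/
theorem exists_isGraphChart (hΩ : IsOpen Ω) (hx₀ : x₀ ∈ frontier Ω)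
    {ρ : EuclideanSpace ℝ (Fin n) → ℝ} (hρ : IsLocalDefiningFunction Ω x₀ ρ) (he : ‖e‖ = 1)
    {b : ℝ} (hb : 0 < b)
    (hbe : ‖∇ ρ x₀ - (inner ℝ (∇ ρ x₀) e : ℝ) • e‖ < b * inner ℝ (∇ ρ x₀) e) :
    ∃ r s g, IsGraphChart Ω x₀ e b r s g := by
  obtain ⟨R₁, hR₁, hball⟩ := hρ.exists_ball
  have hc := hρ.continuous_gradient
  have hev : ∀ᶠ x in 𝓝 x₀, ‖∇ ρ x - (inner ℝ (∇ ρ x) e : ℝ) • e‖ < b * inner ℝ (∇ ρ x) e :=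
    (isOpen_lt (by fun_prop) (by fun_prop)).mem_nhds hbe
  obtain ⟨R₂, hR₂, hcone⟩ := Metric.eventually_nhds_iff_ball.1 hev
  set R := min R₁ R₂
  have hR : 0 < R := lt_min hR₁ hR₂
  replace hball : ∀ y ∈ Metric.ball x₀ R, (y ∈ Ω ↔ ρ y < 0) := fun y hy =>
    hball y (Metric.ball_subset_ball (min_le_left _ _) hy)
  replace hcone : ∀ y ∈ Metric.ball x₀ R,
      ‖∇ ρ y - (inner ℝ (∇ ρ y) e : ℝ) • e‖ < b * inner ℝ (∇ ρ y) e := fun y hy =>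
    hcone y (Metric.ball_subset_ball (min_le_right _ _) hy)
  -- monotonicity in the cone around `e`
  have hmono : ∀ (h h' : (ℝ ∙ e)ᗮ) (t t' : ℝ), chartPoint x₀ e h t ∈ Metric.ball x₀ R →
      chartPoint x₀ e h' t' ∈ Metric.ball x₀ R → b * ‖h' - h‖ < t' - t →
      ρ (chartPoint x₀ e h t) < ρ (chartPoint x₀ e h' t') := by
    intro h h' t t' h1 h2 hlt
    refine hρ.lt_of_inner_gradient_pos (convex_ball x₀ R) h1 h2 fun w hw => ?_
    have hdiff : chartPoint x₀ e h' t' - chartPoint x₀ e h t =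
        ((h' - h : (ℝ ∙ e)ᗮ) : EuclideanSpace ℝ (Fin n)) + (t' - t) • e := by
      simp only [chartPoint, Submodule.coe_sub, sub_smul]; abel
    rw [hdiff, inner_add_right, real_inner_smul_right]
    have hg := hcone w hw
    set p : ℝ := inner ℝ (∇ ρ w) e
    have hp : 0 < p := pos_of_mul_pos_right ((norm_nonneg _).trans_lt hg) hb.le
    have h3 : inner ℝ (∇ ρ w) ((h' - h : (ℝ ∙ e)ᗮ) : EuclideanSpace ℝ (Fin n)) =
        inner ℝ (∇ ρ w - p • e) ((h' - h : (ℝ ∙ e)ᗮ) : EuclideanSpace ℝ (Fin n)) := by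
      rw [inner_sub_left, real_inner_smul_left, inner_coe_orthogonal, mul_zero, sub_zero]
    have h4 := (abs_le.1 (abs_real_inner_le_norm (∇ ρ w - p • e)
      ((h' - h : (ℝ ∙ e)ᗮ) : EuclideanSpace ℝ (Fin n)))).1
    rw [Submodule.norm_coe] at h4
    rw [h3]
    nlinarith [mul_le_mul_of_nonneg_right hg.le (norm_nonneg (h' - h)),
      mul_lt_mul_of_pos_right hlt hp]
  set s := R / 2 with hs_def
  -- The bound `R / 2` keeps the cylinder in the ball. The bound `s / b` makes the points at heights
  -- `±s` comparable with `x₀` in the cone order, so `ρ` changes sign on every vertical line.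
  set r := min (R / 2) (s / b) with hr_def
  have hs : 0 < s := by positivity
  have hr : 0 < r := by positivity
  have hin : ∀ h ∈ Metric.ball (0 : (ℝ ∙ e)ᗮ) r, ∀ t, |t| ≤ s →
      chartPoint x₀ e h t ∈ Metric.ball x₀ R := by
    intro h hh t ht
    rw [mem_ball_zero_iff] at hh
    rw [Metric.mem_ball, dist_eq_norm, chartPoint, add_sub_cancel_left]
    calc _ ≤ ‖(h : EuclideanSpace ℝ (Fin n))‖ + ‖t • e‖ := norm_add_le _ _
      _ = ‖h‖ + |t| := by rw [norm_smul, he, mul_one]; rfl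
      _ < R / 2 + R / 2 := add_lt_add_of_lt_of_le (hh.trans_le (min_le_left _ _)) ht
      _ = R := by ring
  have hbr : ∀ h ∈ Metric.ball (0 : (ℝ ∙ e)ᗮ) r, b * ‖h‖ < s := by
    intro h hh
    rw [mem_ball_zero_iff] at hh
    have := hh.trans_le (min_le_right _ _)
    rwa [lt_div_iff₀ hb, mul_comm] at this
  have h00 : chartPoint x₀ e 0 0 = x₀ := by simp [chartPoint]
  have hρ0 : ρ x₀ = 0 := hρ.eq_zero_of_mem_frontier hΩ Metric.isOpen_ball hball
    (Metric.mem_ball_self hR) hx₀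
  have hroot : ∀ h ∈ Metric.ball (0 : (ℝ ∙ e)ᗮ) r, ∃ t, |t| < s ∧ ρ (chartPoint x₀ e h t) = 0 := by
    intro h hh
    have hx : chartPoint x₀ e 0 0 ∈ Metric.ball x₀ R := by
      rw [h00]; exact Metric.mem_ball_self hR
    have hneg : ρ (chartPoint x₀ e h (-s)) < 0 := by
      have := hmono h 0 (-s) 0 (hin h hh _ (by rw [abs_neg, abs_of_pos hs])) hx
        (by simpa using hbr h hh)
      rwa [h00, hρ0] at this
    have hpos : 0 < ρ (chartPoint x₀ e h s) := by
      have := hmono 0 h 0 s hx (hin h hh _ (by rw [abs_of_pos hs])) (by simpa using hbr h hh)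
      rwa [h00, hρ0] at this
    have hcont : ContinuousOn (fun t => ρ (chartPoint x₀ e h t)) (Icc (-s) s) := by
      have : Continuous fun t : ℝ => chartPoint x₀ e h t :=
        continuous_chartPoint.comp (by fun_prop : Continuous fun t : ℝ => (h, t))
      exact (hρ.smooth.continuous.comp this).continuousOn
    obtain ⟨t, ht, ht0⟩ := intermediate_value_Ioo (by linarith) hcont
      (show (0 : ℝ) ∈ Ioo _ _ from ⟨hneg, hpos⟩)
    exact ⟨t, abs_lt.2 ht, ht0⟩
  choose! g hgs hg0 using hroot
  have hinΩ : ∀ h ∈ Metric.ball (0 : (ℝ ∙ e)ᗮ) r, ∀ t, |t| < s →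
      (chartPoint x₀ e h t ∈ Ω ↔ t < g h) := by
    intro h hh t ht
    rw [hball _ (hin h hh t ht.le)]
    constructor
    · intro hlt
      by_contra! hge
      rcases hge.eq_or_lt with heq | hgt
      · rw [← heq, hg0 h hh] at hlt; exact lt_irrefl _ hlt
      · have := hmono h h (g h) t (hin h hh _ (hgs h hh).le) (hin h hh t ht.le) (by simpa using hgt)
        rw [hg0 h hh] at this; linarith
    · intro hlt
      have := hmono h h t (g h) (hin h hh t ht.le) (hin h hh _ (hgs h hh).le) (by simpa using hlt)
      rwa [hg0 h hh] at this
  refine ⟨r, s, g, he, hb, hr, hs, ?_, hgs, hinΩ, ?_⟩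
  · intro h hh h' hh'
    have key : ∀ h ∈ Metric.ball (0 : (ℝ ∙ e)ᗮ) r, ∀ h' ∈ Metric.ball (0 : (ℝ ∙ e)ᗮ) r,
        g h - g h' ≤ b * ‖h - h'‖ := by
      intro h hh h' hh'
      by_contra! hlt
      have := hmono h' h (g h') (g h) (hin h' hh' _ (hgs h' hh').le) (hin h hh _ (hgs h hh).le) hlt
      rw [hg0 h hh, hg0 h' hh'] at this
      exact lt_irrefl _ this
    rw [abs_le]
    have h2 := key h' hh' h hh
    rw [norm_sub_rev] at h2
    exact ⟨by linarith, key h hh h' hh'⟩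
  · intro h hh t ht
    constructor
    · intro hf
      have h0 := hρ.eq_zero_of_mem_frontier hΩ Metric.isOpen_ball hball (hin h hh t ht.le) hf
      rcases lt_trichotomy t (g h) with hlt | heq | hgt
      · have := (hball _ (hin h hh t ht.le)).1 ((hinΩ h hh t ht).2 hlt); linarith
      · exact heq
      · have := hmono h h (g h) t (hin h hh _ (hgs h hh).le) (hin h hh t ht.le) (by simpa using hgt)
        rw [hg0 h hh] at this; linarith
    · rintro rfl
      rw [hΩ.frontier_eq]
      refine ⟨?_, fun hmem => lt_irrefl _ ((hinΩ h hh _ ht).1 hmem)⟩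
      have hcont : Continuous fun t : ℝ => chartPoint x₀ e h t :=
        continuous_chartPoint.comp (by fun_prop : Continuous fun t : ℝ => (h, t))
      refine mem_closure_of_tendsto (b := 𝓝[<] (g h))
        ((hcont.tendsto (g h)).mono_left nhdsWithin_le_nhds) ?_
      have hnear : ∀ᶠ t in 𝓝[<] (g h), |t| < s :=
        nhdsWithin_le_nhds ((isOpen_lt continuous_abs continuous_const).mem_nhds ht)
      filter_upwards [hnear, self_mem_nhdsWithin] with t h1 h2
      exact (hinΩ h hh t h1).2 h2

end Chart

/-! ### Fubini and surface measure in a graph chart. -/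

section Slicing

variable {Ω : Set (EuclideanSpace ℝ (Fin n))} {x₀ e : EuclideanSpace ℝ (Fin n)}

/-- Cylinder coordinates as a homeomorphism. -/
def chartHomeomorph (x₀ : EuclideanSpace ℝ (Fin n)) (he : ‖e‖ = 1) :
    (ℝ ∙ e)ᗮ × ℝ ≃ₜ EuclideanSpace ℝ (Fin n) where
  toFun p := chartPoint x₀ e p.1 p.2
  invFun x := ((ℝ ∙ e)ᗮ.orthogonalProjectionOnto (x - x₀), inner ℝ e (x - x₀))
  left_inv p := by simp [projection_chartPoint, inner_chartPoint he]
  right_inv x := chartPoint_projection he x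
  continuous_toFun := continuous_chartPoint
  continuous_invFun := by fun_prop

theorem measurePreserving_chartHomeomorph (x₀ : EuclideanSpace ℝ (Fin n)) (he : ‖e‖ = 1) :
    MeasurePreserving (chartHomeomorph x₀ he) (volume.prod volume) volume := by
  have h1 := ((ℝ ∙ e).measurePreserving_measurableEquivProd x₀).symm
  rw [InnerProductSpace.euclideanHausdorffMeasure_eq_volume, Measure.volume_eq_prod] at h1
  have h2 : MeasurePreserving
      (Prod.map (LinearIsometryEquiv.toSpanUnitSingleton (𝕜 := ℝ) e he) (id : (ℝ ∙ e)ᗮ → _))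
      (volume.prod volume) (volume.prod volume) :=
    (LinearIsometryEquiv.measurePreserving _).prod (MeasurePreserving.id _)
  have h3 := (h1.comp h2).comp
    (Measure.measurePreserving_swap (μ := (volume : Measure (ℝ ∙ e)ᗮ)) (ν := (volume : Measure ℝ)))
  have h4 : ⇑(chartHomeomorph x₀ he) = (((ℝ ∙ e).measurableEquivProd x₀).symm ∘
      Prod.map (LinearIsometryEquiv.toSpanUnitSingleton (𝕜 := ℝ) e he) id) ∘ Prod.swap := by
    funext p
    simp only [Function.comp, Submodule.measurableEquivProd_symm_apply, Prod.fst_swap,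
      Prod.snd_swap, Prod.map, id, LinearIsometryEquiv.toSpanUnitSingleton_apply, vadd_eq_add]
    change x₀ + (_ + _) = _
    abel
  rw [h4]
  exact h3

namespace IsGraphChart

variable {b r s : ℝ} {g : (ℝ ∙ e)ᗮ → ℝ}

theorem hasCompactSupport (hc : IsGraphChart Ω x₀ e b r s g) {f : EuclideanSpace ℝ (Fin n) → ℝ}
    (hfs : tsupport f ⊆ cylinder x₀ e r s) : HasCompactSupport f :=
  Metric.isCompact_of_isClosed_isBounded (isClosed_tsupport f)
    (Metric.isBounded_ball.subset (hfs.trans (cylinder_subset_ball hc.norm_eq_one)))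

theorem hasDerivAt_chartPoint {f : EuclideanSpace ℝ (Fin n) → ℝ} (hf : ContDiff ℝ 1 f)
    (h : (ℝ ∙ e)ᗮ) (t : ℝ) : HasDerivAt (fun t => f (chartPoint x₀ e h t))
      (fderiv ℝ f (chartPoint x₀ e h t) e) t := by
  have h1 : HasDerivAt (fun t : ℝ => chartPoint x₀ e h t) e t := by
    simpa [chartPoint] using
      (((hasDerivAt_id t).smul_const e).const_add (h : EuclideanSpace ℝ (Fin n))).const_add x₀
  exact HasFDerivAt.comp_hasDerivAt t
    (hf.differentiable one_ne_zero (chartPoint x₀ e h t)).hasFDerivAt h1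

/-- On each line parallel to `e` the fundamental theorem of calculus leaves only the value on the
graph, since `f` vanishes at the bottom of the cylinder. -/
theorem setIntegral_fderiv (hc : IsGraphChart Ω x₀ e b r s g) (hΩ : IsOpen Ω)
    {f : EuclideanSpace ℝ (Fin n) → ℝ} (hf : ContDiff ℝ 1 f)
    (hfs : tsupport f ⊆ cylinder x₀ e r s) :
    ∫ x in Ω, fderiv ℝ f x e = ∫ h in Metric.ball 0 r, f (chartPoint x₀ e h (g h)) := by
  have he := hc.norm_eq_one
  have hcs := hc.hasCompactSupport hfs
  have hcont : Continuous fun x => fderiv ℝ f x e :=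
    (hf.continuous_fderiv one_ne_zero).clm_apply continuous_const
  have hzero : ∀ x, x ∉ cylinder x₀ e r s → fderiv ℝ f x e = 0 := by
    intro x hx
    have : x ∉ tsupport (fderiv ℝ f) := fun h => hx (hfs (tsupport_fderiv_subset ℝ h))
    rw [image_eq_zero_of_notMem_tsupport this]; rfl
  have hint : Integrable (Ω.indicator fun x => fderiv ℝ f x e) :=
    (hcont.integrable_of_hasCompactSupport (hcs.fderiv_apply (𝕜 := ℝ) e)).indicator
      hΩ.measurableSet
  have hmp := measurePreserving_chartHomeomorph x₀ he
  have hemb := (chartHomeomorph x₀ he).measurableEmbedding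
  rw [← integral_indicator hΩ.measurableSet, ← hmp.integral_comp hemb, integral_prod,
    ← integral_indicator measurableSet_ball]
  swap
  · exact hmp.integrable_comp_of_integrable hint
  congr 1
  ext1 h
  simp only [chartHomeomorph, Homeomorph.homeomorph_mk_coe, Equiv.coe_fn_mk]
  by_cases hh : h ∈ Metric.ball (0 : (ℝ ∙ e)ᗮ) r
  · rw [indicator_of_mem hh]
    have hgh := _root_.abs_lt.1 (hc.abs_lt h hh)
    have hcyl : ∀ t, |t| < s ↔ chartPoint x₀ e h t ∈ cylinder x₀ e r s := fun t => by
      rw [chartPoint_mem_cylinder he]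
      exact ⟨fun h1 => ⟨mem_ball_zero_iff.1 hh, h1⟩, And.right⟩
    have heq : (fun t => Ω.indicator (fun x => fderiv ℝ f x e) (chartPoint x₀ e h t)) =
        (Ioo (-s) (g h)).indicator fun t => fderiv ℝ f (chartPoint x₀ e h t) e := by
      ext1 t
      by_cases ht : |t| < s
      · have h1 := hc.mem_iff h hh t ht
        simp only [indicator, h1, mem_Ioo, (_root_.abs_lt.1 ht).1, true_and]
      · have h1 := hzero _ (fun h2 => ht ((hcyl t).2 h2))
        simp [indicator, h1]
    rw [heq, integral_indicator measurableSet_Ioo, ← integral_Ioc_eq_integral_Ioo,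
      ← intervalIntegral.integral_of_le hgh.1.le,
      intervalIntegral.integral_eq_sub_of_hasDerivAt
        (fun t _ => hasDerivAt_chartPoint hf h t)]
    · have : chartPoint x₀ e h (-s) ∉ tsupport f := fun h2 => by
        have := (hcyl _).2 (hfs h2)
        rw [abs_neg, abs_of_pos hc.height_pos] at this
        exact lt_irrefl _ this
      rw [image_eq_zero_of_notMem_tsupport this, sub_zero]
    · refine Continuous.intervalIntegrable ?_ _ _
      exact hcont.comp (continuous_chartPoint.comp (by fun_prop : Continuous fun t : ℝ => (h, t)))
  · rw [indicator_of_notMem hh]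
    refine integral_eq_zero_of_ae (Eventually.of_forall fun t => ?_)
    have : chartPoint x₀ e h t ∉ cylinder x₀ e r s := fun h2 =>
      hh (mem_ball_zero_iff.2 ((chartPoint_mem_cylinder he h t).1 h2).1)
    simp [indicator, hzero _ this]

end IsGraphChart

theorem euclideanHausdorffMeasure_image_le {X Y : Type*} [EMetricSpace X] [MeasurableSpace X]
    [BorelSpace X] [EMetricSpace Y] [MeasurableSpace Y] [BorelSpace Y] {K : NNReal} {f : X → Y}
    {s : Set X} (h : LipschitzOnWith K f s) (d : ℕ) :
    (μHE[d] : Measure Y) (f '' s) ≤ (K : ENNReal) ^ d * (μHE[d] : Measure X) s := by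
  rw [Measure.euclideanHausdorffMeasure_def, Measure.euclideanHausdorffMeasure_def,
    Measure.smul_apply, Measure.smul_apply, ENNReal.smul_def, ENNReal.smul_def, smul_eq_mul,
    smul_eq_mul, mul_left_comm]
  gcongr
  simpa using h.hausdorffMeasure_image_le (d := d) (by positivity)

/-- For nonnegative functions the two integrals differ by at most `C - 1` times the smaller one. The
signed case follows from positive and negative parts. -/
theorem abs_integral_sub_le_of_le {X : Type*} [MeasurableSpace X] {μ ν : Measure X} {C : NNReal}
    (hC : 1 ≤ C) (h1 : μ ≤ ν) (h2 : ν ≤ C • μ) {φ : X → ℝ} (hφ : Integrable φ ν) :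
    |(∫ x, φ x ∂μ) - ∫ x, φ x ∂ν| ≤ ((C : ℝ) - 1) * ∫ x, |φ x| ∂ν := by
  have key : ∀ ψ : X → ℝ, Integrable ψ ν → (∀ x, 0 ≤ ψ x) →
      ∫ x, ψ x ∂μ ≤ ∫ x, ψ x ∂ν ∧
        ∫ x, ψ x ∂ν - ∫ x, ψ x ∂μ ≤ ((C : ℝ) - 1) * ∫ x, ψ x ∂ν := by
    intro ψ hψ h0
    have hle : ∫ x, ψ x ∂μ ≤ ∫ x, ψ x ∂ν :=
      integral_mono_measure h1 (Eventually.of_forall h0) hψ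
    have hle2 : ∫ x, ψ x ∂ν ≤ ∫ x, ψ x ∂(C • μ) :=
      integral_mono_measure h2 (Eventually.of_forall h0) ((hψ.mono_measure h1).smul_measure_nnreal)
    rw [integral_smul_nnreal_measure, NNReal.smul_def, smul_eq_mul] at hle2
    have : (1 : ℝ) ≤ C := by exact_mod_cast hC
    exact ⟨hle, by nlinarith⟩
  have hp := key (fun x => max (φ x) 0) hφ.pos_part (fun x => le_max_right _ _)
  have hn := key (fun x => max (-φ x) 0) hφ.neg_part (fun x => le_max_right _ _)
  have hφμ := hφ.mono_measure h1
  have e1 : ∀ x, φ x = max (φ x) 0 - max (-φ x) 0 := fun x => by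
    rcases le_total 0 (φ x) with h | h <;> simp [h]
  have e2 : ∀ x, |φ x| = max (φ x) 0 + max (-φ x) 0 := fun x => by
    rcases le_total 0 (φ x) with h | h <;> simp [h, abs_of_nonneg, abs_of_nonpos]
  have i1 : ∫ x, φ x ∂μ = ∫ x, max (φ x) 0 ∂μ - ∫ x, max (-φ x) 0 ∂μ := by
    rw [← integral_sub hφμ.pos_part hφμ.neg_part]; exact integral_congr_ae (.of_forall e1)
  have i2 : ∫ x, φ x ∂ν = ∫ x, max (φ x) 0 ∂ν - ∫ x, max (-φ x) 0 ∂ν := by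
    rw [← integral_sub hφ.pos_part hφ.neg_part]; exact integral_congr_ae (.of_forall e1)
  have i3 : ∫ x, |φ x| ∂ν = ∫ x, max (φ x) 0 ∂ν + ∫ x, max (-φ x) 0 ∂ν := by
    rw [← integral_add hφ.pos_part hφ.neg_part]; exact integral_congr_ae (.of_forall e2)
  rw [i1, i2, i3, abs_le]
  constructor <;> nlinarith [hp.1, hp.2, hn.1, hn.2]

namespace IsGraphChart

variable {b r s : ℝ} {g : (ℝ ∙ e)ᗮ → ℝ}

theorem finrank_orthogonal (hc : IsGraphChart Ω x₀ e b r s g) :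
    Module.finrank ℝ (ℝ ∙ e)ᗮ = n - 1 := by
  have h := (ℝ ∙ e).finrank_add_finrank_orthogonal
  have he : e ≠ 0 := by
    intro h0; have := hc.norm_eq_one; simp [h0] at this
  rw [finrank_span_singleton he, finrank_euclideanSpace_fin] at h
  omega

theorem volume_eq (hc : IsGraphChart Ω x₀ e b r s g) :
    (μHE[n - 1] : Measure (ℝ ∙ e)ᗮ) = volume := by
  rw [← hc.finrank_orthogonal]; exact InnerProductSpace.euclideanHausdorffMeasure_eq_volume

/-- By orthogonality the sharp constant would be `√(1 + b²)`. The cruder `1 + b²` suffices, since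
all that matters later is that the excess over `1` is quadratic in `b`. -/
theorem lipschitzOnWith (hc : IsGraphChart Ω x₀ e b r s g) :
    LipschitzOnWith (1 + b.toNNReal ^ 2) (fun h => chartPoint x₀ e h (g h))
      (Metric.ball 0 r) := by
  refine LipschitzOnWith.of_dist_le_mul fun h hh h' hh' => ?_
  have hdiff : chartPoint x₀ e h (g h) - chartPoint x₀ e h' (g h') =
      ((h - h' : (ℝ ∙ e)ᗮ) : EuclideanSpace ℝ (Fin n)) + (g h - g h') • e := by
    simp only [chartPoint, Submodule.coe_sub, sub_smul]; abel
  have hsq : ‖chartPoint x₀ e h (g h) - chartPoint x₀ e h' (g h')‖ ^ 2 =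
      ‖h - h'‖ ^ 2 + |g h - g h'| ^ 2 := by
    have hin : inner ℝ ((h - h' : (ℝ ∙ e)ᗮ) : EuclideanSpace ℝ (Fin n)) ((g h - g h') • e) = 0 := by
      rw [real_inner_smul_right, real_inner_comm, inner_coe_orthogonal, mul_zero]
    rw [hdiff, norm_add_sq_real, hin, norm_smul, hc.norm_eq_one]
    simp
  have hl := hc.lipschitz h hh h' hh'
  rw [dist_eq_norm, dist_eq_norm]
  refine (pow_le_pow_iff_left₀ (by positivity) (by positivity) two_ne_zero).1 ?_
  rw [hsq]
  have h3 : |g h - g h'| ^ 2 ≤ (b * ‖h - h'‖) ^ 2 := by gcongr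
  simp only [NNReal.coe_add, NNReal.coe_one, NNReal.coe_pow,
    Real.coe_toNNReal b hc.slope_pos.le]
  nlinarith [sq_nonneg (b * ‖h - h'‖), sq_nonneg (b ^ 2 * ‖h - h'‖)]

theorem image_graph (hc : IsGraphChart Ω x₀ e b r s g) (A : Set (ℝ ∙ e)ᗮ) :
    (fun h => chartPoint x₀ e h (g h)) '' (A ∩ Metric.ball 0 r) =
      (fun x => (ℝ ∙ e)ᗮ.orthogonalProjectionOnto (x - x₀)) ⁻¹' A ∩
        (cylinder x₀ e r s ∩ frontier Ω) := by
  ext x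
  constructor
  · rintro ⟨h, ⟨hA, hb⟩, rfl⟩
    refine ⟨?_, ?_, ?_⟩
    · rwa [mem_preimage, projection_chartPoint]
    · rw [chartPoint_mem_cylinder hc.norm_eq_one]
      exact ⟨mem_ball_zero_iff.1 hb, hc.abs_lt h hb⟩
    · exact (hc.mem_frontier_iff h hb _ (hc.abs_lt h hb)).2 rfl
  · rintro ⟨h1, h2, h3⟩
    have hx := chartPoint_projection (x₀ := x₀) hc.norm_eq_one x
    rw [← hx, hc.mem_frontier_iff _ (mem_ball_zero_iff.2 h2.1) _ h2.2] at h3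
    refine ⟨_, ⟨h1, mem_ball_zero_iff.2 h2.1⟩, ?_⟩
    simp only [← h3, hx]

theorem map_surfaceMeasure_apply (hc : IsGraphChart Ω x₀ e b r s g) {A : Set (ℝ ∙ e)ᗮ}
    (hA : MeasurableSet A) :
    ((surfaceMeasure Ω).restrict (cylinder x₀ e r s)).map
      (fun x => (ℝ ∙ e)ᗮ.orthogonalProjectionOnto (x - x₀)) A =
      (μHE[n - 1] : Measure (EuclideanSpace ℝ (Fin n)))
        ((fun h => chartPoint x₀ e h (g h)) '' (A ∩ Metric.ball 0 r)) := by
  have hm : Measurable fun x => (ℝ ∙ e)ᗮ.orthogonalProjectionOnto (x - x₀) :=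
    Continuous.measurable (by fun_prop)
  rw [Measure.map_apply hm hA, surfaceMeasure,
    Measure.restrict_restrict (isOpen_cylinder r s).measurableSet,
    Measure.restrict_apply (hm hA), hc.image_graph]

/-- Orthogonal projection is 1-Lipschitz and inverts the graph map, so the graph has at least the
measure of its shadow. The companion bound `map_surfaceMeasure_le` uses the Lipschitz constant of
the graph map instead; no area formula is involved. -/
theorem le_map_surfaceMeasure (hc : IsGraphChart Ω x₀ e b r s g) :
    volume.restrict (Metric.ball 0 r) ≤
      ((surfaceMeasure Ω).restrict (cylinder x₀ e r s)).map
        (fun x => (ℝ ∙ e)ᗮ.orthogonalProjectionOnto (x - x₀)) := by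
  refine Measure.le_iff.2 fun A hA => ?_
  rw [hc.map_surfaceMeasure_apply hA, Measure.restrict_apply hA, ← hc.volume_eq]
  have hl : LipschitzWith 1 fun x => (ℝ ∙ e)ᗮ.orthogonalProjectionOnto (x - x₀) := by
    refine LipschitzWith.of_dist_le_mul fun x y => ?_
    rw [dist_eq_norm, dist_eq_norm, ← map_sub, sub_sub_sub_cancel_right, NNReal.coe_one, one_mul]
    exact Submodule.norm_orthogonalProjectionOnto_apply_le _ _
  have := euclideanHausdorffMeasure_image_le (hl.lipschitzOnWith
    (s := (fun h => chartPoint x₀ e h (g h)) '' (A ∩ Metric.ball 0 r))) (n - 1)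
  rw [image_image] at this
  simpa [projection_chartPoint] using this

theorem map_surfaceMeasure_le (hc : IsGraphChart Ω x₀ e b r s g) :
    ((surfaceMeasure Ω).restrict (cylinder x₀ e r s)).map
        (fun x => (ℝ ∙ e)ᗮ.orthogonalProjectionOnto (x - x₀)) ≤
      ((1 + b.toNNReal ^ 2) ^ (n - 1) : NNReal) •
        volume.restrict (Metric.ball 0 r) := by
  refine Measure.le_iff.2 fun A hA => ?_
  rw [hc.map_surfaceMeasure_apply hA, Measure.smul_apply, Measure.restrict_apply hA, ← hc.volume_eq,
    ENNReal.smul_def, smul_eq_mul, ENNReal.coe_pow]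
  exact euclideanHausdorffMeasure_image_le (hc.lipschitzOnWith.mono inter_subset_right) (n - 1)

theorem surfaceMeasure_cylinder_lt_top (hc : IsGraphChart Ω x₀ e b r s g) :
    surfaceMeasure Ω (cylinder x₀ e r s) < ⊤ := by
  have hm : Measurable fun x => (ℝ ∙ e)ᗮ.orthogonalProjectionOnto (x - x₀) :=
    Continuous.measurable (by fun_prop)
  have h := Measure.le_iff'.1 hc.map_surfaceMeasure_le univ
  rw [Measure.map_apply hm MeasurableSet.univ, preimage_univ, Measure.restrict_apply_univ] at h
  refine h.trans_lt ?_
  rw [Measure.smul_apply, Measure.restrict_apply_univ, ENNReal.smul_def, smul_eq_mul]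
  exact ENNReal.mul_lt_top ENNReal.coe_lt_top measure_ball_lt_top

/-- In a chart with small slope, the directional derivative along the axis integrates to almost
the surface integral. -/
theorem abs_setIntegral_sub_le (hc : IsGraphChart Ω x₀ e b r s g) (hΩ : IsOpen Ω)
    {f : EuclideanSpace ℝ (Fin n) → ℝ} (hf : ContDiff ℝ 1 f)
    (hfs : tsupport f ⊆ cylinder x₀ e r s) :
    |(∫ x in Ω, fderiv ℝ f x e) - ∫ x, f x ∂(surfaceMeasure Ω)| ≤
      ((1 + b ^ 2) ^ (n - 1) - 1) * ∫ x, |f x| ∂(surfaceMeasure Ω) := by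
  set π : EuclideanSpace ℝ (Fin n) → (ℝ ∙ e)ᗮ :=
    fun x => (ℝ ∙ e)ᗮ.orthogonalProjectionOnto (x - x₀)
  set γ : (ℝ ∙ e)ᗮ → EuclideanSpace ℝ (Fin n) := fun h => chartPoint x₀ e h (g h)
  set Q := cylinder x₀ e r s
  have hQ : MeasurableSet Q := (isOpen_cylinder r s).measurableSet
  have hm : Measurable π := Continuous.measurable (by fun_prop)
  have hae : AEStronglyMeasurable γ (((surfaceMeasure Ω).restrict Q).map π) := by
    have h1 : AEStronglyMeasurable γ (volume.restrict (Metric.ball 0 r)) :=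
      hc.lipschitzOnWith.continuousOn.aestronglyMeasurable measurableSet_ball
    exact h1.mono_ac (hc.map_surfaceMeasure_le.absolutelyContinuous.trans
      (Measure.AbsolutelyContinuous.rfl.smul_left _))
  -- Lifting after projecting is the identity on the boundary inside the cylinder, so surface
  -- integrals become integrals over the base against the projected measure.
  have hγπ : ∀ᵐ x ∂((surfaceMeasure Ω).restrict Q), γ (π x) = x := by
    have hF : MeasurableSet (frontier Ω) := isClosed_frontier.measurableSet
    have : (surfaceMeasure Ω).restrict Q = (μHE[n - 1]).restrict (Q ∩ frontier Ω) := by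
      rw [surfaceMeasure, Measure.restrict_restrict hQ]
    rw [this]
    filter_upwards [ae_restrict_mem (hQ.inter hF)] with x hx
    have := (hc.image_graph univ).symm.subset ⟨mem_univ _, hx⟩
    obtain ⟨h, -, rfl⟩ := this
    simp only [γ, π, projection_chartPoint]
  have hmap : ∀ ψ : EuclideanSpace ℝ (Fin n) → ℝ, Continuous ψ →
      (∀ x, x ∉ Q → ψ x = 0) → ∫ x, ψ x ∂(surfaceMeasure Ω) =
        ∫ h, ψ (γ h) ∂(((surfaceMeasure Ω).restrict Q).map π) := by
    intro ψ hψ h0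
    rw [integral_map hm.aemeasurable (hψ.comp_aestronglyMeasurable hae),
      ← setIntegral_eq_integral_of_forall_compl_eq_zero (s := Q) (fun x hx => h0 x hx)]
    refine integral_congr_ae ?_
    filter_upwards [hγπ] with x hx
    rw [hx]
  have hf0 : ∀ x, x ∉ Q → f x = 0 := fun x hx =>
    image_eq_zero_of_notMem_tsupport fun h => hx (hfs h)
  rw [hc.setIntegral_fderiv hΩ hf hfs, hmap f hf.continuous hf0,
    hmap (fun x => |f x|) hf.continuous.abs (fun x hx => by simp [hf0 x hx])]
  have := abs_integral_sub_le_of_le (C := (1 + b.toNNReal ^ 2) ^ (n - 1))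
    (one_le_pow₀ (by simp)) hc.le_map_surfaceMeasure hc.map_surfaceMeasure_le
    (φ := fun h => f (γ h)) ?_
  · simpa only [NNReal.coe_pow, NNReal.coe_add, NNReal.coe_one,
      Real.coe_toNNReal b hc.slope_pos.le] using this
  · obtain ⟨M, hM⟩ := (hc.hasCompactSupport hfs).exists_bound_of_continuous hf.continuous
    have : IsFiniteMeasure (((surfaceMeasure Ω).restrict Q).map π) := by
      have : IsFiniteMeasure ((surfaceMeasure Ω).restrict Q) :=
        ⟨by rw [Measure.restrict_apply_univ]; exact hc.surfaceMeasure_cylinder_lt_top⟩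
      infer_instance
    exact Integrable.of_bound (hf.continuous.comp_aestronglyMeasurable hae) M
      (Eventually.of_forall fun h => hM _)

end IsGraphChart

end Slicing

/-! ### Smooth partitions of unity and integrals of derivatives of compactly supported functions. -/

section Calculus

variable {F : Type*} [NormedAddCommGroup F] [NormedSpace ℝ F] [FiniteDimensional ℝ F]

theorem exists_finite_smooth_partition {K : Set F} (hK : IsCompact K) (U : F → Set F)
    (hU : ∀ x ∈ K, U x ∈ 𝓝 x) :
    ∃ (t : Finset F) (χ : t → F → ℝ), (∀ i : t, (i : F) ∈ K) ∧
      (∀ i, ContDiff ℝ ∞ (χ i)) ∧ (∀ i, HasCompactSupport (χ i)) ∧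
      (∀ i, tsupport (χ i) ⊆ U i) ∧ (∀ i x, 0 ≤ χ i x) ∧ ∀ x ∈ K, ∑ i, χ i x = 1 := by
  obtain ⟨t, htK, ht⟩ := hK.elim_nhds_subcover (fun x => interior (U x) ∩ Metric.ball x 1)
    fun x hx => inter_mem (interior_mem_nhds.2 (hU x hx)) (Metric.ball_mem_nhds x one_pos)
  obtain ⟨χ, hχ⟩ := SmoothPartitionOfUnity.exists_isSubordinate (modelWithCornersSelf ℝ F) hK.isClosed
    (fun i : t => interior (U i) ∩ Metric.ball (i : F) 1)
    (fun i => isOpen_interior.inter Metric.isOpen_ball)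
    (fun x hx => by
      obtain ⟨i, hi, hx⟩ := mem_iUnion₂.1 (ht hx)
      exact mem_iUnion.2 ⟨⟨i, hi⟩, hx⟩)
  refine ⟨t, fun i => χ i, fun i => htK i i.2,
    fun i => (χ i).contMDiff.contDiff, fun i => ?_, fun i => ?_, fun i x => χ.nonneg i x,
    fun x hx => ?_⟩
  · exact Metric.isCompact_of_isClosed_isBounded (isClosed_tsupport _)
      (Metric.isBounded_ball.subset ((hχ i).trans inter_subset_right))
  · exact (hχ i).trans (inter_subset_left.trans interior_subset)
  · rw [← finsum_eq_sum_of_fintype]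
    exact χ.sum_eq_one hx

theorem integral_fderiv_eq_zero [MeasurableSpace F] [BorelSpace F] {μ : Measure F}
    [μ.IsAddHaarMeasure] {f : F → ℝ} (hf : ContDiff ℝ 1 f) (hs : HasCompactSupport f) (e : F) :
    ∫ x, fderiv ℝ f x e ∂μ = 0 := by
  have h1 : Integrable (fun x => fderiv ℝ f x e) μ :=
    ((hf.continuous_fderiv one_ne_zero).clm_apply continuous_const).integrable_of_hasCompactSupport
      (hs.fderiv_apply (𝕜 := ℝ) e)
  have := integral_mul_fderiv_eq_neg_fderiv_mul_of_integrable (μ := μ) (𝕜 := ℝ)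
    (f := fun _ => (1 : ℝ)) (g := f) (v := e) (by simp) (by simpa using h1)
    (by simpa using hf.continuous.integrable_of_hasCompactSupport hs)
    (fun x _ => differentiableAt_const _) (fun x _ => hf.differentiable one_ne_zero x)
  simpa using this

end Calculus

/-! ### The normal field, finiteness of the measures and integrability. -/

variable {Ω : Set (EuclideanSpace ℝ (Fin n))}

open Classical in
/-- A choice of the outer unit normal. -/
def outerNormal (Ω : Set (EuclideanSpace ℝ (Fin n))) (x : EuclideanSpace ℝ (Fin n)) :
    EuclideanSpace ℝ (Fin n) :=
  if h : ∃ ρ, IsLocalDefiningFunction Ω x ρ then ‖∇ h.choose x‖⁻¹ • ∇ h.choose x else 0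

theorem outerNormal_eq (hΩ : IsOpen Ω) {x : EuclideanSpace ℝ (Fin n)} (hx : x ∈ frontier Ω)
    {ρ : EuclideanSpace ℝ (Fin n) → ℝ} (hρ : IsLocalDefiningFunction Ω x ρ) :
    outerNormal Ω x = ‖∇ ρ x‖⁻¹ • ∇ ρ x := by
  have h : ∃ ρ, IsLocalDefiningFunction Ω x ρ := ⟨ρ, hρ⟩
  rw [outerNormal, dif_pos h]
  exact h.choose_spec.normal_unique hΩ hx hρ

theorem exists_isGraphChart_of_outerNormal (hΩ : IsOpen Ω) {x₀ e : EuclideanSpace ℝ (Fin n)}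
    (hx₀ : x₀ ∈ frontier Ω) {ρ : EuclideanSpace ℝ (Fin n) → ℝ}
    (hρ : IsLocalDefiningFunction Ω x₀ ρ) (he : ‖e‖ = 1) {b : ℝ} (hb : 0 < b)
    (h : ‖outerNormal Ω x₀ - (inner ℝ (outerNormal Ω x₀) e : ℝ) • e‖ <
      b * inner ℝ (outerNormal Ω x₀) e) :
    ∃ r s g, IsGraphChart Ω x₀ e b r s g := by
  refine exists_isGraphChart hΩ hx₀ hρ he hb ?_
  have hpos : 0 < ‖∇ ρ x₀‖ := norm_pos_iff.2 hρ.gradient_ne_zero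
  have heq : ∇ ρ x₀ = ‖∇ ρ x₀‖ • outerNormal Ω x₀ := by
    rw [outerNormal_eq hΩ hx₀ hρ, smul_smul, mul_inv_cancel₀ hpos.ne', one_smul]
  rw [heq, real_inner_smul_left, mul_smul, ← smul_sub, norm_smul, norm_norm, mul_left_comm]
  exact mul_lt_mul_of_pos_left h hpos

theorem IsGraphChart.cylinder_mem_nhds {x₀ e : EuclideanSpace ℝ (Fin n)} {b r s : ℝ}
    {g : (ℝ ∙ e)ᗮ → ℝ} (hc : IsGraphChart Ω x₀ e b r s g) : cylinder x₀ e r s ∈ 𝓝 x₀ :=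
  (isOpen_cylinder r s).mem_nhds (self_mem_cylinder hc.radius_pos hc.height_pos)

namespace IsSmoothBoundedDomain

theorem isCompact_closure (hΩ : IsSmoothBoundedDomain Ω) : IsCompact (closure Ω) :=
  hΩ.isBounded.isCompact_closure

theorem isCompact_frontier (hΩ : IsSmoothBoundedDomain Ω) : IsCompact (frontier Ω) :=
  hΩ.isCompact_closure.of_isClosed_subset isClosed_frontier frontier_subset_closure

theorem norm_outerNormal (hΩ : IsSmoothBoundedDomain Ω) {x : EuclideanSpace ℝ (Fin n)}
    (hx : x ∈ frontier Ω) : ‖outerNormal Ω x‖ = 1 := by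
  obtain ⟨ρ, hρ⟩ := hΩ.smooth_boundary x hx
  rw [outerNormal_eq hΩ.isOpen hx hρ, norm_smul, norm_inv, norm_norm,
    inv_mul_cancel₀ (norm_ne_zero_iff.2 hρ.gradient_ne_zero)]

theorem isOuterUnitNormal (hΩ : IsSmoothBoundedDomain Ω) {x : EuclideanSpace ℝ (Fin n)}
    (hx : x ∈ frontier Ω) : IsOuterUnitNormal Ω x (outerNormal Ω x) := by
  obtain ⟨ρ, hρ⟩ := hΩ.smooth_boundary x hx
  exact ⟨ρ, hρ, outerNormal_eq hΩ.isOpen hx hρ⟩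

theorem continuousOn_outerNormal (hΩ : IsSmoothBoundedDomain Ω) :
    ContinuousOn (outerNormal Ω) (frontier Ω) := by
  intro x hx
  obtain ⟨ρ, hρ⟩ := hΩ.smooth_boundary x hx
  have hc : ContinuousAt (fun y => ‖∇ ρ y‖⁻¹ • ∇ ρ y) x :=
    (hρ.continuous_gradient.continuousAt.norm.inv₀
      (norm_ne_zero_iff.2 hρ.gradient_ne_zero)).smul hρ.continuous_gradient.continuousAt
  refine hc.continuousWithinAt.congr_of_eventuallyEq ?_ (outerNormal_eq hΩ.isOpen hx hρ)
  filter_upwards [nhdsWithin_le_nhds hρ.eventually_frontier, self_mem_nhdsWithin] with y h1 h2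
  exact outerNormal_eq hΩ.isOpen h2 h1

theorem exists_isGraphChart_normal (hΩ : IsSmoothBoundedDomain Ω)
    {x₀ : EuclideanSpace ℝ (Fin n)} (hx₀ : x₀ ∈ frontier Ω) {b : ℝ} (hb : 0 < b) :
    ∃ r s g, IsGraphChart Ω x₀ (outerNormal Ω x₀) b r s g := by
  obtain ⟨ρ, hρ⟩ := hΩ.smooth_boundary x₀ hx₀
  have h1 := hΩ.norm_outerNormal hx₀
  refine exists_isGraphChart_of_outerNormal hΩ.isOpen hx₀ hρ h1 hb ?_
  rw [real_inner_self_eq_norm_sq, h1]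
  simpa using hb

theorem isFiniteMeasure_surfaceMeasure (hΩ : IsSmoothBoundedDomain Ω) :
    IsFiniteMeasure (surfaceMeasure Ω) := by
  have h : surfaceMeasure Ω (frontier Ω) < ⊤ := by
    refine hΩ.isCompact_frontier.measure_lt_top_of_nhdsWithin fun x hx => ?_
    obtain ⟨r, s, g, hc⟩ := hΩ.exists_isGraphChart_normal hx one_pos
    exact ⟨_, nhdsWithin_le_nhds hc.cylinder_mem_nhds, hc.surfaceMeasure_cylinder_lt_top⟩
  refine ⟨?_⟩
  rw [surfaceMeasure, Measure.restrict_apply_univ]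
  rwa [surfaceMeasure, Measure.restrict_apply_self] at h

theorem ae_mem_frontier (Ω : Set (EuclideanSpace ℝ (Fin n))) :
    ∀ᵐ x ∂(surfaceMeasure Ω), x ∈ frontier Ω :=
  ae_restrict_mem isClosed_frontier.measurableSet

theorem integrable_surfaceMeasure (hΩ : IsSmoothBoundedDomain Ω) {F : Type*}
    [NormedAddCommGroup F] {φ : EuclideanSpace ℝ (Fin n) → F} (hφ : ContinuousOn φ (frontier Ω)) :
    Integrable φ (surfaceMeasure Ω) := by
  have := hΩ.isFiniteMeasure_surfaceMeasure
  obtain ⟨M, hM⟩ := hΩ.isCompact_frontier.exists_bound_of_continuousOn hφ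
  refine Integrable.of_bound (hφ.aestronglyMeasurable_of_isCompact hΩ.isCompact_frontier
    isClosed_frontier.measurableSet) M ?_
  filter_upwards [ae_mem_frontier Ω] with x hx using hM x hx

theorem isFiniteMeasure_restrict (hΩ : IsSmoothBoundedDomain Ω) :
    IsFiniteMeasure (volume.restrict Ω) :=
  ⟨by rw [Measure.restrict_apply_univ]; exact hΩ.isBounded.measure_lt_top⟩

theorem integrableOn_of_bound (hΩ : IsSmoothBoundedDomain Ω) {F : Type*} [NormedAddCommGroup F]
    {φ : EuclideanSpace ℝ (Fin n) → F} (hφ : ContinuousOn φ Ω) {M : ℝ}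
    (hM : ∀ x ∈ Ω, ‖φ x‖ ≤ M) : IntegrableOn φ Ω := by
  have := hΩ.isFiniteMeasure_restrict
  refine Integrable.of_bound (hφ.aestronglyMeasurable hΩ.isOpen.measurableSet) M ?_
  filter_upwards [ae_restrict_mem hΩ.isOpen.measurableSet] with x hx using hM x hx

theorem integrableOn_of_continuousOn_closure (hΩ : IsSmoothBoundedDomain Ω) {F : Type*}
    [NormedAddCommGroup F] {φ : EuclideanSpace ℝ (Fin n) → F} (hφ : ContinuousOn φ (closure Ω)) :
    IntegrableOn φ Ω := by
  obtain ⟨M, hM⟩ := hΩ.isCompact_closure.exists_bound_of_continuousOn hφ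
  exact hΩ.integrableOn_of_bound (hφ.mono subset_closure) fun x hx => hM x (subset_closure hx)

end IsSmoothBoundedDomain

/-! ### Gauss' theorem for functions smooth up to the boundary. -/

/-- Near `x`, the Gauss formula in the direction `e` holds up to a relatively small error. -/
def LocalGauss (Ω : Set (EuclideanSpace ℝ (Fin n))) (x e : EuclideanSpace ℝ (Fin n)) : Prop :=
  ∀ η > 0, ∃ U ∈ 𝓝 x, ∀ f : EuclideanSpace ℝ (Fin n) → ℝ, ContDiff ℝ 1 f → HasCompactSupport f →
    tsupport f ⊆ U → |(∫ y in Ω, fderiv ℝ f y e) -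
      ∫ y, f y * inner ℝ (outerNormal Ω y) e ∂(surfaceMeasure Ω)| ≤
        η * ∫ y, |f y| ∂(surfaceMeasure Ω)

namespace LocalGauss

open IsSmoothBoundedDomain

variable {x e e' : EuclideanSpace ℝ (Fin n)}

theorem integrable_mul_normal (hΩ : IsSmoothBoundedDomain Ω) {f : EuclideanSpace ℝ (Fin n) → ℝ}
    (hf : Continuous f) (e : EuclideanSpace ℝ (Fin n)) :
    Integrable (fun y => f y * inner ℝ (outerNormal Ω y) e) (surfaceMeasure Ω) :=
  hΩ.integrable_surfaceMeasure
    (hf.continuousOn.mul (hΩ.continuousOn_outerNormal.inner continuousOn_const))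

theorem integrable_fderiv {f : EuclideanSpace ℝ (Fin n) → ℝ} (hf : ContDiff ℝ 1 f)
    (hs : HasCompactSupport f) (e : EuclideanSpace ℝ (Fin n)) :
    Integrable (fun x => fderiv ℝ f x e) :=
  ((hf.continuous_fderiv one_ne_zero).clm_apply continuous_const).integrable_of_hasCompactSupport
    (hs.fderiv_apply (𝕜 := ℝ) e)

theorem add (hΩ : IsSmoothBoundedDomain Ω) (h : LocalGauss Ω x e) (h' : LocalGauss Ω x e') :
    LocalGauss Ω x (e + e') := by
  intro η hη
  obtain ⟨U, hU, h⟩ := h (η / 2) (by positivity)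
  obtain ⟨U', hU', h'⟩ := h' (η / 2) (by positivity)
  refine ⟨U ∩ U', inter_mem hU hU', fun f hf hs hfs => ?_⟩
  have h1 := h f hf hs (hfs.trans inter_subset_left)
  have h2 := h' f hf hs (hfs.trans inter_subset_right)
  simp only [map_add, inner_add_right, mul_add]
  rw [integral_add (integrable_fderiv hf hs e).integrableOn
      (integrable_fderiv hf hs e').integrableOn,
    integral_add (integrable_mul_normal hΩ hf.continuous e)
      (integrable_mul_normal hΩ hf.continuous e')]
  rw [abs_le] at *
  constructor <;> linarith [h1.1, h1.2, h2.1, h2.2]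

theorem smul (h : LocalGauss Ω x e) (c : ℝ) : LocalGauss Ω x (c • e) := by
  intro η hη
  obtain ⟨U, hU, h⟩ := h (η / (|c| + 1)) (by positivity)
  refine ⟨U, hU, fun f hf hs hfs => ?_⟩
  have h1 := h f hf hs hfs
  have h2 : 0 ≤ ∫ y, |f y| ∂(surfaceMeasure Ω) := integral_nonneg fun _ => abs_nonneg _
  simp only [map_smul, smul_eq_mul, real_inner_smul_right, mul_left_comm _ c]
  rw [integral_const_mul, integral_const_mul, ← mul_sub, abs_mul]
  calc _ ≤ |c| * (η / (|c| + 1) * ∫ y, |f y| ∂(surfaceMeasure Ω)) := by gcongr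
    _ = |c| / (|c| + 1) * (η * ∫ y, |f y| ∂(surfaceMeasure Ω)) := by ring
    _ ≤ 1 * (η * ∫ y, |f y| ∂(surfaceMeasure Ω)) := by
        gcongr
        rw [div_le_one (by positivity)]; linarith
    _ = _ := one_mul _

theorem of_interior (hΩ : IsOpen Ω) (hx : x ∈ Ω) : LocalGauss Ω x e := by
  intro η hη
  refine ⟨Ω, hΩ.mem_nhds hx, fun f hf hs hfs => ?_⟩
  have h1 : ∫ y in Ω, fderiv ℝ f y e = 0 := by
    rw [setIntegral_eq_integral_of_forall_compl_eq_zero, integral_fderiv_eq_zero hf hs e]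
    intro y hy
    have : y ∉ tsupport (fderiv ℝ f) := fun h => hy (hfs (tsupport_fderiv_subset ℝ h))
    rw [image_eq_zero_of_notMem_tsupport this]; rfl
  have h2 : ∫ y, f y * inner ℝ (outerNormal Ω y) e ∂(surfaceMeasure Ω) = 0 := by
    refine integral_eq_zero_of_ae ?_
    filter_upwards [ae_mem_frontier Ω] with y hy
    rw [hΩ.frontier_eq] at hy
    rw [image_eq_zero_of_notMem_tsupport fun h => hy.2 (hfs h), zero_mul]; rfl
  rw [h1, h2, sub_zero, abs_zero]
  exact mul_nonneg hη.le (integral_nonneg fun _ => abs_nonneg _)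

/-- The local Gauss formula from a family of approximate formulas with constant weight `c`. -/
theorem of_approx (hΩ : IsSmoothBoundedDomain Ω) (hx : x ∈ frontier Ω)
    (h : ∀ η > 0, ∃ U ∈ 𝓝 x, ∀ f : EuclideanSpace ℝ (Fin n) → ℝ, ContDiff ℝ 1 f →
      HasCompactSupport f → tsupport f ⊆ U → |(∫ y in Ω, fderiv ℝ f y e) -
        inner ℝ (outerNormal Ω x) e * ∫ y, f y ∂(surfaceMeasure Ω)| ≤
          η * ∫ y, |f y| ∂(surfaceMeasure Ω)) : LocalGauss Ω x e := by
  intro η hη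
  obtain ⟨U, hU, h⟩ := h (η / 2) (by positivity)
  -- Half of the error budget pays for freezing the normal at `x`, which is possible because the
  -- normal is continuous along the boundary.
  have hcont : ContinuousWithinAt (fun y => (inner ℝ (outerNormal Ω y) e : ℝ)) (frontier Ω) x :=
    (hΩ.continuousOn_outerNormal.inner continuousOn_const) x hx
  have hev := hcont.eventually (Metric.ball_mem_nhds _ (half_pos hη))
  rw [eventually_nhdsWithin_iff] at hev
  refine ⟨U ∩ _, inter_mem hU hev, fun f hf hs hfs => ?_⟩
  have h1 := h f hf hs (hfs.trans inter_subset_left)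
  set c : ℝ := inner ℝ (outerNormal Ω x) e
  have hfi : Integrable f (surfaceMeasure Ω) :=
    hΩ.integrable_surfaceMeasure hf.continuous.continuousOn
  have h2 : |c * (∫ y, f y ∂(surfaceMeasure Ω)) -
      ∫ y, f y * inner ℝ (outerNormal Ω y) e ∂(surfaceMeasure Ω)| ≤
      η / 2 * ∫ y, |f y| ∂(surfaceMeasure Ω) := by
    rw [← integral_const_mul, ← integral_sub (hfi.const_mul c)
      (integrable_mul_normal hΩ hf.continuous e), ← integral_const_mul]
    refine (abs_integral_le_integral_abs).trans (integral_mono_ae ?_ (hfi.abs.const_mul _) ?_)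
    · exact ((hfi.const_mul c).sub (integrable_mul_normal hΩ hf.continuous e)).abs
    · filter_upwards [ae_mem_frontier Ω] with y hy
      by_cases hyU : y ∈ tsupport f
      · have h3 : dist (inner ℝ (outerNormal Ω y) e : ℝ) c < η / 2 := (hfs hyU).2 hy
        rw [Real.dist_eq] at h3
        have : c * f y - f y * inner ℝ (outerNormal Ω y) e =
          -(inner ℝ (outerNormal Ω y) e - c) * f y := by ring
        rw [this, abs_mul, abs_neg]
        gcongr
      · simp [image_eq_zero_of_notMem_tsupport hyU]
  rw [abs_le] at *
  constructor <;> linarith [h1.1, h1.2, h2.1, h2.2]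

/-- With the normal as axis, charts of arbitrarily small slope exist, so the relative error `(1 +
b²)^(n-1) - 1` can be made smaller than any `η`. -/
theorem normal (hΩ : IsSmoothBoundedDomain Ω) (hx : x ∈ frontier Ω) :
    LocalGauss Ω x (outerNormal Ω x) := by
  refine of_approx hΩ hx fun η hη => ?_
  have hlim : Tendsto (fun b : ℝ => (1 + b ^ 2) ^ (n - 1) - 1) (𝓝[>] 0) (𝓝 0) := by
    have : Continuous fun b : ℝ => (1 + b ^ 2) ^ (n - 1) - 1 := by fun_prop
    simpa using (this.tendsto 0).mono_left nhdsWithin_le_nhds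
  obtain ⟨b, hb, hb0⟩ := ((hlim.eventually (gt_mem_nhds hη)).and self_mem_nhdsWithin).exists
  obtain ⟨r, s, g, hc⟩ := hΩ.exists_isGraphChart_normal hx hb0
  refine ⟨_, hc.cylinder_mem_nhds, fun f hf hs hfs => ?_⟩
  rw [real_inner_self_eq_norm_sq, hΩ.norm_outerNormal hx, one_pow, one_mul]
  refine (hc.abs_setIntegral_sub_le hΩ.isOpen hf hfs).trans ?_
  gcongr

/-- Relative to the axis `(ν + a e) / √(1 + a²)` the tangent plane at `x` has slope exactly `|a|`.
The factor `2` provides the strict inequality required for a chart near `x`. -/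
theorem exists_isGraphChart_tilted (hΩ : IsSmoothBoundedDomain Ω) (hx : x ∈ frontier Ω)
    (hτ : ‖e‖ = 1) (hort : inner ℝ (outerNormal Ω x) e = 0) {a : ℝ} (ha : a ≠ 0) :
    ∃ r s g, IsGraphChart Ω x ((√(1 + a ^ 2))⁻¹ • (outerNormal Ω x + a • e)) (2 * |a|) r s g := by
  obtain ⟨ρ, hρ⟩ := hΩ.smooth_boundary x hx
  set ν := outerNormal Ω x
  have hν : ‖ν‖ = 1 := hΩ.norm_outerNormal hx
  set q := √(1 + a ^ 2) with hq
  have hq2 : q ^ 2 = 1 + a ^ 2 := Real.sq_sqrt (by positivity)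
  have hq0 : 0 < q := Real.sqrt_pos.2 (by positivity)
  have ha0 : 0 < |a| := abs_pos.2 ha
  have hnorm : ∀ s t : ℝ, ‖s • ν + t • e‖ ^ 2 = s ^ 2 + t ^ 2 := by
    intro s t
    rw [norm_add_sq_real, real_inner_smul_left, real_inner_smul_right, hort, norm_smul, norm_smul,
      hν, hτ]
    simp
  refine exists_isGraphChart_of_outerNormal hΩ.isOpen hx hρ ?_ (by positivity) ?_
  · rw [norm_smul, norm_inv, Real.norm_of_nonneg hq0.le, inv_mul_eq_one₀ hq0.ne',
      ← pow_left_inj₀ hq0.le (norm_nonneg _) two_ne_zero, hq2]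
    simpa using (hnorm 1 a).symm
  · have hin : inner ℝ ν (q⁻¹ • (ν + a • e)) = q⁻¹ := by
      rw [real_inner_smul_right, inner_add_right, real_inner_smul_right, hort,
        real_inner_self_eq_norm_sq, hν]
      simp
    rw [hin]
    have heq : ν - q⁻¹ • q⁻¹ • (ν + a • e) = (a ^ 2 / q ^ 2) • ν + (-a / q ^ 2) • e := by
      have h1 : a ^ 2 / q ^ 2 = 1 - q⁻¹ * q⁻¹ := by field_simp; rw [hq2]; ring
      have h2 : -a / q ^ 2 = -(q⁻¹ * q⁻¹ * a) := by field_simp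
      rw [h1, h2, smul_add, smul_add, smul_smul, smul_smul, smul_smul, sub_smul, neg_smul, one_smul]
      simp only [mul_assoc]
      abel
    have h3 := hnorm (a ^ 2 / q ^ 2) (-a / q ^ 2)
    rw [← heq] at h3
    have h4 : (a ^ 2 / q ^ 2) ^ 2 + (-a / q ^ 2) ^ 2 = (|a| * q⁻¹) ^ 2 := by
      rw [mul_pow, sq_abs]
      field_simp
      rw [hq2]; ring
    rw [h4, pow_left_inj₀ (norm_nonneg _) (by positivity) two_ne_zero] at h3
    rw [h3]
    have : 0 < |a| * q⁻¹ := by positivity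
    linarith

/-- Two charts with axes tilted by `+a` and `-a` give two approximate formulas with the same surface
term. Subtracting cancels it together with the normal derivative, leaving `2a / √(1 + a²)` times the
tangential integral. The error is `O(a²)`, so dividing by `a` still leaves something small. -/
theorem tangential (hΩ : IsSmoothBoundedDomain Ω) (hx : x ∈ frontier Ω)
    (hτ : ‖e‖ = 1) (hort : inner ℝ (outerNormal Ω x) e = 0) : LocalGauss Ω x e := by
  refine of_approx hΩ hx fun η hη => ?_
  -- The quotient is a difference quotient at `0` of a function of `a` whose derivative there
  -- vanishes.
  have hlim : Tendsto (fun a : ℝ => ((1 + (2 * a) ^ 2) ^ (n - 1) - 1) / a) (𝓝[>] 0) (𝓝 0) := by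
    have hd : HasDerivAt (fun a : ℝ => (1 + (2 * a) ^ 2) ^ (n - 1)) 0 0 := by
      have h1 : HasDerivAt (fun a : ℝ => 1 + (2 * a) ^ 2) 0 0 := by
        have := ((((hasDerivAt_id (0 : ℝ)).const_mul 2).pow 2).const_add 1)
        simpa using this
      simpa using h1.fun_pow (n - 1)
    have := hd.hasDerivWithinAt (s := Ioi 0)
    rw [hasDerivWithinAt_iff_tendsto_slope] at this
    simpa [slope_fun_def_field] using this
  obtain ⟨a, ⟨ha, ha1⟩, ha0⟩ := (((hlim.eventually (gt_mem_nhds (half_pos hη))).and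
    (nhdsWithin_le_nhds (gt_mem_nhds (one_pos : (0 : ℝ) < 1)))).and self_mem_nhdsWithin).exists
  have ha0 : 0 < a := ha0
  obtain ⟨r, s, g, hc⟩ := exists_isGraphChart_tilted hΩ hx hτ hort ha0.ne'
  have hneg := exists_isGraphChart_tilted hΩ hx hτ hort (neg_ne_zero.2 ha0.ne')
  rw [abs_neg, neg_sq] at hneg
  obtain ⟨r', s', g', hc'⟩ := hneg
  rw [abs_of_pos ha0] at hc hc'
  refine ⟨_, inter_mem hc.cylinder_mem_nhds hc'.cylinder_mem_nhds, fun f hf hs hfs => ?_⟩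
  have h1 := hc.abs_setIntegral_sub_le hΩ.isOpen hf (hfs.trans inter_subset_left)
  have h2 := hc'.abs_setIntegral_sub_le hΩ.isOpen hf (hfs.trans inter_subset_right)
  have hI : 0 ≤ ∫ y, |f y| ∂(surfaceMeasure Ω) := integral_nonneg fun _ => abs_nonneg _
  set q := √(1 + a ^ 2) with hq
  have hq2 : q ^ 2 = 1 + a ^ 2 := Real.sq_sqrt (by positivity)
  have hq0 : 0 < q := Real.sqrt_pos.2 (by positivity)
  have hqle : q ≤ 2 := by nlinarith
  rw [hort, zero_mul, sub_zero]
  simp only [map_smul, map_add, smul_eq_mul] at h1 h2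
  rw [integral_const_mul, integral_add (integrable_fderiv hf hs _).integrableOn
    ((integrable_fderiv hf hs e).integrableOn.const_mul _), integral_const_mul] at h1 h2
  set A := ∫ y in Ω, fderiv ℝ f y (outerNormal Ω x)
  set T := ∫ y in Ω, fderiv ℝ f y e
  set S := ∫ y, f y ∂(surfaceMeasure Ω)
  set I := ∫ y, |f y| ∂(surfaceMeasure Ω)
  set κ := (1 + (2 * a) ^ 2) ^ (n - 1) - 1
  have hκ0 : 0 ≤ κ := sub_nonneg.2 (one_le_pow₀ (by nlinarith))
  have hκ : κ < η / 2 * a := by rwa [div_lt_iff₀ ha0] at ha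
  have h3 : |2 * (q⁻¹ * (a * T))| ≤ 2 * (κ * I) := by
    rw [abs_le] at *
    have e1 : 2 * (q⁻¹ * (a * T)) = q⁻¹ * (A + a * T) - q⁻¹ * (A + -a * T) := by ring
    constructor <;> rw [e1] <;> linarith [h1.1, h1.2, h2.1, h2.2]
  rw [abs_mul, abs_mul, abs_mul, abs_two, abs_of_pos (inv_pos.2 hq0), abs_of_pos ha0] at h3
  have h4 : a * |T| ≤ q * (κ * I) := by
    have := mul_le_mul_of_nonneg_left h3 hq0.le
    have e2 : q * (2 * (q⁻¹ * (a * |T|))) = 2 * (a * |T|) := by field_simp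
    rw [e2] at this; linarith
  have h5 : q * (κ * I) ≤ a * (η * I) := by
    calc q * (κ * I) ≤ 2 * (η / 2 * a * I) := by gcongr
      _ = a * (η * I) := by ring
  exact le_of_mul_le_mul_left (h4.trans h5) ha0

theorem of_mem_closure (hΩ : IsSmoothBoundedDomain Ω) (hx : x ∈ closure Ω)
    (e : EuclideanSpace ℝ (Fin n)) : LocalGauss Ω x e := by
  by_cases hxΩ : x ∈ Ω
  · exact of_interior hΩ.isOpen hxΩ
  have hxf : x ∈ frontier Ω := by rw [hΩ.isOpen.frontier_eq]; exact ⟨hx, hxΩ⟩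
  set ν := outerNormal Ω x
  have hν : ‖ν‖ = 1 := hΩ.norm_outerNormal hxf
  set τ := e - (inner ℝ ν e : ℝ) • ν
  have hτ : inner ℝ ν τ = 0 := by
    simp only [τ]
    rw [inner_sub_right, real_inner_smul_right, real_inner_self_eq_norm_sq, hν]; ring
  have he : e = (inner ℝ ν e : ℝ) • ν + ‖τ‖ • (‖τ‖⁻¹ • τ) := by
    by_cases h0 : τ = 0
    · rw [h0, norm_zero, zero_smul, add_zero]; exact sub_eq_zero.1 h0
    · rw [smul_smul, mul_inv_cancel₀ (norm_ne_zero_iff.2 h0), one_smul]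
      simp [τ]
  rw [he]
  refine add hΩ ((normal hΩ hxf).smul _) ?_
  by_cases h0 : τ = 0
  · have : LocalGauss Ω x ν := normal hΩ hxf
    simpa [h0] using this.smul 0
  · refine (tangential hΩ hxf ?_ ?_).smul _
    · rw [norm_smul, norm_inv, norm_norm, inv_mul_cancel₀ (norm_ne_zero_iff.2 h0)]
    · rw [real_inner_smul_right, hτ, mul_zero]

end LocalGauss

/-- Gauss' theorem for functions that are smooth up to the boundary. -/
theorem IsSmoothBoundedDomain.setIntegral_fderiv (hΩ : IsSmoothBoundedDomain Ω)
    {f : EuclideanSpace ℝ (Fin n) → ℝ} (hf : ContDiff ℝ 1 f) (e : EuclideanSpace ℝ (Fin n)) :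
    ∫ x in Ω, fderiv ℝ f x e =
      ∫ x, f x * inner ℝ (outerNormal Ω x) e ∂(surfaceMeasure Ω) := by
  set I := ∫ y, |f y| ∂(surfaceMeasure Ω)
  have hI : 0 ≤ I := integral_nonneg fun _ => abs_nonneg _
  suffices h : ∀ η > 0, |(∫ x in Ω, fderiv ℝ f x e) -
      ∫ x, f x * inner ℝ (outerNormal Ω x) e ∂(surfaceMeasure Ω)| ≤ η * I by
    rw [← sub_eq_zero, ← abs_nonpos_iff]
    refine le_of_forall_pos_le_add fun ε hε => ?_
    refine (h (ε / (I + 1)) (by positivity)).trans ?_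
    rw [zero_add, div_mul_eq_mul_div, div_le_iff₀ (by positivity)]
    nlinarith
  intro η hη
  choose! U hU hUf using fun x (hx : x ∈ closure Ω) => LocalGauss.of_mem_closure hΩ hx e η hη
  obtain ⟨t, χ, hc, hχ, hχs, hχU, hχ0, hχ1⟩ :=
    exists_finite_smooth_partition hΩ.isCompact_closure U hU
  have hχf : ∀ i, ContDiff ℝ 1 fun x => χ i x * f x := fun i =>
    ((hχ i).of_le (by exact_mod_cast le_top)).mul hf
  have hχfs : ∀ i, HasCompactSupport fun x => χ i x * f x := fun i => (hχs i).mul_right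
  have hest := fun i : t => hUf i (hc i) _ (hχf i) (hχfs i)
    ((closure_mono (Function.support_mul_subset_left _ _)).trans (hχU i))
  have h1 : ∫ x in Ω, fderiv ℝ f x e = ∑ i, ∫ x in Ω, fderiv ℝ (fun x => χ i x * f x) x e := by
    rw [← integral_finsetSum _ fun i _ =>
      (LocalGauss.integrable_fderiv (hχf i) (hχfs i) e).integrableOn]
    refine setIntegral_congr_fun hΩ.isOpen.measurableSet fun x hx => ?_
    have heq : f =ᶠ[𝓝 x] fun y => ∑ i, χ i y * f y := by
      filter_upwards [hΩ.isOpen.mem_nhds hx] with y hy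
      rw [← Finset.sum_mul, hχ1 y (subset_closure hy), one_mul]
    rw [heq.fderiv_eq, fderiv_fun_sum fun i _ => (hχf i).differentiable one_ne_zero x,
      sum_apply]
  have h2 : ∫ x, f x * inner ℝ (outerNormal Ω x) e ∂(surfaceMeasure Ω) =
      ∑ i, ∫ x, χ i x * f x * inner ℝ (outerNormal Ω x) e ∂(surfaceMeasure Ω) := by
    rw [← integral_finsetSum _ fun i _ =>
      LocalGauss.integrable_mul_normal hΩ (hχf i).continuous e]
    refine integral_congr_ae ?_
    filter_upwards [ae_mem_frontier Ω] with x hx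
    rw [← Finset.sum_mul, ← Finset.sum_mul, hχ1 x (frontier_subset_closure hx), one_mul]
  -- Because the weights are nonnegative and sum to `1`, the local errors add up to `η * I` however
  -- many patches are used. This is why `LocalGauss` measures the error relative to the integral of
  -- `|f|`.
  have h3 : I = ∑ i, ∫ x, |χ i x * f x| ∂(surfaceMeasure Ω) := by
    rw [← integral_finsetSum _ fun i _ =>
      (hΩ.integrable_surfaceMeasure (hχf i).continuous.continuousOn).abs]
    refine integral_congr_ae ?_
    filter_upwards [ae_mem_frontier Ω] with x hx
    simp only [abs_mul, abs_of_nonneg (hχ0 _ x)]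
    rw [← Finset.sum_mul, hχ1 x (frontier_subset_closure hx), one_mul]
  rw [h1, h2, h3, ← Finset.sum_sub_distrib, Finset.mul_sum]
  exact (Finset.abs_sum_le_sum_abs _ _).trans (Finset.sum_le_sum fun i _ => hest i)

/-! ### Interior cones and Gauss' theorem for fields continuous up to the boundary. -/

/-- Near each point of its closure, the domain has a uniform interior cone. -/
theorem IsSmoothBoundedDomain.exists_interior_cone (hΩ : IsSmoothBoundedDomain Ω)
    {x₀ : EuclideanSpace ℝ (Fin n)} (hx₀ : x₀ ∈ closure Ω) :
    ∃ U ∈ 𝓝 x₀, ∃ w₀ : EuclideanSpace ℝ (Fin n), ∃ r > 0, ∀ x ∈ closure Ω ∩ U,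
      ∀ w ∈ Metric.ball w₀ r, ∀ t : ℝ, 0 < t → t ≤ 1 → x + t • w ∈ Ω := by
  by_cases hxΩ : x₀ ∈ Ω
  · obtain ⟨R, hR, hball⟩ := Metric.isOpen_iff.1 hΩ.isOpen x₀ hxΩ
    refine ⟨Metric.ball x₀ (R / 2), Metric.ball_mem_nhds _ (by positivity), 0, R / 2,
      by positivity, fun x hx w hw t h0 h1 => hball ?_⟩
    have h2 := mem_ball_iff_norm.1 hx.2
    rw [mem_ball_zero_iff] at hw
    rw [mem_ball_iff_norm, add_sub_right_comm]
    calc _ ≤ ‖x - x₀‖ + ‖t • w‖ := norm_add_le _ _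
      _ = ‖x - x₀‖ + t * ‖w‖ := by rw [norm_smul, Real.norm_of_nonneg h0.le]
      _ < R := by nlinarith [norm_nonneg w]
  have hxf : x₀ ∈ frontier Ω := by rw [hΩ.isOpen.frontier_eq]; exact ⟨hx₀, hxΩ⟩
  obtain ⟨ρ, hρ⟩ := hΩ.smooth_boundary x₀ hxf
  obtain ⟨R₁, hR₁, hball⟩ := hρ.exists_ball
  have hc := hρ.continuous_gradient
  set v₀ := -∇ ρ x₀ with hv₀
  have hneg : (inner ℝ (∇ ρ x₀) v₀ : ℝ) < 0 := by
    rw [hv₀, inner_neg_right, real_inner_self_eq_norm_sq, neg_lt_zero]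
    have := norm_pos_iff.2 hρ.gradient_ne_zero
    positivity
  have hopen : IsOpen {p : EuclideanSpace ℝ (Fin n) × EuclideanSpace ℝ (Fin n) |
      (inner ℝ (∇ ρ p.1) p.2 : ℝ) < 0} :=
    isOpen_lt ((hc.comp continuous_fst).inner continuous_snd) continuous_const
  obtain ⟨A, hA, B, hB, hAB⟩ := mem_nhds_prod_iff.1 (hopen.mem_nhds (x := (x₀, v₀)) hneg)
  obtain ⟨R₂, hR₂, hA⟩ := Metric.mem_nhds_iff.1 hA
  obtain ⟨r₀, hr₀, hB⟩ := Metric.mem_nhds_iff.1 hB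
  set R := min R₁ R₂
  have hR : 0 < R := lt_min hR₁ hR₂
  replace hball : ∀ y ∈ Metric.ball x₀ R, (y ∈ Ω ↔ ρ y < 0) := fun y hy =>
    hball y (Metric.ball_subset_ball (min_le_left _ _) hy)
  -- Directions near `-∇ρ(x₀)` decrease `ρ`. Scaling them by `δ` makes their length less than `R /
  -- 2`, so segments from the half ball stay where `ρ` describes `Ω`.
  set δ := R / (2 * (‖v₀‖ + r₀)) with hδ_def
  have hδ : 0 < δ := by positivity
  refine ⟨Metric.ball x₀ (R / 2), Metric.ball_mem_nhds _ (by positivity), δ • v₀, δ * r₀,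
    by positivity, fun x hx w hw t h0 h1 => ?_⟩
  set w' := δ⁻¹ • w
  have hww : w = δ • w' := by simp [w', smul_smul, hδ.ne']
  have hw' : w' ∈ Metric.ball v₀ r₀ := by
    rw [mem_ball_iff_norm] at hw ⊢
    rw [hww, ← smul_sub, norm_smul, Real.norm_of_nonneg hδ.le] at hw
    exact lt_of_mul_lt_mul_left hw hδ.le
  have hnw : ‖w‖ < R / 2 := by
    have h2 : ‖w'‖ < ‖v₀‖ + r₀ := by
      have := norm_sub_norm_le w' v₀
      linarith [mem_ball_iff_norm.1 hw']
    rw [hww, norm_smul, Real.norm_of_nonneg hδ.le]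
    calc δ * ‖w'‖ < δ * (‖v₀‖ + r₀) := by gcongr
      _ = R / 2 := by rw [hδ_def]; field_simp
  have hxR : x ∈ Metric.ball x₀ R := Metric.ball_subset_ball (by linarith) hx.2
  have hy : x + t • w ∈ Metric.ball x₀ R := by
    have h2 := mem_ball_iff_norm.1 hx.2
    rw [mem_ball_iff_norm, add_sub_right_comm]
    calc _ ≤ ‖x - x₀‖ + ‖t • w‖ := norm_add_le _ _
      _ = ‖x - x₀‖ + t * ‖w‖ := by rw [norm_smul, Real.norm_of_nonneg h0.le]
      _ < R := by nlinarith [norm_nonneg w]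
  rw [hball _ hy]
  refine (hρ.lt_of_inner_gradient_pos (convex_ball x₀ R) hy hxR fun z hz => ?_).trans_le
    (hρ.le_zero_of_mem_closure Metric.isOpen_ball hball hxR hx.1)
  have h3 : (inner ℝ (∇ ρ z) w' : ℝ) < 0 :=
    hAB (mk_mem_prod (hA (Metric.ball_subset_ball (min_le_right _ _) hz)) (hB hw'))
  rw [sub_add_cancel_left, inner_neg_right, hww, real_inner_smul_right, real_inner_smul_right,
    neg_pos]
  exact mul_neg_of_pos_of_neg h0 (mul_neg_of_pos_of_neg hδ h3)

/-- The divergence of a vector field. -/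
def divergence (F : EuclideanSpace ℝ (Fin n) → EuclideanSpace ℝ (Fin n))
    (x : EuclideanSpace ℝ (Fin n)) : ℝ :=
  ∑ i, fderiv ℝ F x (EuclideanSpace.single i 1) i

section Divergence

variable {F : EuclideanSpace ℝ (Fin n) → EuclideanSpace ℝ (Fin n)}

theorem divergence_smul {φ : EuclideanSpace ℝ (Fin n) → ℝ} {x : EuclideanSpace ℝ (Fin n)}
    (hφ : DifferentiableAt ℝ φ x) (hF : DifferentiableAt ℝ F x) :
    divergence (fun y => φ y • F y) x = fderiv ℝ φ x (F x) + φ x * divergence F x := by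
  have h1 : F x = ∑ i, F x i • EuclideanSpace.single i (1 : ℝ) := by
    simpa using ((EuclideanSpace.basisFun (Fin n) ℝ).sum_repr (F x)).symm
  have h2 : fderiv ℝ φ x (F x) = ∑ i, fderiv ℝ φ x (EuclideanSpace.single i 1) * F x i := by
    conv_lhs => rw [h1, map_sum]
    exact Finset.sum_congr rfl fun i _ => by rw [map_smul, smul_eq_mul, mul_comm]
  rw [divergence, divergence, h2, Finset.mul_sum, ← Finset.sum_add_distrib]
  refine Finset.sum_congr rfl fun i _ => ?_
  rw [fderiv_fun_smul hφ hF]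
  simp [add_comm]

theorem divergence_congr {F' : EuclideanSpace ℝ (Fin n) → EuclideanSpace ℝ (Fin n)}
    {x : EuclideanSpace ℝ (Fin n)} (h : F =ᶠ[𝓝 x] F') : divergence F x = divergence F' x := by
  rw [divergence, divergence, h.fderiv_eq]

theorem continuousOn_divergence {s : Set (EuclideanSpace ℝ (Fin n))} (hs : IsOpen s)
    (hF : ContDiffOn ℝ 1 F s) : ContinuousOn (divergence F) s := by
  have h := hF.continuousOn_fderiv_of_isOpen hs le_rfl
  unfold divergence
  refine continuousOn_finsetSum _ fun i _ => ?_
  exact (EuclideanSpace.proj i).continuous.comp_continuousOn (h.clm_apply continuousOn_const)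

theorem divergence_comp_add (F : EuclideanSpace ℝ (Fin n) → EuclideanSpace ℝ (Fin n))
    (w x : EuclideanSpace ℝ (Fin n)) :
    divergence (fun y => F (y + w)) x = divergence F (x + w) := by
  simp only [divergence, fderiv_comp_add_right]

end Divergence

namespace IsSmoothBoundedDomain

variable {F : EuclideanSpace ℝ (Fin n) → EuclideanSpace ℝ (Fin n)}

theorem setIntegral_divergence_of_contDiff (hΩ : IsSmoothBoundedDomain Ω)
    (hF : ContDiff ℝ 1 F) :
    ∫ x in Ω, divergence F x =
      ∫ x, inner ℝ (F x) (outerNormal Ω x) ∂(surfaceMeasure Ω) := by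
  have hcomp : ∀ i, ContDiff ℝ 1 fun x => F x i := fun i =>
    (EuclideanSpace.proj (𝕜 := ℝ) i).contDiff.comp hF
  have hd : ∀ i x, fderiv ℝ F x (EuclideanSpace.single i 1) i =
      fderiv ℝ (fun x => F x i) x (EuclideanSpace.single i 1) := by
    intro i x
    have := ((EuclideanSpace.proj i : EuclideanSpace ℝ (Fin n) →L[ℝ] ℝ).hasFDerivAt.comp x
      (hF.differentiable one_ne_zero x).hasFDerivAt).fderiv
    change _ = fderiv ℝ ((EuclideanSpace.proj i : EuclideanSpace ℝ (Fin n) →L[ℝ] ℝ) ∘ F) x _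
    rw [this]; rfl
  simp only [divergence, hd]
  have h1 : ∀ x, (inner ℝ (F x) (outerNormal Ω x) : ℝ) =
      ∑ i, F x i * inner ℝ (outerNormal Ω x) (EuclideanSpace.single i (1 : ℝ)) := by
    intro x
    simp [PiLp.inner_apply, mul_comm]
  simp only [h1]
  rw [integral_finsetSum, integral_finsetSum]
  · exact Finset.sum_congr rfl fun i _ => hΩ.setIntegral_fderiv (hcomp i) _
  · exact fun i _ => LocalGauss.integrable_mul_normal hΩ (hcomp i).continuous _
  · intro i _
    exact hΩ.integrableOn_of_continuousOn_closure
      (((hcomp i).continuous_fderiv one_ne_zero).clm_apply continuous_const).continuousOn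

theorem exists_smooth_one_near {K V : Set (EuclideanSpace ℝ (Fin n))} (hK : IsCompact K)
    (hV : IsOpen V) (hKV : K ⊆ V) :
    ∃ η : EuclideanSpace ℝ (Fin n) → ℝ, ContDiff ℝ ∞ η ∧ tsupport η ⊆ V ∧
      ∀ x ∈ K, ∀ᶠ y in 𝓝 x, η y = 1 := by
  obtain ⟨K', hK', h1, h2⟩ := exists_compact_between hK hV hKV
  obtain ⟨t, χ, -, hχ, -, hχV, -, hχ1⟩ := exists_finite_smooth_partition hK' (fun _ => V)
    fun x hx => hV.mem_nhds (h2 hx)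
  refine ⟨fun x => ∑ i, χ i x, ContDiff.sum fun i _ => hχ i, ?_, fun x hx => ?_⟩
  · have hclosed : IsClosed (⋃ i, tsupport (χ i)) :=
      isClosed_iUnion_of_finite fun i => isClosed_tsupport _
    refine (closure_minimal ?_ hclosed).trans (iUnion_subset hχV)
    intro x hx
    obtain ⟨i, -, hi⟩ := Finset.exists_ne_zero_of_sum_ne_zero hx
    exact mem_iUnion.2 ⟨i, subset_tsupport _ hi⟩
  · filter_upwards [isOpen_interior.mem_nhds (h1 hx)] with y hy
    exact hχ1 y (interior_subset hy)

theorem contDiff_of_contDiffAt_tsupport {X Y : Type*} [NormedAddCommGroup X] [NormedSpace ℝ X]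
    [NormedAddCommGroup Y] [NormedSpace ℝ Y] {f : X → Y} {k : WithTop ℕ∞}
    (h : ∀ x ∈ tsupport f, ContDiffAt ℝ k f x) : ContDiff ℝ k f := by
  refine contDiff_iff_contDiffAt.2 fun x => ?_
  by_cases hx : x ∈ tsupport f
  · exact h x hx
  · exact contDiffAt_const.congr_of_eventuallyEq (notMem_tsupport_iff_eventuallyEq.1 hx)

/-- The shifted field is `C¹` only where the translate lies in `Ω`. A cutoff equal to `1` near
`closure Ω ∩ tsupport χ` makes it global without changing values or divergence on the closure. -/
theorem exists_contDiff_shift (hΩ : IsOpen Ω) (hcpt : IsCompact (closure Ω))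
    (hF : ContDiffOn ℝ 1 F Ω) {χ : EuclideanSpace ℝ (Fin n) → ℝ} (hχ : ContDiff ℝ 1 χ)
    {w : EuclideanSpace ℝ (Fin n)} (hw : ∀ x ∈ closure Ω ∩ tsupport χ, x + w ∈ Ω) :
    ∃ G : EuclideanSpace ℝ (Fin n) → EuclideanSpace ℝ (Fin n), ContDiff ℝ 1 G ∧
      (∀ x ∈ closure Ω, G x = χ x • F (x + w)) ∧
      ∀ x ∈ closure Ω, divergence G x =
        fderiv ℝ χ x (F (x + w)) + χ x * divergence F (x + w) := by
  have hV : IsOpen ((· + w) ⁻¹' Ω) := hΩ.preimage (by fun_prop)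
  obtain ⟨η, hη, hηV, hη1⟩ := exists_smooth_one_near
    (hcpt.inter_right (isClosed_tsupport χ)) hV hw
  have hFw : ∀ x ∈ (· + w) ⁻¹' Ω, ContDiffAt ℝ 1 (fun y => F (y + w)) x := fun x hx =>
    ContDiffAt.comp x (hF.contDiffAt (hΩ.mem_nhds hx)) (by fun_prop)
  have hη' : ContDiff ℝ 1 η := hη.of_le (by exact_mod_cast le_top)
  refine ⟨fun x => η x • χ x • F (x + w), ?_, fun x hx => ?_, fun x hx => ?_⟩
  · refine contDiff_of_contDiffAt_tsupport fun x hx => ?_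
    have hxV := hηV (closure_mono (Function.support_smul_subset_left _ _) hx)
    exact hη'.contDiffAt.smul (hχ.contDiffAt.smul (hFw x hxV))
  · by_cases hxs : x ∈ tsupport χ
    · simp only [(hη1 x ⟨hx, hxs⟩).self_of_nhds, one_smul]
    · simp [image_eq_zero_of_notMem_tsupport hxs]
  · by_cases hxs : x ∈ tsupport χ
    · have h1 : (fun x => η x • χ x • F (x + w)) =ᶠ[𝓝 x] fun x => χ x • F (x + w) := by
        filter_upwards [hη1 x ⟨hx, hxs⟩] with y hy
        rw [hy, one_smul]
      rw [divergence_congr h1, divergence_smul (hχ.differentiable one_ne_zero x)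
        ((hFw x (hw x ⟨hx, hxs⟩)).differentiableAt one_ne_zero), divergence_comp_add]
    · have h0 : ∀ᶠ y in 𝓝 x, χ y = 0 := notMem_tsupport_iff_eventuallyEq.1 hxs
      have h1 : (fun x => η x • χ x • F (x + w)) =ᶠ[𝓝 x] fun x => 0 := by
        filter_upwards [h0] with y hy
        rw [hy, zero_smul, smul_zero]
      have h2 : fderiv ℝ χ x = 0 :=
        image_eq_zero_of_notMem_tsupport fun h => hxs (tsupport_fderiv_subset ℝ h)
      rw [divergence_congr h1, h2, h0.self_of_nhds]
      simp [divergence]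

/-- Gauss' theorem holds for the field shifted into `Ω` along the interior cone by `w₀ / (j + 1)`.
Letting `j → ∞`, the bound on the divergence dominates the volume integrals, and continuity on the
closure handles the surface integrals. -/
theorem setIntegral_divergence_local (hΩ : IsSmoothBoundedDomain Ω)
    (hF : ContDiffOn ℝ 1 F Ω) (hFc : ContinuousOn F (closure Ω)) {M : ℝ}
    (hM : ∀ x ∈ Ω, |divergence F x| ≤ M) {x₀ : EuclideanSpace ℝ (Fin n)}
    (hx₀ : x₀ ∈ closure Ω) :
    ∃ U ∈ 𝓝 x₀, ∀ χ : EuclideanSpace ℝ (Fin n) → ℝ, ContDiff ℝ 1 χ → HasCompactSupport χ →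
      tsupport χ ⊆ U → ∫ x in Ω, (fderiv ℝ χ x (F x) + χ x * divergence F x) =
        ∫ x, χ x * inner ℝ (F x) (outerNormal Ω x) ∂(surfaceMeasure Ω) := by
  obtain ⟨U, hU, w₀, r, hr, hcone⟩ := hΩ.exists_interior_cone hx₀
  refine ⟨U, hU, fun χ hχ hχs hχU => ?_⟩
  set t : ℕ → ℝ := fun j => 1 / ((j : ℝ) + 1) with ht_def
  have ht : Tendsto t atTop (𝓝 0) := tendsto_one_div_add_atTop_nhds_zero_nat
  have hwt : ∀ j, ∀ x ∈ closure Ω ∩ tsupport χ, x + t j • w₀ ∈ Ω := fun j x hx =>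
    hcone x ⟨hx.1, hχU hx.2⟩ w₀ (Metric.mem_ball_self hr) (t j) Nat.one_div_pos_of_nat
      (by simp only [ht_def]; rw [div_le_one (by positivity)]; simp)
  choose G hG hGχ hGdiv using fun j =>
    exists_contDiff_shift hΩ.isOpen hΩ.isCompact_closure hF hχ (hwt j)
  obtain ⟨M', hM'⟩ := hΩ.isCompact_closure.exists_bound_of_continuousOn hFc
  have hshift : ∀ x, Tendsto (fun j => x + t j • w₀) atTop (𝓝 x) := fun x => by
    simpa using (ht.smul_const w₀).const_add x
  have hfin := hΩ.isFiniteMeasure_restrict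
  have hfin' := hΩ.isFiniteMeasure_surfaceMeasure
  -- convergence of the volume integrals
  have hlim1 : Tendsto (fun j => ∫ x in Ω, divergence (G j) x) atTop
      (𝓝 (∫ x in Ω, (fderiv ℝ χ x (F x) + χ x * divergence F x))) := by
    refine tendsto_integral_of_dominated_convergence
      (fun x => ‖fderiv ℝ χ x‖ * M' + |χ x| * M) (fun j => ?_) ?_ (fun j => ?_) ?_
    · exact ((continuousOn_divergence isOpen_univ (hG j).contDiffOn).mono
        (subset_univ Ω)).aestronglyMeasurable hΩ.isOpen.measurableSet
    · have : Continuous fun x => ‖fderiv ℝ χ x‖ * M' + |χ x| * M :=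
        ((hχ.continuous_fderiv one_ne_zero).norm.mul continuous_const).add
          (hχ.continuous.abs.mul continuous_const)
      exact hΩ.integrableOn_of_continuousOn_closure this.continuousOn
    · filter_upwards [ae_restrict_mem hΩ.isOpen.measurableSet] with x hx
      rw [hGdiv j x (subset_closure hx)]
      by_cases hxs : x ∈ tsupport χ
      · have hmem := hwt j x ⟨subset_closure hx, hxs⟩
        refine (norm_add_le _ _).trans (add_le_add ?_ ?_)
        · exact ((fderiv ℝ χ x).le_opNorm _).trans
            (mul_le_mul_of_nonneg_left (hM' _ (subset_closure hmem)) (norm_nonneg _))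
        · rw [Real.norm_eq_abs, abs_mul]
          exact mul_le_mul_of_nonneg_left (hM _ hmem) (abs_nonneg _)
      · have h2 : fderiv ℝ χ x = 0 :=
          image_eq_zero_of_notMem_tsupport fun h => hxs (tsupport_fderiv_subset ℝ h)
        simp [h2, image_eq_zero_of_notMem_tsupport hxs]
    · filter_upwards [ae_restrict_mem hΩ.isOpen.measurableSet] with x hx
      simp only [hGdiv _ x (subset_closure hx)]
      have c1 : ContinuousAt F x := hF.continuousOn.continuousAt (hΩ.isOpen.mem_nhds hx)
      have c2 : ContinuousAt (divergence F) x :=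
        (continuousOn_divergence hΩ.isOpen hF).continuousAt (hΩ.isOpen.mem_nhds hx)
      exact (((fderiv ℝ χ x).continuous.tendsto _).comp (c1.tendsto.comp (hshift x))).add
        ((c2.tendsto.comp (hshift x)).const_mul _)
  -- convergence of the surface integrals
  have hlim2 : Tendsto (fun j => ∫ x, inner ℝ (G j x) (outerNormal Ω x) ∂(surfaceMeasure Ω)) atTop
      (𝓝 (∫ x, χ x * inner ℝ (F x) (outerNormal Ω x) ∂(surfaceMeasure Ω))) := by
    refine tendsto_integral_of_dominated_convergence (fun x => |χ x| * M') (fun j => ?_) ?_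
      (fun j => ?_) ?_
    · exact (hΩ.integrable_surfaceMeasure ((hG j).continuous.continuousOn.inner
        hΩ.continuousOn_outerNormal)).aestronglyMeasurable
    · exact hΩ.integrable_surfaceMeasure (hχ.continuous.abs.mul continuous_const).continuousOn
    · filter_upwards [ae_mem_frontier Ω] with x hx
      have hxc := frontier_subset_closure hx
      rw [hGχ j x hxc, real_inner_smul_left, norm_mul, Real.norm_eq_abs]
      by_cases hxs : x ∈ tsupport χ
      · refine mul_le_mul_of_nonneg_left ?_ (abs_nonneg _)
        refine (norm_inner_le_norm _ _).trans ?_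
        rw [hΩ.norm_outerNormal hx, mul_one]
        exact hM' _ (subset_closure (hwt j x ⟨hxc, hxs⟩))
      · simp [image_eq_zero_of_notMem_tsupport hxs]
    · filter_upwards [ae_mem_frontier Ω] with x hx
      have hxc := frontier_subset_closure hx
      simp only [hGχ _ x hxc, real_inner_smul_left]
      by_cases hxs : x ∈ tsupport χ
      · have c1 : Tendsto (fun j => F (x + t j • w₀)) atTop (𝓝 (F x)) :=
          (hFc x hxc).tendsto.comp (tendsto_nhdsWithin_iff.2 ⟨hshift x,
            Eventually.of_forall fun j => subset_closure (hwt j x ⟨hxc, hxs⟩)⟩)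
        exact (c1.inner tendsto_const_nhds).const_mul _
      · simp [image_eq_zero_of_notMem_tsupport hxs]
  refine tendsto_nhds_unique hlim1 ?_
  simpa only [hΩ.setIntegral_divergence_of_contDiff (hG _)] using hlim2

/-- **Gauss' theorem** for vector fields that are continuous up to the boundary and have bounded
divergence. -/
theorem setIntegral_divergence (hΩ : IsSmoothBoundedDomain Ω)
    (hF : ContDiffOn ℝ 1 F Ω) (hFc : ContinuousOn F (closure Ω)) {M : ℝ}
    (hM : ∀ x ∈ Ω, |divergence F x| ≤ M) :
    ∫ x in Ω, divergence F x =
      ∫ x, inner ℝ (F x) (outerNormal Ω x) ∂(surfaceMeasure Ω) := by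
  choose! U hU hUF using fun x (hx : x ∈ closure Ω) =>
    hΩ.setIntegral_divergence_local hF hFc hM hx
  obtain ⟨t, χ, hc, hχ, hχs, hχU, -, hχ1⟩ :=
    exists_finite_smooth_partition hΩ.isCompact_closure U hU
  have hχ' : ∀ i, ContDiff ℝ 1 (χ i) := fun i => (hχ i).of_le (by exact_mod_cast le_top)
  have hloc := fun i : t => hUF i (hc i) (χ i) (hχ' i) (hχs i) (hχU i)
  have hdiv : IntegrableOn (divergence F) Ω :=
    hΩ.integrableOn_of_bound (continuousOn_divergence hΩ.isOpen hF) hM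
  have h1 : ∫ x in Ω, divergence F x =
      ∑ i, ∫ x in Ω, (fderiv ℝ (χ i) x (F x) + χ i x * divergence F x) := by
    rw [← integral_finsetSum]
    · refine setIntegral_congr_fun hΩ.isOpen.measurableSet fun x hx => ?_
      have heq : (fun y => ∑ i, χ i y) =ᶠ[𝓝 x] fun _ => 1 := by
        filter_upwards [hΩ.isOpen.mem_nhds hx] with y hy using hχ1 y (subset_closure hy)
      -- The derivative terms of the localized formulas cancel, because the cutoffs sum to the
      -- constant `1` near `x`.
      have h0 : ∑ i, fderiv ℝ (χ i) x = 0 := by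
        rw [← fderiv_fun_sum fun i _ => (hχ' i).differentiable one_ne_zero x, heq.fderiv_eq,
          fderiv_fun_const]; rfl
      rw [Finset.sum_add_distrib, ← Finset.sum_mul, hχ1 x (subset_closure hx), one_mul,
        ← sum_apply, h0]
      simp
    · intro i _
      refine Integrable.add ?_ ?_
      · exact hΩ.integrableOn_of_continuousOn_closure
          (((hχ' i).continuous_fderiv one_ne_zero).continuousOn.clm_apply hFc)
      · obtain ⟨C, hC⟩ := (hχs i).exists_bound_of_continuous (hχ i).continuous
        exact hdiv.bdd_mul (hχ i).continuous.aestronglyMeasurable (Eventually.of_forall hC)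
  rw [h1, Finset.sum_congr rfl fun i _ => hloc i, ← integral_finsetSum]
  · refine integral_congr_ae ?_
    filter_upwards [ae_mem_frontier Ω] with x hx
    rw [← Finset.sum_mul, hχ1 x (frontier_subset_closure hx), one_mul]
  · intro i _
    exact hΩ.integrable_surfaceMeasure ((hχ i).continuous.continuousOn.mul
      ((hFc.mono frontier_subset_closure).inner hΩ.continuousOn_outerNormal))

end IsSmoothBoundedDomain

/-! ### Controlling the `L²` norm by the gradient and the `L¹` norm. -/

theorem sq_lintegral_le {α : Type*} [MeasurableSpace α] (μ : Measure α) {g : α → ENNReal}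
    (hg : AEMeasurable g μ) : (∫⁻ a, g a ∂μ) ^ 2 ≤ μ univ * ∫⁻ a, g a ^ 2 ∂μ := by
  have h := ENNReal.lintegral_mul_le_Lp_mul_Lq μ Real.HolderConjugate.two_two
    (f := fun _ => 1) aemeasurable_const hg
  simp only [Pi.mul_apply, one_mul, ENNReal.rpow_two, one_pow, lintegral_one] at h
  calc (∫⁻ a, g a ∂μ) ^ 2
      ≤ (μ univ ^ (1 / 2 : ℝ) * (∫⁻ a, g a ^ 2 ∂μ) ^ (1 / 2 : ℝ)) ^ 2 := by gcongr
    _ = _ := by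
      rw [mul_pow, ← ENNReal.rpow_two, ← ENNReal.rpow_two, ← ENNReal.rpow_mul, ← ENNReal.rpow_mul]
      norm_num

/-- The fundamental theorem of calculus along the segment. The extended nonnegative integral spares
any integrability assumption on the gradient, and the indicator makes the integrand a function on
the whole space, ready for translation. -/
theorem enorm_le_add_lintegral_segment (hΩ : IsOpen Ω) {v : EuclideanSpace ℝ (Fin n) → ℝ}
    (hv : ContDiffOn ℝ 1 v Ω) {x w : EuclideanSpace ℝ (Fin n)}
    (hseg : ∀ t ∈ Icc (0 : ℝ) 1, x + t • w ∈ Ω) :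
    ‖v x‖ₑ ≤ ‖v (x + w)‖ₑ +
      ‖w‖ₑ * ∫⁻ t in Ioc (0 : ℝ) 1, Ω.indicator (fun y => ‖fderiv ℝ v y‖ₑ) (x + t • w) := by
  have hd : ∀ t ∈ uIcc (0 : ℝ) 1, HasDerivAt (fun t : ℝ => v (x + t • w))
      (fderiv ℝ v (x + t • w) w) t := by
    intro t ht
    rw [uIcc_of_le zero_le_one] at ht
    have h1 : HasDerivAt (fun t : ℝ => x + t • w) w t := by
      simpa using ((hasDerivAt_id t).smul_const w).const_add x
    have h2 : HasFDerivAt v (fderiv ℝ v (x + t • w)) (x + t • w) :=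
      ((hv.contDiffAt (hΩ.mem_nhds (hseg t ht))).differentiableAt one_ne_zero).hasFDerivAt
    exact h2.comp_hasDerivAt t h1
  have hc : ContinuousOn (fun t : ℝ => fderiv ℝ v (x + t • w) w) (uIcc 0 1) := by
    rw [uIcc_of_le zero_le_one]
    exact ((hv.continuousOn_fderiv_of_isOpen hΩ le_rfl).comp (by fun_prop)
      (fun t ht => hseg t ht)).clm_apply continuousOn_const
  have hftc := intervalIntegral.integral_eq_sub_of_hasDerivAt hd hc.intervalIntegrable
  rw [intervalIntegral.integral_of_le zero_le_one, one_smul, zero_smul, add_zero] at hftc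
  have h1 : v x = v (x + w) - ∫ t in Ioc (0 : ℝ) 1, fderiv ℝ v (x + t • w) w := by
    rw [hftc]; ring
  rw [h1]
  refine enorm_sub_le.trans (add_le_add le_rfl ?_)
  refine (enorm_integral_le_lintegral_enorm _).trans ?_
  rw [← lintegral_const_mul' _ _ enorm_ne_top]
  refine setLIntegral_mono' measurableSet_Ioc fun t ht => ?_
  rw [indicator_of_mem (hseg t (Ioc_subset_Icc_self ht)), mul_comm]
  exact (fderiv ℝ v (x + t • w)).le_opENorm w

namespace IsSmoothBoundedDomain

/-- The segment estimate is averaged over the endpoints `x + w`, with `w` in the ball of cone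
directions. The endpoint values average to at most the `L¹` norm of `v`. The gradient term is
squared by Cauchy-Schwarz and integrated in `x`. -/
theorem setLIntegral_sq_le_local (hΩ : IsSmoothBoundedDomain Ω)
    {x₀ : EuclideanSpace ℝ (Fin n)} (hx₀ : x₀ ∈ closure Ω) :
    ∃ U ∈ 𝓝 x₀, ∃ C : ENNReal, C ≠ ⊤ ∧ ∀ v : EuclideanSpace ℝ (Fin n) → ℝ, ContDiffOn ℝ 1 v Ω →
      ∫⁻ x in Ω ∩ U, ‖v x‖ₑ ^ 2 ≤
        C * ((∫⁻ x in Ω, ‖fderiv ℝ v x‖ₑ ^ 2) + (∫⁻ x in Ω, ‖v x‖ₑ) ^ 2) := by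
  obtain ⟨U, hU, w₀, r, hr, hcone⟩ := hΩ.exists_interior_cone hx₀
  set W := Metric.ball w₀ r
  set R : ENNReal := ENNReal.ofReal (‖w₀‖ + r)
  have hR : ∀ w ∈ W, ‖w‖ₑ ≤ R := by
    intro w hw
    rw [← ofReal_norm]
    refine ENNReal.ofReal_le_ofReal ?_
    have := norm_sub_norm_le w w₀
    linarith [mem_ball_iff_norm.1 hw]
  have hW0 : volume W ≠ 0 := (Metric.measure_ball_pos _ _ hr).ne'
  have hWt : volume W ≠ ⊤ := measure_ball_lt_top.ne
  refine ⟨U, hU, (volume W ^ 2)⁻¹ * (2 * volume Ω + 2 * (R * volume W) ^ 2), ?_, fun v hv => ?_⟩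
  · have h1 : volume Ω ≠ ⊤ := hΩ.isBounded.measure_lt_top.ne
    refine ENNReal.mul_ne_top (ENNReal.inv_ne_top.2 (pow_ne_zero 2 hW0)) (ENNReal.add_ne_top.2
      ⟨ENNReal.mul_ne_top (by simp) h1, ENNReal.mul_ne_top (by simp)
        (ENNReal.pow_ne_top (ENNReal.mul_ne_top ENNReal.ofReal_ne_top hWt))⟩)
  set g : EuclideanSpace ℝ (Fin n) → ENNReal := Ω.indicator fun y => ‖fderiv ℝ v y‖ₑ
  have hg : Measurable g :=
    (measurable_fderiv ℝ v).enorm.indicator hΩ.isOpen.measurableSet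
  set μ : Measure (EuclideanSpace ℝ (Fin n) × ℝ) :=
    (volume.restrict W).prod (volume.restrict (Ioc (0 : ℝ) 1)) with hμ
  have hμW : μ univ = volume W := by
    rw [hμ, ← univ_prod_univ, Measure.prod_prod]; simp
  have hgm : Measurable fun p : EuclideanSpace ℝ (Fin n) × (EuclideanSpace ℝ (Fin n) × ℝ) =>
      g (p.1 + p.2.2 • p.2.1) := hg.comp (by fun_prop)
  have hgx : ∀ x, Measurable fun q : EuclideanSpace ℝ (Fin n) × ℝ => g (x + q.2 • q.1) :=
    fun x => hg.comp (by fun_prop)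
  set I := ∫⁻ x in Ω, ‖v x‖ₑ
  have hpt : ∀ x ∈ Ω ∩ U, volume W * ‖v x‖ₑ ≤ I + R * ∫⁻ q, g (x + q.2 • q.1) ∂μ := by
    intro x hx
    have h1 : volume W * ‖v x‖ₑ = ∫⁻ _ in W, ‖v x‖ₑ := by
      rw [setLIntegral_const, mul_comm]
    have h2 : ∀ w ∈ W, ‖v x‖ₑ ≤ Ω.indicator (fun y => ‖v y‖ₑ) (x + w) +
        R * ∫⁻ t in Ioc (0 : ℝ) 1, g (x + t • w) := by
      intro w hw
      have hseg : ∀ t ∈ Icc (0 : ℝ) 1, x + t • w ∈ Ω := by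
        intro t ht
        rcases ht.1.eq_or_lt with h0 | h0
        · rw [← h0, zero_smul, add_zero]; exact hx.1
        · exact hcone x ⟨subset_closure hx.1, hx.2⟩ w hw t h0 ht.2
      have hxw : x + w ∈ Ω := by simpa using hseg 1 (by simp)
      rw [indicator_of_mem hxw]
      refine (enorm_le_add_lintegral_segment hΩ.isOpen hv hseg).trans ?_
      gcongr
      exact hR w hw
    have hm : Measurable fun w : EuclideanSpace ℝ (Fin n) =>
        ∫⁻ t in Ioc (0 : ℝ) 1, g (x + t • w) := (hgx x).lintegral_prod_right'
    calc volume W * ‖v x‖ₑ = ∫⁻ _ in W, ‖v x‖ₑ := h1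
      _ ≤ ∫⁻ w in W, (Ω.indicator (fun y => ‖v y‖ₑ) (x + w) +
          R * ∫⁻ t in Ioc (0 : ℝ) 1, g (x + t • w)) := setLIntegral_mono' measurableSet_ball h2
      _ = (∫⁻ w in W, Ω.indicator (fun y => ‖v y‖ₑ) (x + w)) +
          R * ∫⁻ w in W, ∫⁻ t in Ioc (0 : ℝ) 1, g (x + t • w) := by
        rw [lintegral_add_right _ (hm.const_mul R), lintegral_const_mul _ hm]
      _ ≤ I + R * ∫⁻ q, g (x + q.2 • q.1) ∂μ := by
        gcongr
        · refine (setLIntegral_le_lintegral W _).trans_eq ?_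
          rw [lintegral_add_left_eq_self (fun y => Ω.indicator (fun y => ‖v y‖ₑ) y) x,
            lintegral_indicator hΩ.isOpen.measurableSet]
        · rw [hμ, lintegral_prod _ (hgx x).aemeasurable]
  have hsq : ∀ x ∈ Ω ∩ U, volume W ^ 2 * ‖v x‖ₑ ^ 2 ≤
      2 * I ^ 2 + 2 * R ^ 2 * volume W * ∫⁻ q, g (x + q.2 • q.1) ^ 2 ∂μ := by
    intro x hx
    rw [← mul_pow]
    calc (volume W * ‖v x‖ₑ) ^ 2 ≤ (I + R * ∫⁻ q, g (x + q.2 • q.1) ∂μ) ^ 2 := by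
          gcongr; exact hpt x hx
      _ ≤ 2 * (I ^ 2 + (R * ∫⁻ q, g (x + q.2 • q.1) ∂μ) ^ 2) := by
          have := ENNReal.rpow_add_le_mul_rpow_add_rpow I (R * ∫⁻ q, g (x + q.2 • q.1) ∂μ)
            (p := 2) (by norm_num)
          norm_num at this
          exact this
      _ = 2 * I ^ 2 + 2 * R ^ 2 * (∫⁻ q, g (x + q.2 • q.1) ∂μ) ^ 2 := by ring
      _ ≤ 2 * I ^ 2 + 2 * R ^ 2 * (μ univ * ∫⁻ q, g (x + q.2 • q.1) ^ 2 ∂μ) := by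
          gcongr; exact sq_lintegral_le μ (hgx x).aemeasurable
      _ = _ := by rw [hμW]; ring
  -- After Tonelli the inner integral is over a translate of `g ^ 2`, so it does not depend on `q`.
  have hswap : ∫⁻ x, ∫⁻ q, g (x + q.2 • q.1) ^ 2 ∂μ = volume W * ∫⁻ x in Ω, ‖fderiv ℝ v x‖ₑ ^ 2 := by
    rw [lintegral_lintegral_swap (hgm.pow_const 2).aemeasurable]
    have : ∀ q : EuclideanSpace ℝ (Fin n) × ℝ,
        ∫⁻ x, g (x + q.2 • q.1) ^ 2 = ∫⁻ x in Ω, ‖fderiv ℝ v x‖ₑ ^ 2 := by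
      intro q
      rw [lintegral_add_right_eq_self (fun x => g x ^ 2), ← lintegral_indicator
        hΩ.isOpen.measurableSet]
      congr 1; ext1 x
      by_cases hx : x ∈ Ω <;> simp [g, hx]
    simp only [this]
    rw [lintegral_const, hμW, mul_comm]
  set D := ∫⁻ x in Ω, ‖fderiv ℝ v x‖ₑ ^ 2
  have hΩm := hΩ.isOpen.measurableSet
  have hmeas : Measurable fun x => ∫⁻ q, g (x + q.2 • q.1) ^ 2 ∂μ :=
    (hgm.pow_const 2).lintegral_prod_right'
  have hfin : volume W ^ 2 * ∫⁻ x in Ω ∩ U, ‖v x‖ₑ ^ 2 ≤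
      2 * volume Ω * I ^ 2 + 2 * (R * volume W) ^ 2 * D := by
    rw [← lintegral_const_mul' _ _ (ENNReal.pow_ne_top hWt)]
    calc ∫⁻ x in Ω ∩ U, volume W ^ 2 * ‖v x‖ₑ ^ 2
        ≤ ∫⁻ x in Ω ∩ U, (2 * I ^ 2 +
            2 * R ^ 2 * volume W * ∫⁻ q, g (x + q.2 • q.1) ^ 2 ∂μ) :=
          setLIntegral_mono (by fun_prop) hsq
      _ ≤ (∫⁻ x in Ω ∩ U, 2 * I ^ 2) +
          2 * R ^ 2 * volume W * ∫⁻ x, ∫⁻ q, g (x + q.2 • q.1) ^ 2 ∂μ := by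
          rw [lintegral_add_right _ (hmeas.const_mul _), lintegral_const_mul _ hmeas]
          gcongr
          exact Measure.restrict_le_self
      _ ≤ 2 * I ^ 2 * volume Ω + 2 * R ^ 2 * volume W * (volume W * D) := by
          rw [setLIntegral_const, hswap]
          gcongr
          exact inter_subset_left
      _ = _ := by ring
  calc ∫⁻ x in Ω ∩ U, ‖v x‖ₑ ^ 2
      = (volume W ^ 2)⁻¹ * (volume W ^ 2 * ∫⁻ x in Ω ∩ U, ‖v x‖ₑ ^ 2) := by
        rw [← mul_assoc, ENNReal.inv_mul_cancel (pow_ne_zero 2 hW0) (ENNReal.pow_ne_top hWt),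
          one_mul]
    _ ≤ (volume W ^ 2)⁻¹ * (2 * volume Ω * I ^ 2 + 2 * (R * volume W) ^ 2 * D) := by gcongr
    _ ≤ (volume W ^ 2)⁻¹ * ((2 * volume Ω + 2 * (R * volume W) ^ 2) * (D + I ^ 2)) := by
        gcongr
        rw [add_mul, mul_add, mul_add]
        exact add_le_add le_add_self le_self_add
    _ = _ := by ring

/-- An inequality of Friedrichs type with an `L¹` remainder. -/
theorem exists_setLIntegral_sq_le (hΩ : IsSmoothBoundedDomain Ω) :
    ∃ C : ENNReal, C ≠ ⊤ ∧ ∀ v : EuclideanSpace ℝ (Fin n) → ℝ, ContDiffOn ℝ 1 v Ω →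
      ∫⁻ x in Ω, ‖v x‖ₑ ^ 2 ≤
        C * ((∫⁻ x in Ω, ‖fderiv ℝ v x‖ₑ ^ 2) + (∫⁻ x in Ω, ‖v x‖ₑ) ^ 2) := by
  have h := hΩ.isCompact_closure.induction_on (p := fun s => ∃ C : ENNReal, C ≠ ⊤ ∧
    ∀ v : EuclideanSpace ℝ (Fin n) → ℝ, ContDiffOn ℝ 1 v Ω → ∫⁻ x in Ω ∩ s, ‖v x‖ₑ ^ 2 ≤
        C * ((∫⁻ x in Ω, ‖fderiv ℝ v x‖ₑ ^ 2) + (∫⁻ x in Ω, ‖v x‖ₑ) ^ 2)) ?_ ?_ ?_ ?_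
  · simpa only [inter_eq_left.2 (subset_closure (s := Ω))] using h
  · exact ⟨0, by simp, fun v _ => by simp⟩
  · rintro s t hst ⟨C, hC, h⟩
    exact ⟨C, hC, fun v hv =>
      (lintegral_mono_set (inter_subset_inter_right _ hst)).trans (h v hv)⟩
  · rintro s t ⟨C, hC, h⟩ ⟨C', hC', h'⟩
    refine ⟨C + C', ENNReal.add_ne_top.2 ⟨hC, hC'⟩, fun v hv => ?_⟩
    rw [inter_union_distrib_left, add_mul]
    exact (lintegral_union_le _ _ _).trans (add_le_add (h v hv) (h' v hv))
  · intro x hx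
    obtain ⟨U, hU, C, hC, h⟩ := hΩ.setLIntegral_sq_le_local hx
    exact ⟨U, nhdsWithin_le_nhds hU, C, hC, h⟩

end IsSmoothBoundedDomain

/-! ### Friedrichs' inequality for functions `C¹` up to the boundary. -/

/-- `v` is `C¹` up to the boundary, and `G` is the continuous extension of its gradient. -/
structure IsC1Closure (Ω : Set (EuclideanSpace ℝ (Fin n))) (v : EuclideanSpace ℝ (Fin n) → ℝ)
    (G : EuclideanSpace ℝ (Fin n) → EuclideanSpace ℝ (Fin n)) : Prop where
  contDiffOn : ContDiffOn ℝ 1 v Ω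
  continuousOn : ContinuousOn v (closure Ω)
  continuousOn_gradient : ContinuousOn G (closure Ω)
  eq_gradient : ∀ x ∈ Ω, G x = ∇ v x

theorem norm_gradient (v : EuclideanSpace ℝ (Fin n) → ℝ) (x : EuclideanSpace ℝ (Fin n)) :
    ‖∇ v x‖ = ‖fderiv ℝ v x‖ := by
  simp [gradient]

theorem fderiv_apply_eq_inner (v : EuclideanSpace ℝ (Fin n) → ℝ)
    (x y : EuclideanSpace ℝ (Fin n)) : fderiv ℝ v x y = inner ℝ (∇ v x) y :=
  inner_gradient_left.symm

theorem isC1Closure_of_contDiff {v : EuclideanSpace ℝ (Fin n) → ℝ} (hv : ContDiff ℝ 1 v) :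
    IsC1Closure Ω v (∇ v) :=
  ⟨hv.contDiffOn, hv.continuous.continuousOn,
    ((InnerProductSpace.toDual ℝ (EuclideanSpace ℝ (Fin n))).symm.continuous.comp
      (hv.continuous_fderiv one_ne_zero)).continuousOn, fun _ _ => rfl⟩

namespace IsC1Closure

variable {v : EuclideanSpace ℝ (Fin n) → ℝ}
  {G : EuclideanSpace ℝ (Fin n) → EuclideanSpace ℝ (Fin n)}

theorem exists_bound (h : IsC1Closure Ω v G) (hΩ : IsSmoothBoundedDomain Ω) :
    ∃ M, 0 ≤ M ∧ (∀ x ∈ closure Ω, |v x| ≤ M) ∧ (∀ x ∈ closure Ω, ‖G x‖ ≤ M) ∧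
      ∀ x ∈ Ω, ‖∇ v x‖ ≤ M := by
  obtain ⟨M₁, h1⟩ := hΩ.isCompact_closure.exists_bound_of_continuousOn h.continuousOn
  obtain ⟨M₂, h2⟩ := hΩ.isCompact_closure.exists_bound_of_continuousOn h.continuousOn_gradient
  refine ⟨max 0 (max M₁ M₂), le_max_left _ _, fun x hx => ?_, fun x hx => ?_, fun x hx => ?_⟩
  · exact (h1 x hx).trans ((le_max_left _ _).trans (le_max_right _ _))
  · exact (h2 x hx).trans ((le_max_right _ _).trans (le_max_right _ _))
  · rw [← h.eq_gradient x hx]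
    exact (h2 x (subset_closure hx)).trans ((le_max_right _ _).trans (le_max_right _ _))

theorem continuousOn_norm_gradient_pow (h : IsC1Closure Ω v G) (k : ℕ) :
    ContinuousOn (fun x => ‖G x‖ ^ k) (closure Ω) :=
  h.continuousOn_gradient.norm.pow k

theorem integrableOn_norm_gradient_pow (h : IsC1Closure Ω v G) (hΩ : IsSmoothBoundedDomain Ω)
    (k : ℕ) : IntegrableOn (fun x => ‖∇ v x‖ ^ k) Ω :=
  (hΩ.integrableOn_of_continuousOn_closure (h.continuousOn_norm_gradient_pow k)).congr_fun
    (fun x hx => by simp only [h.eq_gradient x hx]) hΩ.isOpen.measurableSet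

end IsC1Closure

theorem divergence_id (x : EuclideanSpace ℝ (Fin n)) : divergence (fun y => y) x = n := by
  simp [divergence]

namespace IsSmoothBoundedDomain

/-- The `L¹` norm is controlled by the `L¹` norms of the gradient and of the boundary values. -/
theorem exists_integral_abs_le (hΩ : IsSmoothBoundedDomain Ω) (hn : 1 ≤ n) :
    ∃ C, 0 ≤ C ∧ ∀ v G, IsC1Closure Ω v G →
      ∫ x in Ω, |v x| ≤ C * ((∫ x in Ω, ‖∇ v x‖) + ∫ x, |v x| ∂(surfaceMeasure Ω)) := by
  obtain ⟨R, hR⟩ := hΩ.isCompact_closure.exists_bound_of_continuousOn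
    (f := fun x : EuclideanSpace ℝ (Fin n) => x) continuousOn_id
  have hR0 : 0 ≤ R := by
    obtain ⟨x, hx⟩ := hΩ.isConnected.nonempty
    exact (norm_nonneg _).trans (hR x (subset_closure hx))
  have := hΩ.isFiniteMeasure_surfaceMeasure
  have := hΩ.isFiniteMeasure_restrict
  refine ⟨R, hR0, fun v G h => ?_⟩
  set σ := surfaceMeasure Ω
  have hgi := h.integrableOn_norm_gradient_pow hΩ 1
  simp only [pow_one] at hgi
  have hvi : IntegrableOn (fun x => |v x|) Ω :=
    hΩ.integrableOn_of_continuousOn_closure h.continuousOn.abs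
  have hvσ : Integrable (fun x => |v x|) σ :=
    hΩ.integrable_surfaceMeasure (h.continuousOn.mono frontier_subset_closure).abs
  have key : ∀ ε > 0, ∫ x in Ω, |v x| ≤ R * ((∫ x in Ω, ‖∇ v x‖) +
      ((∫ x, |v x| ∂σ) + ε * σ.real univ)) := by
    intro ε hε
    -- A differentiable substitute for `|v|`. Gauss' theorem is applied to the field `s(y) y`, whose
    -- divergence is `n s` plus a term bounded by `R ‖∇v‖`; then `ε → 0`.
    set s : EuclideanSpace ℝ (Fin n) → ℝ := fun x => √(v x ^ 2 + ε ^ 2) with hs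
    have hpos : ∀ x, 0 < v x ^ 2 + ε ^ 2 := fun x => by positivity
    have hs1 : ∀ x, |v x| ≤ s x := fun x => by
      rw [← Real.sqrt_sq_eq_abs]
      exact Real.sqrt_le_sqrt (by nlinarith)
    have hs2 : ∀ x, s x ≤ |v x| + ε := fun x => by
      rw [hs, Real.sqrt_le_left (by positivity)]
      nlinarith [abs_nonneg (v x), sq_abs (v x)]
    have hsc : ContinuousOn s (closure Ω) :=
      (Real.continuous_sqrt.comp_continuousOn ((h.continuousOn.pow 2).add continuousOn_const))
    have hsC1 : ContDiffOn ℝ 1 s Ω :=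
      ((h.contDiffOn.pow 2).add contDiffOn_const).sqrt fun x _ => (hpos x).ne'
    have hfd : ∀ x ∈ Ω, fderiv ℝ s x = (v x / s x) • fderiv ℝ v x := by
      intro x hx
      have h1 : HasFDerivAt v (fderiv ℝ v x) x :=
        ((h.contDiffOn.contDiffAt (hΩ.isOpen.mem_nhds hx)).differentiableAt
          one_ne_zero).hasFDerivAt
      have h2 := (((h1.pow 2).add_const (ε ^ 2)).sqrt (hpos x).ne').fderiv
      have h3 : fderiv ℝ s x = _ := h2
      rw [h3, smul_smul]
      congr 1
      have : s x ≠ 0 := (Real.sqrt_pos.2 (hpos x)).ne'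
      change 1 / (2 * s x) * _ = _
      simp
      field_simp
    have hfdn : ∀ x ∈ Ω, |fderiv ℝ s x x| ≤ R * ‖∇ v x‖ := by
      intro x hx
      have hsx : 0 < s x := Real.sqrt_pos.2 (hpos x)
      have h1 : |v x / s x| ≤ 1 := by
        rw [abs_div, abs_of_pos hsx, div_le_one hsx]; exact hs1 x
      rw [hfd x hx, norm_gradient]
      calc |((v x / s x) • fderiv ℝ v x) x| = |v x / s x| * ‖fderiv ℝ v x x‖ := by
            simp [abs_mul]
        _ ≤ 1 * (‖fderiv ℝ v x‖ * R) := by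
            gcongr
            exact (fderiv ℝ v x).le_opNorm_of_le (hR x (subset_closure hx))
        _ = _ := by ring
    have hdiv : ∀ x ∈ Ω, divergence (fun y => s y • y) x = fderiv ℝ s x x + s x * n := by
      intro x hx
      rw [divergence_smul (F := fun y => y) ((hsC1.contDiffAt (hΩ.isOpen.mem_nhds hx)).differentiableAt one_ne_zero)
        differentiableAt_fun_id, divergence_id]
    obtain ⟨M, hM0, hMv, -, hMg⟩ := h.exists_bound hΩ
    have hgauss := hΩ.setIntegral_divergence (F := fun y => s y • y) (hsC1.smul contDiffOn_id)
      (hsc.smul continuousOn_id) (M := R * M + (M + ε) * n) (fun x hx => by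
        rw [hdiv x hx]
        refine (abs_add_le _ _).trans (add_le_add ((hfdn x hx).trans ?_) ?_)
        · exact mul_le_mul_of_nonneg_left (hMg x hx) hR0
        · rw [abs_mul, Nat.abs_cast, abs_of_nonneg (Real.sqrt_nonneg _)]
          gcongr
          exact (hs2 x).trans (by gcongr; exact hMv x (subset_closure hx)))
    rw [setIntegral_congr_fun hΩ.isOpen.measurableSet hdiv] at hgauss
    have hsi : IntegrableOn s Ω := hΩ.integrableOn_of_continuousOn_closure hsc
    have hdi : IntegrableOn (fun x => fderiv ℝ s x x) Ω :=
      hΩ.integrableOn_of_bound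
        ((hsC1.continuousOn_fderiv_of_isOpen hΩ.isOpen le_rfl).clm_apply continuousOn_id)
        (M := R * M) fun x hx =>
          (hfdn x hx).trans (mul_le_mul_of_nonneg_left (hMg x hx) hR0)
    rw [integral_add hdi (hsi.mul_const _), integral_mul_const] at hgauss
    have e1 : ∫ x in Ω, |v x| ≤ ∫ x in Ω, s x := integral_mono hvi hsi hs1
    have e2 : -(∫ x in Ω, fderiv ℝ s x x) ≤ R * ∫ x in Ω, ‖∇ v x‖ := by
      rw [← integral_neg, ← integral_const_mul]
      exact setIntegral_mono_on hdi.neg (hgi.const_mul R) hΩ.isOpen.measurableSet fun x hx =>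
        (neg_le_abs _).trans (hfdn x hx)
    have e3 : ∫ x, inner ℝ (s x • x) (outerNormal Ω x) ∂σ ≤
        R * ((∫ x, |v x| ∂σ) + ε * σ.real univ) := by
      have : (∫ x, |v x| ∂σ) + ε * σ.real univ = ∫ x, (|v x| + ε) ∂σ := by
        rw [integral_add hvσ (integrable_const _), integral_const, smul_eq_mul, mul_comm]
      rw [this, ← integral_const_mul]
      refine integral_mono_ae (hΩ.integrable_surfaceMeasure
        (((hsc.mono frontier_subset_closure).smul continuousOn_id).inner
          hΩ.continuousOn_outerNormal)) ((hvσ.add (integrable_const _)).const_mul R) ?_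
      filter_upwards [ae_mem_frontier Ω] with x hx
      refine (real_inner_le_norm _ _).trans ?_
      rw [hΩ.norm_outerNormal hx, mul_one, norm_smul, Real.norm_of_nonneg (Real.sqrt_nonneg _),
        mul_comm]
      exact mul_le_mul (hR x (frontier_subset_closure hx)) (hs2 x) (Real.sqrt_nonneg _) hR0
    have e4 : ∫ x in Ω, s x ≤ (∫ x in Ω, s x) * n := by
      have h1 : 0 ≤ ∫ x in Ω, s x := integral_nonneg fun x => Real.sqrt_nonneg _
      have h2 : (1 : ℝ) ≤ n := by exact_mod_cast hn
      nlinarith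
    calc ∫ x in Ω, |v x| ≤ (∫ x in Ω, s x) * n := e1.trans e4
      _ ≤ R * (∫ x in Ω, ‖∇ v x‖) + R * ((∫ x, |v x| ∂σ) + ε * σ.real univ) := by linarith
      _ = _ := by ring
  have hlim : Tendsto (fun ε : ℝ => R * ((∫ x in Ω, ‖∇ v x‖) +
      ((∫ x, |v x| ∂σ) + ε * σ.real univ))) (𝓝[>] 0)
      (𝓝 (R * ((∫ x in Ω, ‖∇ v x‖) + ∫ x, |v x| ∂σ))) := by
    have hc : Continuous fun ε : ℝ => R * ((∫ x in Ω, ‖∇ v x‖) +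
      ((∫ x, |v x| ∂σ) + ε * σ.real univ)) := by fun_prop
    have := (hc.tendsto 0).mono_left (nhdsWithin_le_nhds (s := Ioi 0))
    simpa using this
  exact ge_of_tendsto hlim (by filter_upwards [self_mem_nhdsWithin] with ε hε using key ε hε)

theorem setLIntegral_enorm_eq {φ : EuclideanSpace ℝ (Fin n) → ℝ}
    (hφ : IntegrableOn φ Ω) (h0 : ∀ x, 0 ≤ φ x) :
    ∫⁻ x in Ω, ‖φ x‖ₑ = ENNReal.ofReal (∫ x in Ω, φ x) := by
  rw [← ofReal_integral_norm_eq_lintegral_enorm hφ]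
  simp only [Real.norm_of_nonneg (h0 _)]

/-- **Friedrichs' inequality** with the `L¹` norm of the boundary values. -/
theorem exists_integral_sq_le (hΩ : IsSmoothBoundedDomain Ω) (hn : 1 ≤ n) :
    ∃ C, 0 ≤ C ∧ ∀ v G, IsC1Closure Ω v G →
      ∫ x in Ω, v x ^ 2 ≤
        C * ((∫ x in Ω, ‖∇ v x‖ ^ 2) + (∫ x, |v x| ∂(surfaceMeasure Ω)) ^ 2) := by
  obtain ⟨C₁, hC₁, h1⟩ := hΩ.exists_integral_abs_le hn
  obtain ⟨C₂, hC₂, h2⟩ := hΩ.exists_setLIntegral_sq_le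
  have hfin := hΩ.isFiniteMeasure_restrict
  set V := (volume.restrict Ω).real univ
  -- `C₂` bounds the squared `L²` norm by `D + I²`, `C₁` bounds `I` by the `L¹` norms of gradient
  -- and boundary values, and `V`, the volume of `Ω`, enters when the gradient passes from `L¹` to
  -- `L²`.
  refine ⟨C₂.toReal * (1 + 2 * C₁ ^ 2 * (V + 1)), by positivity, fun v G h => ?_⟩
  set σ := surfaceMeasure Ω
  have hv2 : IntegrableOn (fun x => v x ^ 2) Ω :=
    hΩ.integrableOn_of_continuousOn_closure (h.continuousOn.pow 2)
  have hv1 : IntegrableOn (fun x => |v x|) Ω :=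
    hΩ.integrableOn_of_continuousOn_closure h.continuousOn.abs
  have hg2 := h.integrableOn_norm_gradient_pow hΩ 2
  have hg1 := h.integrableOn_norm_gradient_pow hΩ 1
  simp only [pow_one] at hg1
  have c1 := setLIntegral_enorm_eq hv2 fun _ => sq_nonneg _
  have c2 := setLIntegral_enorm_eq hv1 fun _ => abs_nonneg _
  have c3 := setLIntegral_enorm_eq hg2 fun _ => sq_nonneg _
  have c4 := setLIntegral_enorm_eq hg1 fun _ => norm_nonneg _
  simp only [enorm_pow, enorm_norm, Real.enorm_abs] at c1 c2 c3 c4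
  have hcs := sq_lintegral_le (volume.restrict Ω) (g := fun x => ‖∇ v x‖ₑ)
    (by simpa using hg1.aestronglyMeasurable.enorm)
  rw [c3, c4, ← ENNReal.ofReal_pow (integral_nonneg fun _ => norm_nonneg _),
    ← ENNReal.ofReal_toReal (measure_ne_top (volume.restrict Ω) univ),
    ← ENNReal.ofReal_mul ENNReal.toReal_nonneg, ENNReal.ofReal_le_ofReal_iff (by positivity)] at hcs
  change _ ≤ V * _ at hcs
  have hfr := h2 v h.contDiffOn
  have hen : ∀ x, ‖fderiv ℝ v x‖ₑ = ‖∇ v x‖ₑ := fun x => by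
    rw [← ofReal_norm, ← ofReal_norm, norm_gradient]
  simp only [hen] at hfr
  have hI0 : 0 ≤ ∫ x in Ω, |v x| := integral_nonneg fun _ => abs_nonneg _
  have hD0 : 0 ≤ ∫ x in Ω, ‖∇ v x‖ ^ 2 := integral_nonneg fun _ => sq_nonneg _
  rw [c1, c2, c3, ← ENNReal.ofReal_pow hI0, ← ENNReal.ofReal_add hD0 (by positivity),
    ← ENNReal.ofReal_toReal hC₂, ← ENNReal.ofReal_mul ENNReal.toReal_nonneg,
    ENNReal.ofReal_le_ofReal_iff (by positivity)] at hfr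
  refine hfr.trans ?_
  rw [mul_assoc]
  refine mul_le_mul_of_nonneg_left ?_ ENNReal.toReal_nonneg
  have h3 := h1 v G h
  set I := ∫ x in Ω, |v x|
  set D := ∫ x in Ω, ‖∇ v x‖ ^ 2
  set D₁ := ∫ x in Ω, ‖∇ v x‖
  set B := ∫ x, |v x| ∂σ
  have h4 : I ^ 2 ≤ C₁ ^ 2 * (2 * (D₁ ^ 2 + B ^ 2)) := by
    calc I ^ 2 ≤ (C₁ * (D₁ + B)) ^ 2 := by gcongr
      _ = C₁ ^ 2 * (D₁ + B) ^ 2 := by ring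
      _ ≤ _ := by gcongr; nlinarith [sq_nonneg (D₁ - B)]
  have hV : 0 ≤ V := measureReal_nonneg
  calc D + I ^ 2 ≤ D + C₁ ^ 2 * (2 * (V * D + B ^ 2)) := by
        refine add_le_add le_rfl (h4.trans ?_); gcongr
    _ ≤ (1 + 2 * C₁ ^ 2 * (V + 1)) * (D + B ^ 2) := by
        have e1 : 0 ≤ C₁ ^ 2 * D := by positivity
        have e2 : 0 ≤ C₁ ^ 2 * (V * B ^ 2) := by positivity
        have e3 : 0 ≤ B ^ 2 := sq_nonneg _
        nlinarith

end IsSmoothBoundedDomain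

/-! ### Green's identity and weak gradients. -/

/-- The divergence of the gradient is the Laplacian. -/
theorem divergence_gradient (u : EuclideanSpace ℝ (Fin n) → ℝ) (x : EuclideanSpace ℝ (Fin n)) :
    divergence (∇ u) x = (Δ u) x := by
  rw [InnerProductSpace.laplacian_eq_iteratedFDeriv_orthonormalBasis u
    (EuclideanSpace.basisFun (Fin n) ℝ)]
  simp only [divergence, iteratedFDeriv_two_apply]
  refine Finset.sum_congr rfl fun i _ => ?_
  set L := (InnerProductSpace.toDual ℝ (EuclideanSpace ℝ (Fin n))).symm
  have h1 : ∇ u = L ∘ fderiv ℝ u := rfl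
  have h2 : fderiv ℝ (∇ u) x (EuclideanSpace.single i 1) =
      L (fderiv ℝ (fderiv ℝ u) x (EuclideanSpace.single i 1)) := by
    rw [h1]
    have := L.comp_fderiv (f := fderiv ℝ u) (x := x)
    rw [this]; rfl
  rw [h2]
  set ℓ := fderiv ℝ (fderiv ℝ u) x (EuclideanSpace.single i 1)
  have h3 : inner ℝ (L ℓ) (EuclideanSpace.single i (1 : ℝ)) = ℓ (EuclideanSpace.single i 1) :=
    InnerProductSpace.toDual_symm_apply
  rw [EuclideanSpace.inner_single_right] at h3
  simpa [ℓ] using h3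

/-- **Green's identity** for functions that are `C¹` up to the boundary. -/
theorem IsC1Closure.green {u φ : EuclideanSpace ℝ (Fin n) → ℝ}
    {G Gφ : EuclideanSpace ℝ (Fin n) → EuclideanSpace ℝ (Fin n)} (hΩ : IsSmoothBoundedDomain Ω)
    (hφ : IsC1Closure Ω φ Gφ) (hu : IsC1Closure Ω u G) (hu2 : ContDiffOn ℝ 2 u Ω) {M : ℝ}
    (hM : ∀ x ∈ Ω, |(Δ u) x| ≤ M) :
    ∫ x in Ω, (inner ℝ (∇ φ x) (∇ u x) + φ x * (Δ u) x) =
      ∫ x, φ x * inner ℝ (G x) (outerNormal Ω x) ∂(surfaceMeasure Ω) := by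
  have hG1 : ContDiffOn ℝ 1 (∇ u) Ω := by
    have h1 : ContDiffOn ℝ 1 (fderiv ℝ u) Ω := hu2.fderiv_of_isOpen hΩ.isOpen (by norm_num)
    exact (InnerProductSpace.toDual ℝ
      (EuclideanSpace ℝ (Fin n))).symm.toContinuousLinearEquiv.contDiff.comp_contDiffOn h1
  have hdiv : ∀ x ∈ Ω, divergence (fun y => φ y • G y) x =
      inner ℝ (∇ φ x) (∇ u x) + φ x * (Δ u) x := by
    intro x hx
    have h1 : (fun y => φ y • G y) =ᶠ[𝓝 x] fun y => φ y • ∇ u y := by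
      filter_upwards [hΩ.isOpen.mem_nhds hx] with y hy
      rw [hu.eq_gradient y hy]
    rw [divergence_congr h1, divergence_smul
      ((hφ.contDiffOn.contDiffAt (hΩ.isOpen.mem_nhds hx)).differentiableAt one_ne_zero)
      ((hG1.contDiffAt (hΩ.isOpen.mem_nhds hx)).differentiableAt one_ne_zero),
      divergence_gradient, fderiv_apply_eq_inner]
  obtain ⟨M₁, hM₁, b1, -, b2⟩ := hφ.exists_bound hΩ
  obtain ⟨M₂, hM₂, -, -, b3⟩ := hu.exists_bound hΩ
  have hF : ContDiffOn ℝ 1 (fun y => φ y • G y) Ω :=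
    (hφ.contDiffOn.smul hG1).congr fun x hx => by rw [hu.eq_gradient x hx]; rfl
  have := hΩ.setIntegral_divergence hF (hφ.continuousOn.smul hu.continuousOn_gradient)
    (M := M₁ * M₂ + M₁ * M) fun x hx => by
      rw [hdiv x hx]
      refine (abs_add_le _ _).trans (add_le_add ?_ ?_)
      · exact (abs_real_inner_le_norm _ _).trans
          (mul_le_mul (b2 x hx) (b3 x hx) (norm_nonneg _) hM₁)
      · rw [abs_mul]
        exact mul_le_mul (b1 x (subset_closure hx)) (hM x hx) (abs_nonneg _) hM₁
  rw [setIntegral_congr_fun hΩ.isOpen.measurableSet hdiv] at this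
  simpa only [real_inner_smul_left] using this

theorem continuousOn_gradient_of_contDiffOn (hΩ : IsOpen Ω) {v : EuclideanSpace ℝ (Fin n) → ℝ}
    (hv : ContDiffOn ℝ 1 v Ω) : ContinuousOn (∇ v) Ω :=
  (InnerProductSpace.toDual ℝ _).symm.continuous.comp_continuousOn
    (hv.continuousOn_fderiv_of_isOpen hΩ le_rfl)

/-- Integration by parts against a test function with compact support in `Ω`. -/
theorem setIntegral_smul_gradient_eq_neg (hΩ : IsOpen Ω) {v φ : EuclideanSpace ℝ (Fin n) → ℝ}
    (hv : ContDiffOn ℝ 1 v Ω) (hφ : ContDiff ℝ ∞ φ) (hφs : HasCompactSupport φ)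
    (hφΩ : tsupport φ ⊆ Ω) :
    ∫ x in Ω, v x • ∇ φ x = - ∫ x in Ω, φ x • ∇ v x := by
  have hφ1 : ContDiff ℝ 1 φ := hφ.of_le (by exact_mod_cast le_top)
  have hf : ContDiff ℝ 1 fun x => φ x * v x := by
    refine IsSmoothBoundedDomain.contDiff_of_contDiffAt_tsupport fun x hx => hφ1.contDiffAt.mul
      (hv.contDiffAt (hΩ.mem_nhds (hφΩ ?_)))
    exact closure_mono (Function.support_mul_subset_left _ _) hx
  have hfs : HasCompactSupport fun x => φ x * v x := hφs.mul_right
  have hgradφ : ∀ x, x ∉ tsupport φ → ∇ φ x = 0 := by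
    intro x hx
    have : fderiv ℝ φ x = 0 :=
      image_eq_zero_of_notMem_tsupport fun h => hx (tsupport_fderiv_subset ℝ h)
    simp [gradient, this]
  have hint : ∀ (a : EuclideanSpace ℝ (Fin n) → ℝ)
      (b : EuclideanSpace ℝ (Fin n) → EuclideanSpace ℝ (Fin n)), ContinuousOn a Ω →
      ContinuousOn b Ω → (∀ x, x ∉ tsupport φ → a x • b x = 0) →
      IntegrableOn (fun x => a x • b x) Ω := by
    intro a b ha hb h0
    have hc : ContinuousOn (fun x => a x • b x) (tsupport φ) :=
      (ha.mono hφΩ).smul (hb.mono hφΩ)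
    have h1 : IntegrableOn (fun x => a x • b x) (tsupport φ) := hc.integrableOn_compact hφs
    exact (integrableOn_iff_integrable_of_support_subset
      (fun x hx => by_contra fun h => hx (h0 x h))).1 h1 |>.integrableOn
  have i1 := hint v (∇ φ) hv.continuousOn (continuousOn_gradient_of_contDiffOn hΩ hφ1.contDiffOn) fun x hx => by
    rw [hgradφ x hx, smul_zero]
  have i2 := hint φ (∇ v) hφ.continuous.continuousOn (continuousOn_gradient_of_contDiffOn hΩ hv) fun x hx => by
    rw [image_eq_zero_of_notMem_tsupport hx, zero_smul]
  rw [eq_neg_iff_add_eq_zero, ← integral_add i1 i2]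
  -- Paired with `e`, the integrand is the derivative of `φ v` in the direction `e`, whose integral
  -- vanishes by compact support in `Ω`.
  refine ext_inner_left ℝ fun e => ?_
  have i3 : IntegrableOn (fun x => v x • ∇ φ x + φ x • ∇ v x) Ω := i1.add i2
  rw [← integral_inner i3, inner_zero_right]
  have h1 : ∫ x in Ω, fderiv ℝ (fun x => φ x * v x) x e = 0 := by
    rw [setIntegral_eq_integral_of_forall_compl_eq_zero, integral_fderiv_eq_zero hf hfs e]
    intro x hx
    have : x ∉ tsupport (fderiv ℝ fun x => φ x * v x) := fun h => hx (hφΩ (closure_mono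
      (Function.support_mul_subset_left _ _) (tsupport_fderiv_subset ℝ h)))
    rw [image_eq_zero_of_notMem_tsupport this]; rfl
  rw [← h1]
  refine setIntegral_congr_fun hΩ.measurableSet fun x hx => ?_
  have h2 := (hv.contDiffAt (hΩ.mem_nhds hx)).differentiableAt one_ne_zero
  rw [fderiv_fun_mul (hφ1.differentiable one_ne_zero x) h2]
  simp only [add_apply, smul_apply, fderiv_apply_eq_inner, smul_eq_mul,
    inner_add_right, real_inner_smul_right]
  rw [real_inner_comm (∇ v x), real_inner_comm (∇ φ x)]
  ring

/-- The weak gradient of a `C¹` function is its classical gradient. -/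
theorem IsH1With.ae_eq_gradient (hΩ : IsSmoothBoundedDomain Ω)
    {v : EuclideanSpace ℝ (Fin n) → ℝ} {G : EuclideanSpace ℝ (Fin n) → EuclideanSpace ℝ (Fin n)}
    (hv : ContDiffOn ℝ 1 v Ω) (h : IsH1With Ω v G) : G =ᵐ[volume.restrict Ω] ∇ v := by
  have := hΩ.isFiniteMeasure_restrict
  have hGi : IntegrableOn G Ω := h.memLp_gradient.integrable one_le_two
  have hloc : LocallyIntegrableOn (∇ v) Ω :=
    (continuousOn_gradient_of_contDiffOn hΩ.isOpen hv).locallyIntegrableOn hΩ.isOpen.measurableSet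
  have key := IsOpen.ae_eq_zero_of_integral_contDiff_smul_eq_zero (μ := volume) hΩ.isOpen
    (hGi.locallyIntegrableOn.sub hloc) fun φ hφ hφs hφΩ => by
      rw [← setIntegral_eq_integral_of_forall_compl_eq_zero (s := Ω) fun x hx => by
        rw [image_eq_zero_of_notMem_tsupport fun h => hx (hφΩ h), zero_smul]]
      have h1 := h.weak_gradient φ hφ hφs hφΩ
      rw [setIntegral_smul_gradient_eq_neg hΩ.isOpen hv hφ hφs hφΩ, neg_inj] at h1
      have e1 : IntegrableOn (fun x => φ x • G x) Ω := by
        obtain ⟨C, hC⟩ := hφs.exists_bound_of_continuous hφ.continuous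
        exact hGi.bdd_smul _ hφ.continuous.aestronglyMeasurable (Eventually.of_forall hC)
      have e2 : IntegrableOn (fun x => φ x • ∇ v x) Ω := by
        have hc : ContinuousOn (fun x => φ x • ∇ v x) (tsupport φ) :=
          hφ.continuous.continuousOn.smul ((continuousOn_gradient_of_contDiffOn hΩ.isOpen hv).mono hφΩ)
        exact (integrableOn_iff_integrable_of_support_subset fun x hx => by_contra fun h0 =>
          hx (by simp only [image_eq_zero_of_notMem_tsupport h0, zero_smul])).1
            (hc.integrableOn_compact hφs) |>.integrableOn
      simp only [Pi.sub_apply, smul_sub]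
      rw [integral_sub e1 e2, h1, sub_self]
  rw [EventuallyEq, ae_restrict_iff' hΩ.isOpen.measurableSet]
  filter_upwards [key] with x hx hxΩ
  exact sub_eq_zero.1 (hx hxΩ)

/-- Pairings with a bounded function are continuous with respect to `L²` convergence. -/
theorem tendsto_integral_inner_of_tendsto_eLpNorm {α H : Type*} [MeasurableSpace α]
    {μ : Measure α} [IsFiniteMeasure μ] [NormedAddCommGroup H] [InnerProductSpace ℝ H]
    {f : ℕ → α → H} {g a : α → H} {M : ℝ} (hf : ∀ j, MemLp (f j) 2 μ) (hg : MemLp g 2 μ)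
    (ha : AEStronglyMeasurable a μ) (hM : ∀ᵐ x ∂μ, ‖a x‖ ≤ M)
    (h : Tendsto (fun j => eLpNorm (fun x => f j x - g x) 2 μ) atTop (𝓝 0)) :
    Tendsto (fun j => ∫ x, inner ℝ (f j x) (a x) ∂μ) atTop (𝓝 (∫ x, inner ℝ (g x) (a x) ∂μ)) := by
  have hint : ∀ b : α → H, MemLp b 2 μ → Integrable (fun x => (inner ℝ (b x) (a x) : ℝ)) μ := by
    intro b hb
    refine ((hb.integrable one_le_two).norm.mul_const M).mono' (hb.1.inner ha) ?_
    filter_upwards [hM] with x hx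
    exact (norm_inner_le_norm _ _).trans (by gcongr)
  refine tendsto_integral_of_L1' _ (hint g hg).aestronglyMeasurable (Eventually.of_forall fun j => hint _ (hf j)) ?_
  have hle : ∀ j, eLpNorm ((fun x => (inner ℝ (f j x) (a x) : ℝ)) - fun x => inner ℝ (g x) (a x)) 1 μ
      ≤ ENNReal.ofReal M * (eLpNorm (fun x => f j x - g x) 2 μ *
        μ univ ^ (1 / (1 : ENNReal).toReal - 1 / (2 : ENNReal).toReal)) := by
    intro j
    refine (eLpNorm_le_mul_eLpNorm_of_ae_le_mul (g := fun x => f j x - g x) (c := M) ?_ 1).trans ?_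
    · filter_upwards [hM] with x hx
      simp only [Pi.sub_apply]
      rw [← inner_sub_left, mul_comm]
      exact (norm_inner_le_norm _ _).trans (by gcongr)
    · gcongr
      exact eLpNorm_le_eLpNorm_mul_rpow_measure_univ (by norm_num)
        ((hf j).1.sub hg.1)
  refine tendsto_of_tendsto_of_tendsto_of_le_of_le tendsto_const_nhds ?_ (fun _ => zero_le) hle
  have h1 : μ univ ^ (1 / (1 : ENNReal).toReal - 1 / (2 : ENNReal).toReal) ≠ ⊤ :=
    ENNReal.rpow_ne_top_of_nonneg (by norm_num) (measure_ne_top _ _)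
  have := ENNReal.Tendsto.const_mul (ENNReal.Tendsto.mul_const h (Or.inr h1))
    (Or.inr (ENNReal.ofReal_ne_top (r := M)))
  simpa using this

/-! ### Green's identity under a trace hypothesis. -/

/-- Functions that are `C¹` in `Ω` and satisfy Green's identity with their boundary values. -/
structure IsAdmissible (Ω : Set (EuclideanSpace ℝ (Fin n)))
    (v : EuclideanSpace ℝ (Fin n) → ℝ) : Prop where
  contDiffOn : ContDiffOn ℝ 1 v Ω
  bounded : ∃ M, ∀ x ∈ Ω, |v x| ≤ M
  isH1With : IsH1With Ω v (∇ v)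
  integrable_boundary : Integrable v (surfaceMeasure Ω)
  green : ∀ (w : EuclideanSpace ℝ (Fin n) → ℝ)
    (G : EuclideanSpace ℝ (Fin n) → EuclideanSpace ℝ (Fin n)) (M : ℝ),
    IsC1Closure Ω w G → ContDiffOn ℝ 2 w Ω → (∀ x ∈ Ω, |(Δ w) x| ≤ M) →
    ∫ x in Ω, (inner ℝ (∇ v x) (∇ w x) + v x * (Δ w) x) =
      ∫ x, v x * inner ℝ (G x) (outerNormal Ω x) ∂(surfaceMeasure Ω)

theorem IsSmoothBoundedDomain.memLp_of_bound (hΩ : IsSmoothBoundedDomain Ω) {F : Type*}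
    [NormedAddCommGroup F] {f : EuclideanSpace ℝ (Fin n) → F} (hf : ContinuousOn f Ω) {M : ℝ}
    (hM : ∀ x ∈ Ω, ‖f x‖ ≤ M) (p : ENNReal) : MemLp f p (volume.restrict Ω) := by
  have := hΩ.isFiniteMeasure_restrict
  refine MemLp.of_bound (hf.aestronglyMeasurable hΩ.isOpen.measurableSet) M ?_
  filter_upwards [ae_restrict_mem hΩ.isOpen.measurableSet] with x hx using hM x hx

theorem IsC1Closure.isAdmissible (hΩ : IsSmoothBoundedDomain Ω)
    {v : EuclideanSpace ℝ (Fin n) → ℝ} {G : EuclideanSpace ℝ (Fin n) → EuclideanSpace ℝ (Fin n)}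
    (h : IsC1Closure Ω v G) : IsAdmissible Ω v := by
  obtain ⟨M, -, hM, -, hM'⟩ := h.exists_bound hΩ
  refine ⟨h.contDiffOn, ⟨M, fun x hx => hM x (subset_closure hx)⟩, ⟨?_, ?_, ?_⟩, ?_, ?_⟩
  · exact hΩ.memLp_of_bound h.contDiffOn.continuousOn
      (fun x hx => hM x (subset_closure hx)) 2
  · exact hΩ.memLp_of_bound (continuousOn_gradient_of_contDiffOn hΩ.isOpen h.contDiffOn) hM' 2
  · exact fun φ hφ hφs hφΩ =>
      setIntegral_smul_gradient_eq_neg hΩ.isOpen h.contDiffOn hφ hφs hφΩ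
  · exact hΩ.integrable_surfaceMeasure (h.continuousOn.mono frontier_subset_closure)
  · exact fun w Gw M' hw hw2 hM' => IsC1Closure.green hΩ h hw hw2 hM'

/-- Green's identity holds for the smooth approximants. Each of its terms pairs the approximant, its
gradient or its boundary values with a bounded function, namely `Δ w`, `∇ w` or the normal
derivative of `w`, so `L²` convergence carries the identity to the limit. -/
theorem HasTrace.isAdmissible (hΩ : IsSmoothBoundedDomain Ω)
    {v : EuclideanSpace ℝ (Fin n) → ℝ} (hv : ContDiffOn ℝ 1 v Ω)
    (hb : ∃ M, ∀ x ∈ Ω, |v x| ≤ M) (h : HasTrace Ω v v) : IsAdmissible Ω v := by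
  obtain ⟨hσ, G, hG, φ, hφ, l1, l2, l3⟩ := h
  have hfin := hΩ.isFiniteMeasure_restrict
  have hfin' := hΩ.isFiniteMeasure_surfaceMeasure
  have hae := hG.ae_eq_gradient hΩ hv
  have hH1 : IsH1With Ω v (∇ v) := by
    refine ⟨hG.memLp, hG.memLp_gradient.ae_eq hae, fun φ hφ hφs hφΩ =>
      setIntegral_smul_gradient_eq_neg hΩ.isOpen hv hφ hφs hφΩ⟩
  refine ⟨hv, hb, hH1, hσ.integrable one_le_two, fun w Gw M hw hw2 hM => ?_⟩
  have hφC : ∀ j, IsC1Closure Ω (φ j) (∇ (φ j)) := fun j =>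
    isC1Closure_of_contDiff ((hφ j).of_le (by exact_mod_cast le_top))
  have hφA : ∀ j, IsAdmissible Ω (φ j) := fun j => (hφC j).isAdmissible hΩ
  obtain ⟨M', hM'0, -, hMG, hMw⟩ := hw.exists_bound hΩ
  have hΩm := hΩ.isOpen.measurableSet
  have hΔc : ContinuousOn (Δ w) Ω := by
    have h1 : ContDiffOn ℝ 1 (∇ w) Ω :=
      (InnerProductSpace.toDual ℝ
        (EuclideanSpace ℝ (Fin n))).symm.toContinuousLinearEquiv.contDiff.comp_contDiffOn
        (hw2.fderiv_of_isOpen hΩ.isOpen (by norm_num))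
    exact (continuousOn_divergence hΩ.isOpen h1).congr fun x _ => (divergence_gradient w x).symm
  have hgw : AEStronglyMeasurable (∇ w) (volume.restrict Ω) :=
    (continuousOn_gradient_of_contDiffOn hΩ.isOpen hw.contDiffOn).aestronglyMeasurable hΩm
  have hgwb : ∀ᵐ x ∂(volume.restrict Ω), ‖∇ w x‖ ≤ M' := by
    filter_upwards [ae_restrict_mem hΩm] with x hx using hMw x hx
  have hΔb : ∀ᵐ x ∂(volume.restrict Ω), ‖(Δ w) x‖ ≤ M := by
    filter_upwards [ae_restrict_mem hΩm] with x hx using hM x hx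
  have t1 := tendsto_integral_inner_of_tendsto_eLpNorm (fun j => (hφA j).isH1With.memLp_gradient)
    hH1.memLp_gradient hgw hgwb (by
      refine l2.congr fun j => eLpNorm_congr_ae ?_
      filter_upwards [hae] with x hx
      rw [hx])
  have t2 := tendsto_integral_inner_of_tendsto_eLpNorm (fun j => (hφA j).isH1With.memLp)
    hG.memLp (hΔc.aestronglyMeasurable hΩm) hΔb l1
  have t3 := tendsto_integral_inner_of_tendsto_eLpNorm (M := M')
    (fun j => MemLp.of_bound (hφA j).integrable_boundary.aestronglyMeasurable
      ((hφC j).exists_bound hΩ).choose (by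
        filter_upwards [IsSmoothBoundedDomain.ae_mem_frontier Ω] with x hx
        exact ((hφC j).exists_bound hΩ).choose_spec.2.1 x (frontier_subset_closure hx)))
    hσ (a := fun x => (inner ℝ (Gw x) (outerNormal Ω x) : ℝ))
    (hΩ.integrable_surfaceMeasure ((hw.continuousOn_gradient.mono frontier_subset_closure).inner
      hΩ.continuousOn_outerNormal)).aestronglyMeasurable (by
        filter_upwards [IsSmoothBoundedDomain.ae_mem_frontier Ω] with x hx
        refine (norm_inner_le_norm _ _).trans ?_
        rw [hΩ.norm_outerNormal hx, mul_one]
        exact hMG x (frontier_subset_closure hx)) l3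
  have hsplit : ∀ f : EuclideanSpace ℝ (Fin n) → ℝ, IsH1With Ω f (∇ f) →
      ∫ x in Ω, (inner ℝ (∇ f x) (∇ w x) + f x * (Δ w) x) =
        (∫ x in Ω, inner ℝ (∇ f x) (∇ w x)) + ∫ x in Ω, inner ℝ (f x) ((Δ w) x) := by
    intro f hf
    have i1 : IntegrableOn (fun x => (inner ℝ (∇ f x) (∇ w x) : ℝ)) Ω := by
      refine ((hf.memLp_gradient.integrable one_le_two).norm.mul_const M').mono'
        (hf.memLp_gradient.1.inner hgw) ?_
      filter_upwards [hgwb] with x hx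
      exact (norm_inner_le_norm _ _).trans (by gcongr)
    have i2 : IntegrableOn (fun x => f x * (Δ w) x) Ω :=
      (hf.memLp.integrable one_le_two).mul_bdd (hΔc.aestronglyMeasurable hΩm) hΔb
    rw [integral_add i1 i2]
    simp only [RCLike.inner_apply, conj_trivial, mul_comm]
  rw [hsplit v hH1]
  have t4 := (t1.add t2).congr fun j => ((hsplit (φ j) (hφA j).isH1With).symm.trans
    ((hφA j).green w Gw M hw hw2 hM))
  refine (tendsto_nhds_unique t4 (t3.congr fun j => ?_)).trans ?_
  · simp only [RCLike.inner_apply, conj_trivial, mul_comm]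
  · simp only [RCLike.inner_apply, conj_trivial, mul_comm]

/-! ### Boundary inequalities from the Robin condition and one iteration step. -/

/-- Boundary functions related by a Robin condition `w + h b = 0` with
`h = m |u| / ∫ |u|`: lower bound for `∫ u b`. -/
theorem neg_le_integral_mul_of_robin {α : Type*} [MeasurableSpace α] {μ : Measure α}
    {u w b : α → ℝ} {m : ℝ} (hm : 0 < m) (hu : Integrable u μ) (hw : Integrable w μ)
    (hub : Integrable (fun x => u x * b x) μ)
    (h : ∀ᵐ x ∂μ, w x + m * |u x| / (∫ y, |u y| ∂μ) * b x = 0) :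
    -((∫ x, |u x| ∂μ) * ∫ x, |w x| ∂μ) ≤ m * ∫ x, u x * b x ∂μ := by
  set I := ∫ x, |u x| ∂μ with hI
  have hI0 : 0 ≤ I := integral_nonneg fun _ => abs_nonneg _
  have hu0 : I = 0 → ∀ᵐ x ∂μ, u x = 0 := fun h0 => by
    filter_upwards [(integral_eq_zero_iff_of_nonneg (fun _ => abs_nonneg _) hu.abs).1 h0] with x hx
    simpa using hx
  rw [← integral_const_mul, ← integral_const_mul, ← integral_neg]
  refine integral_mono_ae (hw.abs.const_mul I).neg (hub.const_mul m) ?_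
  -- If `I = 0`, then `u` vanishes almost everywhere on the boundary and both integrands are zero.
  rcases hI0.eq_or_lt with h0 | hpos
  · filter_upwards [hu0 h0.symm] with x hx
    simp [hx, ← h0]
  · filter_upwards [h] with x hx
    have h1 : I * |w x| = m * |u x * b x| := by
      have : w x = -(m * |u x| / I * b x) := by linarith
      rw [this, abs_neg, abs_mul, abs_div, abs_mul, abs_of_pos hm, abs_of_pos hpos, abs_abs,
        abs_mul]
      field_simp
    have h2 := neg_abs_le (u x * b x)
    rw [h1]
    nlinarith

/-- Boundary functions related by a Robin condition `w + h b = 0` with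
`h = m |u| / ∫ |u|`: upper bound for `∫ w b`. -/
theorem sq_integral_abs_le_of_robin {α : Type*} [MeasurableSpace α] {μ : Measure α}
    {u w b : α → ℝ} {m : ℝ} (hm : 0 < m) (hu : Integrable u μ) (hw : Integrable w μ)
    (hwb : Integrable (fun x => w x * b x) μ)
    (h : ∀ᵐ x ∂μ, w x + m * |u x| / (∫ y, |u y| ∂μ) * b x = 0) :
    (∫ x, |w x| ∂μ) ^ 2 ≤ -(m * ∫ x, w x * b x ∂μ) := by
  set I := ∫ x, |u x| ∂μ with hI
  set J := ∫ x, |w x| ∂μ with hJ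
  have hI0 : 0 ≤ I := integral_nonneg fun _ => abs_nonneg _
  have hJ0 : 0 ≤ J := integral_nonneg fun _ => abs_nonneg _
  have hp : Integrable (fun x => m * |u x| / I) μ := (hu.abs.const_mul m).div_const I
  have h1 : ∫ x, 2 * (J * m) * |w x| ∂μ ≤
      ∫ x, (J ^ 2 * (m * |u x| / I) - m ^ 2 * (w x * b x)) ∂μ := by
    refine integral_mono_ae (hw.abs.const_mul _)
      ((hp.const_mul _).sub (hwb.const_mul _)) ?_
    filter_upwards [h] with x hx
    have hq : 0 ≤ m * |u x| / I := by positivity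
    have hwx : w x = -(m * |u x| / I * b x) := by linarith
    have hwa : |w x| = m * |u x| / I * |b x| := by rw [hwx, abs_neg, abs_mul, abs_of_nonneg hq]
    rw [hwa, hwx]
    generalize m * |u x| / I = q at hq
    -- Weighted Cauchy-Schwarz in pointwise form. Multiplying the square by the weight `q`, instead
    -- of dividing `w²` by it, allows the weight to vanish.
    have h2 := mul_nonneg hq (sq_nonneg (J - m * |b x|))
    have h3 : m ^ 2 * (-(q * b x) * b x) = -(m ^ 2 * q * |b x| ^ 2) := by rw [sq_abs]; ring
    linarith
  rw [integral_sub (hp.const_mul _) (hwb.const_mul _), integral_const_mul, integral_const_mul,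
    integral_const_mul, integral_div, integral_const_mul] at h1
  -- The total mass of the profile is `m`, or `0` if `I = 0`; an upper bound is enough.
  have h2 : m * I / I ≤ m := by
    rw [mul_div_assoc]
    exact mul_le_of_le_one_right hm.le (div_self_le_one I)
  have h3 : J ^ 2 * (m * I / I) ≤ J ^ 2 * m := by gcongr
  have h4 : m * J ^ 2 ≤ m * -(m * ∫ x, w x * b x ∂μ) := by
    change 2 * (J * m) * J ≤ J ^ 2 * (m * I / I) - _ at h1
    linarith
  exact le_of_mul_le_mul_left h4 hm

theorem sq_integral_mul_le {α : Type*} [MeasurableSpace α] {μ : Measure α} {u w : α → ℝ}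
    (hu : MemLp u 2 μ) (hw : MemLp w 2 μ) :
    (∫ x, u x * w x ∂μ) ^ 2 ≤ (∫ x, u x ^ 2 ∂μ) * ∫ x, w x ^ 2 ∂μ := by
  have huw : Integrable (fun x => u x * w x) μ := hu.integrable_mul hw
  have key : ∀ t : ℝ, 0 ≤ (∫ x, u x ^ 2 ∂μ) * (t * t) + (2 * ∫ x, u x * w x ∂μ) * t +
      ∫ x, w x ^ 2 ∂μ := by
    intro t
    have h1 : 0 ≤ ∫ x, (u x ^ 2 * (t * t) + (2 * (u x * w x)) * t + w x ^ 2) ∂μ :=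
      integral_nonneg fun x => by
        have := sq_nonneg (u x * t + w x)
        simp only [Pi.zero_apply]
        linarith
    have i1 : Integrable (fun x => u x ^ 2 * (t * t)) μ := hu.integrable_sq.mul_const _
    have i2 : Integrable (fun x => 2 * (u x * w x) * t) μ := (huw.const_mul 2).mul_const t
    have i3 : Integrable (fun x => u x ^ 2 * (t * t) + 2 * (u x * w x) * t) μ := i1.add i2
    rwa [integral_add i3 hw.integrable_sq, integral_add i1 i2, integral_mul_const, integral_mul_const,
      integral_const_mul] at h1
  have := discrim_le_zero key
  rw [discrim] at this
  linarith

/-- The numerator of `rayleigh`. -/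
def energy (Ω : Set (EuclideanSpace ℝ (Fin n))) (m : ℝ)
    (v : EuclideanSpace ℝ (Fin n) → ℝ) : ℝ :=
  (∫ x in Ω, ‖∇ v x‖ ^ 2) + 1 / m * (∫ x, |v x| ∂(surfaceMeasure Ω)) ^ 2

theorem rayleigh_eq (Ω : Set (EuclideanSpace ℝ (Fin n))) (m : ℝ)
    (v : EuclideanSpace ℝ (Fin n) → ℝ) :
    rayleigh Ω m v = energy Ω m v / ∫ x in Ω, v x ^ 2 := rfl

theorem IsClassicalRobinSolution.exists_isC1Closure {h f w : EuclideanSpace ℝ (Fin n) → ℝ}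
    (hΩ : IsSmoothBoundedDomain Ω) (hw : IsClassicalRobinSolution Ω h f w) :
    ∃ G, IsC1Closure Ω w G ∧
      ∀ x ∈ frontier Ω, w x + h x * inner ℝ (G x) (outerNormal Ω x) = 0 := by
  obtain ⟨h2, hc, -, G, hG, hGw, hR⟩ := hw
  exact ⟨G, ⟨h2.of_le (by norm_num), hc, hG, hGw⟩, fun x hx =>
    hR x hx _ (hΩ.isOuterUnitNormal hx)⟩

/-- Green's identity for `w` is tested with `u` and with `w`. The first test, with `R_m(u) ∫ u² =
E(u)` and the inequality `2ab ≤ a² + b²` for both the gradient and the boundary products, gives the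
first bound. The second test gives the other one directly. No sign of `u` or `w` is needed. -/
theorem IsAdmissible.energy_le_and_le (hΩ : IsSmoothBoundedDomain Ω) {m : ℝ} (hm : 0 < m)
    {u w : EuclideanSpace ℝ (Fin n) → ℝ} (hu : IsAdmissible Ω u)
    (hN : 0 < ∫ x in Ω, u x ^ 2)
    (hw : IsClassicalRobinSolution Ω (profile Ω m u) (fun x => rayleigh Ω m u * u x) w) :
    energy Ω m u ≤ energy Ω m w ∧
      energy Ω m w ≤ rayleigh Ω m u * ∫ x in Ω, u x * w x := by
  obtain ⟨G, hG, hrobin⟩ := hw.exists_isC1Closure hΩ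
  have hΔ := hw.2.2.1
  obtain ⟨M, hM⟩ := hu.bounded
  have hA := hG.isAdmissible hΩ
  obtain ⟨M', -, -, hM', -⟩ := hG.exists_bound hΩ
  set R := rayleigh Ω m u with hRdef
  set σ := surfaceMeasure Ω
  set b : EuclideanSpace ℝ (Fin n) → ℝ := fun x => inner ℝ (G x) (outerNormal Ω x)
  have hΔ' : ∀ x ∈ Ω, (Δ w) x = -(R * u x) := fun x hx => by linarith [hΔ x hx]
  have hΔb : ∀ x ∈ Ω, |(Δ w) x| ≤ |R| * M := fun x hx => by
    rw [hΔ' x hx, abs_neg, abs_mul]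
    exact mul_le_mul_of_nonneg_left (hM x hx) (abs_nonneg R)
  have hΩm := hΩ.isOpen.measurableSet
  have gl2 : ∀ v, IsAdmissible Ω v →
      IntegrableOn (fun x => (inner ℝ (∇ v x) (∇ w x) : ℝ)) Ω := fun v hv =>
    (hv.isH1With.memLp_gradient.norm.integrable_mul hA.isH1With.memLp_gradient.norm).mono'
      (hv.isH1With.memLp_gradient.1.inner hA.isH1With.memLp_gradient.1)
      (Eventually.of_forall fun x => norm_inner_le_norm _ _)
  have hgreen : ∀ v, IsAdmissible Ω v →
      (∫ x in Ω, inner ℝ (∇ v x) (∇ w x)) - R * ∫ x in Ω, u x * v x = ∫ x, v x * b x ∂σ := by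
    intro v hv
    have i1 : IntegrableOn (fun x => R * (u x * v x)) Ω :=
      (hu.isH1With.memLp.integrable_mul hv.isH1With.memLp).const_mul R
    rw [← hv.green w G _ hG hw.1 hΔb, ← integral_const_mul, ← integral_sub (gl2 v hv) i1]
    refine setIntegral_congr_fun hΩm fun x hx => ?_
    simp only [hΔ' x hx]
    ring
  have hbb : ∀ᵐ x ∂σ, ‖b x‖ ≤ M' := by
    filter_upwards [IsSmoothBoundedDomain.ae_mem_frontier Ω] with x hx
    refine (norm_inner_le_norm _ _).trans ?_
    rw [hΩ.norm_outerNormal hx, mul_one]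
    exact hM' x (frontier_subset_closure hx)
  have hbm : AEStronglyMeasurable b σ := (hΩ.integrable_surfaceMeasure
    ((hG.continuousOn_gradient.mono frontier_subset_closure).inner
      hΩ.continuousOn_outerNormal)).aestronglyMeasurable
  have hae : ∀ᵐ x ∂σ, w x + m * |u x| / (∫ y, |u y| ∂σ) * b x = 0 := by
    filter_upwards [IsSmoothBoundedDomain.ae_mem_frontier Ω] with x hx using hrobin x hx
  have b1 := neg_le_integral_mul_of_robin hm hu.integrable_boundary hA.integrable_boundary
    (hu.integrable_boundary.mul_bdd hbm hbb) hae
  have b2 := sq_integral_abs_le_of_robin hm hu.integrable_boundary hA.integrable_boundary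
    (hA.integrable_boundary.mul_bdd hbm hbb) hae
  rw [← hgreen u hu] at b1
  rw [← hgreen w hA] at b2
  have hRN : R * ∫ x in Ω, u x * u x = energy Ω m u := by
    simp only [← sq]
    rw [hRdef, rayleigh_eq, div_mul_cancel₀ _ hN.ne']
  rw [hRN] at b1
  have hDw : ∫ x in Ω, inner ℝ (∇ w x) (∇ w x) = ∫ x in Ω, ‖∇ w x‖ ^ 2 := by
    simp only [real_inner_self_eq_norm_sq]
  rw [hDw] at b2
  have hamgm : 2 * ∫ x in Ω, inner ℝ (∇ u x) (∇ w x) ≤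
      (∫ x in Ω, ‖∇ u x‖ ^ 2) + ∫ x in Ω, ‖∇ w x‖ ^ 2 := by
    rw [← integral_const_mul, ← integral_add hu.isH1With.memLp_gradient.norm.integrable_sq
      hA.isH1With.memLp_gradient.norm.integrable_sq]
    refine integral_mono ((gl2 u hu).const_mul 2)
      (hu.isH1With.memLp_gradient.norm.integrable_sq.add
        hA.isH1With.memLp_gradient.norm.integrable_sq) fun x => ?_
    have h1 := real_inner_le_norm (∇ u x) (∇ w x)
    have h2 := sq_nonneg (‖∇ u x‖ - ‖∇ w x‖)
    linarith
  have hu' : m * energy Ω m u =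
      m * (∫ x in Ω, ‖∇ u x‖ ^ 2) + (∫ x, |u x| ∂σ) ^ 2 := by
    unfold energy; field_simp; rfl
  have hw' : m * energy Ω m w =
      m * (∫ x in Ω, ‖∇ w x‖ ^ 2) + (∫ x, |w x| ∂σ) ^ 2 := by
    unfold energy; field_simp; rfl
  constructor
  · refine le_of_mul_le_mul_left (a := m) ?_ hm
    have := mul_le_mul_of_nonneg_left hamgm hm.le
    nlinarith [sq_nonneg ((∫ x, |u x| ∂σ) - ∫ x, |w x| ∂σ)]
  · refine le_of_mul_le_mul_left (a := m) ?_ hm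
    linarith

theorem integral_sq_eq_l2Norm_sq (Ω : Set (EuclideanSpace ℝ (Fin n)))
    (v : EuclideanSpace ℝ (Fin n) → ℝ) : ∫ x in Ω, v x ^ 2 = l2Norm Ω v ^ 2 :=
  (Real.sq_sqrt (integral_nonneg fun _ => sq_nonneg _)).symm

/-- One step of the iteration. -/
theorem IsAdmissible.iteration_step (hΩ : IsSmoothBoundedDomain Ω) {m : ℝ} (hm : 0 < m)
    {u w : EuclideanSpace ℝ (Fin n) → ℝ} (hu : IsAdmissible Ω u)
    (hN : 0 < l2Norm Ω u) (hR : 0 < rayleigh Ω m u)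
    (hw : IsClassicalRobinSolution Ω (profile Ω m u) (fun x => rayleigh Ω m u * u x) w) :
    rayleigh Ω m w * l2Norm Ω w ≤ rayleigh Ω m u * l2Norm Ω u ∧
      l2Norm Ω u ≤ l2Norm Ω w ∧ rayleigh Ω m w ≤ rayleigh Ω m u ∧ 0 < rayleigh Ω m w := by
  obtain ⟨G, hG, -⟩ := hw.exists_isC1Closure hΩ
  have hA := hG.isAdmissible hΩ
  have hN2 : 0 < ∫ x in Ω, u x ^ 2 := by rw [integral_sq_eq_l2Norm_sq]; positivity
  obtain ⟨h1, h2⟩ := hu.energy_le_and_le hΩ hm hN2 hw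
  have hcs := sq_integral_mul_le hu.isH1With.memLp hA.isH1With.memLp
  have hl0 : 0 ≤ l2Norm Ω w := Real.sqrt_nonneg _
  rw [integral_sq_eq_l2Norm_sq, integral_sq_eq_l2Norm_sq, ← mul_pow] at hcs
  have hP := le_of_sq_le_sq hcs (by positivity)
  have eu : energy Ω m u = rayleigh Ω m u * l2Norm Ω u ^ 2 := by
    rw [rayleigh_eq, ← integral_sq_eq_l2Norm_sq, div_mul_cancel₀ _ hN2.ne']
  -- Together with `E(u) = R_m(u) ‖u‖² ≤ E(w) = R_m(w) ‖w‖²`, this bound gives norm growth after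
  -- cancelling `R_m(u) ‖u‖`, and the decay of `R_m ‖·‖` after cancelling `‖w‖`.
  have h3 : energy Ω m w ≤ rayleigh Ω m u * (l2Norm Ω u * l2Norm Ω w) :=
    h2.trans (mul_le_mul_of_nonneg_left hP hR.le)
  have h4 : l2Norm Ω u ≤ l2Norm Ω w := by
    have : (rayleigh Ω m u * l2Norm Ω u) * l2Norm Ω u ≤
        (rayleigh Ω m u * l2Norm Ω u) * l2Norm Ω w := by
      rw [eu] at h1; linarith
    exact le_of_mul_le_mul_left this (by positivity)
  have hNw : 0 < l2Norm Ω w := hN.trans_le h4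
  have ew : energy Ω m w = rayleigh Ω m w * l2Norm Ω w ^ 2 := by
    rw [rayleigh_eq, ← integral_sq_eq_l2Norm_sq, div_mul_cancel₀]
    rw [integral_sq_eq_l2Norm_sq]; positivity
  have h5 : rayleigh Ω m w * l2Norm Ω w ≤ rayleigh Ω m u * l2Norm Ω u := by
    refine le_of_mul_le_mul_right (a := l2Norm Ω w) ?_ hNw
    rw [ew] at h3; linarith
  have h6 : 0 < rayleigh Ω m w := by
    have : 0 < rayleigh Ω m w * l2Norm Ω w ^ 2 := by
      rw [← ew]; refine lt_of_lt_of_le ?_ h1; rw [eu]; positivity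
    exact pos_of_mul_pos_left this (by positivity)
  refine ⟨h5, h4, le_of_mul_le_mul_right (h5.trans ?_) hNw, h6⟩
  exact mul_le_mul_of_nonneg_left h4 hR.le

/-! ### Positivity, the `H¹` norm and a lower bound for the functional. -/

theorem IsSmoothBoundedDomain.surfaceMeasure_ne_zero (hΩ : IsSmoothBoundedDomain Ω)
    (hn : 1 ≤ n) : surfaceMeasure Ω ≠ 0 := by
  intro h0
  set e : EuclideanSpace ℝ (Fin n) := EuclideanSpace.single ⟨0, hn⟩ 1
  -- Gauss' formula for a coordinate function expresses the volume of `Ω`, which is positive, as a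
  -- boundary integral.
  have h1 := hΩ.setIntegral_fderiv (f := fun x => inner ℝ e x) (innerSL ℝ e).contDiff e
  have h2 : ∀ x, fderiv ℝ (fun x => (inner ℝ e x : ℝ)) x e = 1 := fun x => by
    have : fderiv ℝ (fun x => (inner ℝ e x : ℝ)) x = innerSL ℝ e := (innerSL ℝ e).fderiv
    rw [this, innerSL_apply_apply, real_inner_self_eq_norm_sq]
    simp [e]
  simp only [h2, h0, integral_zero_measure] at h1
  have := hΩ.isFiniteMeasure_restrict
  have h3 : 0 < volume Ω := hΩ.isOpen.measure_pos volume hΩ.isConnected.nonempty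
  have h4 : volume Ω ≠ ⊤ := hΩ.isBounded.measure_lt_top.ne
  simp only [integral_const, smul_eq_mul, mul_one, measureReal_restrict_apply_univ] at h1
  exact (ENNReal.toReal_pos h3.ne' h4).ne' h1

theorem IsAdmissible.l2Norm_pos (hΩ : IsSmoothBoundedDomain Ω)
    {v : EuclideanSpace ℝ (Fin n) → ℝ} (hv : IsAdmissible Ω v) (h0 : ∀ x ∈ Ω, 0 < v x) :
    0 < l2Norm Ω v := by
  refine Real.sqrt_pos.2 ?_
  rw [setIntegral_pos_iff_support_of_nonneg_ae (Eventually.of_forall fun _ => sq_nonneg _)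
    hv.isH1With.memLp.integrable_sq]
  have : Ω ⊆ (Function.support fun x => v x ^ 2) ∩ Ω := fun x hx =>
    ⟨(pow_pos (h0 x hx) 2).ne', hx⟩
  exact (hΩ.isOpen.measure_pos volume hΩ.isConnected.nonempty).trans_le (measure_mono this)

theorem IsAdmissible.rayleigh_pos (hΩ : IsSmoothBoundedDomain Ω) (hn : 1 ≤ n) {m : ℝ}
    (hm : 0 < m) {v : EuclideanSpace ℝ (Fin n) → ℝ} (hv : IsAdmissible Ω v)
    (h0 : ∀ x ∈ closure Ω, 0 < v x) : 0 < rayleigh Ω m v := by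
  have hI : 0 < ∫ x, |v x| ∂(surfaceMeasure Ω) := by
    refine lt_of_le_of_ne (integral_nonneg fun _ => abs_nonneg _) fun h => ?_
    have h1 := (integral_eq_zero_iff_of_nonneg (fun _ => abs_nonneg _)
      hv.integrable_boundary.abs).1 h.symm
    refine hΩ.surfaceMeasure_ne_zero hn (ae_eq_bot.1 (eventually_false_iff_eq_bot.1 ?_))
    filter_upwards [h1, IsSmoothBoundedDomain.ae_mem_frontier Ω] with x hx hxf
    exact (h0 x (frontier_subset_closure hxf)).ne' (by simpa using hx)
  have hN := hv.l2Norm_pos hΩ fun x hx => h0 x (subset_closure hx)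
  rw [rayleigh_eq, integral_sq_eq_l2Norm_sq]
  have hD : 0 ≤ ∫ x in Ω, ‖∇ v x‖ ^ 2 := integral_nonneg fun _ => sq_nonneg _
  unfold energy
  positivity

theorem IsAdmissible.h1NormLE {m : ℝ} (hm : 0 < m)
    {v : EuclideanSpace ℝ (Fin n) → ℝ} (hv : IsAdmissible Ω v) (hN : 0 < l2Norm Ω v) :
    H1NormLE Ω v (Real.sqrt (1 + rayleigh Ω m v) * l2Norm Ω v) := by
  refine ⟨_, hv.isH1With, ?_⟩
  have h1 : (∫ x in Ω, ‖∇ v x‖ ^ 2) ≤ rayleigh Ω m v * ∫ x in Ω, v x ^ 2 := by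
    rw [rayleigh_eq, div_mul_cancel₀ _ (by rw [integral_sq_eq_l2Norm_sq]; positivity)]
    exact le_add_of_nonneg_right (by positivity)
  rw [l2Norm, ← Real.sqrt_mul' _ (integral_nonneg fun _ => sq_nonneg _)]
  exact Real.sqrt_le_sqrt (by linarith)

theorem H1NormLE.mono {v : EuclideanSpace ℝ (Fin n) → ℝ} {C C' : ℝ} (h : H1NormLE Ω v C)
    (hC : C ≤ C') : H1NormLE Ω v C' :=
  h.imp fun _ hG => ⟨hG.1, hG.2.trans hC⟩

/-- The functional `rayleigh` is bounded below by a positive constant. -/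
theorem IsSmoothBoundedDomain.exists_one_le_mul_rayleigh (hΩ : IsSmoothBoundedDomain Ω)
    (hn : 1 ≤ n) {m : ℝ} (hm : 0 < m) :
    ∃ C, 0 ≤ C ∧ ∀ v G, IsC1Closure Ω v G → 0 < l2Norm Ω v → 1 ≤ C * rayleigh Ω m v := by
  obtain ⟨C, hC, h⟩ := hΩ.exists_integral_sq_le hn
  -- The factor `1 + m` absorbs the weight `1 / m`: `(1 + m)(D + I² / m) ≥ D + I²`.
  refine ⟨C * (1 + m), by positivity, fun v G hv hN => ?_⟩
  have hN2 : 0 < ∫ x in Ω, v x ^ 2 := by rw [integral_sq_eq_l2Norm_sq]; positivity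
  rw [rayleigh_eq, ← mul_div_assoc, one_le_div hN2]
  refine (h v G hv).trans ?_
  rw [mul_assoc]
  refine mul_le_mul_of_nonneg_left ?_ hC
  have hD : 0 ≤ ∫ x in Ω, ‖∇ v x‖ ^ 2 := integral_nonneg fun _ => sq_nonneg _
  unfold energy
  set D := ∫ x in Ω, ‖∇ v x‖ ^ 2
  set I := ∫ x, |v x| ∂(surfaceMeasure Ω)
  have : (1 + m) * (D + 1 / m * I ^ 2) = D + I ^ 2 + (m * D + 1 / m * I ^ 2) := by
    field_simp; ring
  rw [this]
  exact le_add_of_nonneg_right (by positivity)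

end OptimalInsulation

end

/-! ### Monotonicity and boundedness of the iteration. -/

theorem mainTheorem7 (n : ℕ) (hn : 2 ≤ n) (Ω : Set (EuclideanSpace ℝ (Fin n)))
    (hΩ : OptimalInsulation.IsSmoothBoundedDomain Ω) (m : ℝ) (hm : 0 < m)
    (u : ℕ → EuclideanSpace ℝ (Fin n) → ℝ) (hu : OptimalInsulation.IsIteration Ω m u) :
    (∀ k, OptimalInsulation.rayleigh Ω m (u (k + 1)) * OptimalInsulation.l2Norm Ω (u (k + 1)) ≤
      OptimalInsulation.rayleigh Ω m (u k) * OptimalInsulation.l2Norm Ω (u k)) ∧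
    (∀ k, OptimalInsulation.l2Norm Ω (u k) ≤ OptimalInsulation.l2Norm Ω (u (k + 1))) ∧
    (∀ k, OptimalInsulation.rayleigh Ω m (u (k + 1)) ≤ OptimalInsulation.rayleigh Ω m (u k)) ∧
    (∃ C, ∀ k, OptimalInsulation.H1NormLE Ω (u k) C) := by
  have hn1 : 1 ≤ n := one_le_two.trans hn
  have hadm : ∀ k, OptimalInsulation.IsAdmissible Ω (u k) := by
    rintro (_ | k)
    · exact hu.zero_trace.isAdmissible hΩ hu.zero_contDiffOn hu.zero_bounded
    · obtain ⟨G, hG, -⟩ := (hu.step k).exists_isC1Closure hΩ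
      exact hG.isAdmissible hΩ
  -- Pointwise positivity is used only for `u 0`. What propagates is that the norm and the
  -- functional stay positive, which is all that one step requires.
  have hpos : ∀ k, 0 < OptimalInsulation.l2Norm Ω (u k) ∧
      0 < OptimalInsulation.rayleigh Ω m (u k) := by
    intro k
    induction k with
    | zero => exact ⟨(hadm 0).l2Norm_pos hΩ fun x hx => hu.zero_pos x (subset_closure hx),
        (hadm 0).rayleigh_pos hΩ hn1 hm hu.zero_pos⟩
    | succ k ih =>
      obtain ⟨-, h2, -, h4⟩ := (hadm k).iteration_step hΩ hm ih.1 ih.2 (hu.step k)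
      exact ⟨ih.1.trans_le h2, h4⟩
  have hstep := fun k => (hadm k).iteration_step hΩ hm (hpos k).1 (hpos k).2 (hu.step k)
  refine ⟨fun k => (hstep k).1, fun k => (hstep k).2.1, fun k => (hstep k).2.2.1, ?_⟩
  have hanti : Antitone fun k => OptimalInsulation.rayleigh Ω m (u k) :=
    antitone_nat_of_succ_le fun k => (hstep k).2.2.1
  have hanti' : Antitone fun k =>
      OptimalInsulation.rayleigh Ω m (u k) * OptimalInsulation.l2Norm Ω (u k) :=
    antitone_nat_of_succ_le fun k => (hstep k).1
  obtain ⟨C, hC, hlow⟩ := hΩ.exists_one_le_mul_rayleigh hn1 hm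
  have hbound : ∀ k, OptimalInsulation.l2Norm Ω (u (k + 1)) ≤
      C * (OptimalInsulation.rayleigh Ω m (u 0) * OptimalInsulation.l2Norm Ω (u 0)) := by
    intro k
    obtain ⟨G, hG, -⟩ := (hu.step k).exists_isC1Closure hΩ
    calc OptimalInsulation.l2Norm Ω (u (k + 1))
        ≤ C * OptimalInsulation.rayleigh Ω m (u (k + 1)) *
            OptimalInsulation.l2Norm Ω (u (k + 1)) :=
          le_mul_of_one_le_left (hpos (k + 1)).1.le (hlow _ G hG (hpos (k + 1)).1)
      _ ≤ _ := by
          rw [mul_assoc]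
          exact mul_le_mul_of_nonneg_left (hanti' (Nat.zero_le _)) hC
  refine ⟨√(1 + OptimalInsulation.rayleigh Ω m (u 0)) *
    (C * (OptimalInsulation.rayleigh Ω m (u 0) * OptimalInsulation.l2Norm Ω (u 0))),
    fun k => ((hadm k).h1NormLE hm (hpos k).1).mono ?_⟩
  refine mul_le_mul (Real.sqrt_le_sqrt (by linarith [hanti (Nat.zero_le k)])) ?_
    (Real.sqrt_nonneg _) (Real.sqrt_nonneg _)
  -- The lower bound for the functional covers functions `C¹` up to the boundary, hence the iterates
  -- from `u 1` on. The norm of `u 0` is bounded through that of `u 1`.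
  rcases k with _ | k
  · exact (hstep 0).2.1.trans (hbound 0)
  · exact hbound k
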